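/- Let $u_1,u_2\ge 1$ and $\gamma>1$. Consider the control system $$\dot x_1=x_2,\qquad \dot x_2=-u\,x_1+\frac1{x_1^3},\qquad x_1>0,$$ with Lebesgue measurable controls $u$ taking values in $[-u_1,u_2]$ almost everywhere. A *transfer* of duration $T$ is a controlled trajectory $(x,u)$ on $[0,T]$ with $x(0)=(1,0)$ and $x(T)=(\gamma,0)$; it is *time-optimal* if $T$ is minimal among all transfers. It is an *extremal* if it satisfies the conditions of the Pontryagin maximum principle: there are a constant $\lambda_0\le 0$ and a nowhere vanishing absolutely continuous $\lambda=(\lambda_1,\lambda_2)$ on $[0,T]$ such that, with $H(v)=\lambda_0+\lambda_1x_2+\lambda_2(x_1^{-3}-x_1v)$, one has $\dot\lambda_1=\lambda_2(u+3x_1^{-4})$, $\dot\lambda_2=-\lambda_1$, and for almost every $t$ the function $H$ attains its maximum over $[-u_1,u_2]$ at $v=u(t)$, with $H(u(t))=0$. An $X$-segment (a $Y$-segment) is a time interval of positive length on which $u=-u_1$ ($u=u_2$). A transfer *has one switching* if it is an $X$-segment followed by a $Y$-segment, and *has $n$ turns* ($n\ge1$) if it consists of $2n+1$ alternating segments $YX\cdots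 YXY$ ($2n$ switchings). Put $$T_0=\frac1{\sqrt{u_1}}\sinh^{-1}\sqrt{\frac{u_1(\gamma^2-1)(u_2\gamma^2-1)}{\gamma^2(u_1+u_2)(u_1+1)}}+\frac1{\sqrt{u_2}}\sin^{-1}\sqrt{\frac{u_2(\gamma^2-1)(u_1\gamma^2+1)}{(u_1+u_2)(u_2\gamma^4-1)}},$$ $c_1=u_2+1$, $c_{n+1}=u_2\gamma^2+\gamma^{-2}$, $s_+=(u_2-1)^2/4$, and, for $s\in(u_1,s_+]$, $$T_I=\frac1{2\sqrt{u_2}}\cos^{-1}\!\left(-\frac{sc_1+u_2\sqrt{c_1^2-4(s+u_2)}}{(s+u_2)\sqrt{c_1^2-4u_2}}\right),\qquad T_F=\frac1{2\sqrt{u_2}}\cos^{-1}\!\left(\frac{-sc_{n+1}+u_2\sqrt{c_{n+1}^2-4(s+u_2)}}{(s+u_2)\sqrt{c_{n+1}^2-4u_2}}\right),$$ $$T_X(s)=\frac1{2\sqrt{u_1}}\cosh^{-1}\!\left(\frac{s+u_1}{s-u_1}\right),\qquad T_Y=\frac1{2\sqrt{u_2}}\left(2\pi-\cos^{-1}\frac{s-u_2}{s+u_2}\right),$$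 $$T_n=T_I+nT_X(s)+(n-1)T_Y+T_F .$$ 1. (One switching.) $T_0$ is the least duration of a transfer with one switching. Moreover, extremal transfers with one switching exist and all of them have duration $T_0$. 2. ($n$ turns.) For every $n\ge1$: (a) the equation $$\frac{c_1+\sqrt{c_1^2-4(s+u_2)}}{c_{n+1}+\sqrt{c_{n+1}^2-4(s+u_2)}}=\left(\frac{s-u_1}{s+u_2}\right)^n\qquad(*)$$ has at most one solution $s$ in the interval $u_1<s\le s_+$; (b) if $(*)$ has a solution $s\in(u_1,s_+]$, then there is an extremal transfer with $n$ turns whose initial segment lasts $T_I$, whose $n$ $X$-segments each last $T_X(s)$, whose $n-1$ intermediate $Y$-segments each last $T_Y$ and whose final segment lasts $T_F$, so that its duration is $T_n$; and $T_n$ is the least duration of an extremal transfer with $n$ turns; (c) if a time-optimal transfer has $n$ turns, then $(*)$ has a solution $s\in(u_1,s_+]$, the segments of the transfer have the durations listed in (b), its total duration is $T_n$, and $$n\le\left[\frac{T_0}{T_X(s_+)}\right],$$ where $[\,\cdot\,]$ denotes the integer part; (d) the same inequality $n\le[T_0/T_X(s_+)]$ holds for every extremal transfer with $n$ turns whose duration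 is at most $T_0$. -/

import Mathlib

open Set MeasureTheory

namespace TrapCooling

noncomputable section

/-! ### The control system, its trajectories and its extremals -/

/-- Right-hand side of `ẋ₁ = x₂`, `ẋ₂ = -u x₁ + 1 / x₁³`. -/
def field (u : ℝ) (x : ℝ × ℝ) : ℝ × ℝ :=
  (x.2, -u * x.1 + 1 / x.1 ^ 3)

/-- `(x, u)` is a controlled trajectory on `[0, T]`: the control `u` is Lebesgue measurable with
values in `[-u₁, u₂]` almost everywhere, and `x` is a (Carathéodory) solution of `ẋ = field u x`
which stays in the domain `x₁ > 0`. -/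
structure IsControlledTrajectory (u₁ u₂ T : ℝ) (x : ℝ → ℝ × ℝ) (u : ℝ → ℝ) : Prop where
  nonneg : 0 ≤ T
  measurable : AEMeasurable u (volume.restrict (Icc 0 T))
  mem_control_set : ∀ᵐ t ∂(volume.restrict (Icc 0 T)), u t ∈ Icc (-u₁) u₂
  continuousOn : ContinuousOn x (Icc 0 T)
  pos : ∀ t ∈ Icc 0 T, 0 < (x t).1
  solves : ∀ t ∈ Icc 0 T, x t = x 0 + ∫ r in (0 : ℝ)..t, field (u r) (x r)

/-- A controlled trajectory on `[0, T]` that goes from `(1, 0)` to `(γ, 0)`. -/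
structure IsTransfer (u₁ u₂ γ T : ℝ) (x : ℝ → ℝ × ℝ) (u : ℝ → ℝ) : Prop where
  trajectory : IsControlledTrajectory u₁ u₂ T x u
  start : x 0 = (1, 0)
  finish : x T = (γ, 0)

/-- A transfer whose duration is minimal among all transfers. -/
def IsTimeOptimal (u₁ u₂ γ T : ℝ) (x : ℝ → ℝ × ℝ) (u : ℝ → ℝ) : Prop :=
  IsTransfer u₁ u₂ γ T x u ∧
    ∀ (T' : ℝ) (x' : ℝ → ℝ × ℝ) (u' : ℝ → ℝ), IsTransfer u₁ u₂ γ T' x' u' → T ≤ T'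

/-- The control Hamiltonian `λ₀ + ⟨λ, f(x) + u g(x)⟩`. -/
def hamiltonian (l₀ : ℝ) (l x : ℝ × ℝ) (u : ℝ) : ℝ :=
  l₀ + l.1 * (field u x).1 + l.2 * (field u x).2

/-- Right-hand side `-∂H/∂x` of the adjoint equation:
`λ̇₁ = λ₂ (u + 3 / x₁⁴)`, `λ̇₂ = -λ₁`. -/
def adjointField (u : ℝ) (x l : ℝ × ℝ) : ℝ × ℝ :=
  (l.2 * (u + 3 / x.1 ^ 4), -l.1)

/-- `(x, u)` is an extremal on `[0, T]`: there are multipliers `λ₀ ≤ 0` and `λ`, with `λ`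
nowhere zero and absolutely continuous, that satisfy the adjoint equation, the maximum condition
and the vanishing of the Hamiltonian. -/
def IsExtremal (u₁ u₂ T : ℝ) (x : ℝ → ℝ × ℝ) (u : ℝ → ℝ) : Prop :=
  ∃ (l₀ : ℝ) (l : ℝ → ℝ × ℝ), l₀ ≤ 0 ∧ ContinuousOn l (Icc 0 T) ∧
    (∀ t ∈ Icc 0 T, l t ≠ 0) ∧
    (∀ t ∈ Icc 0 T, l t = l 0 + ∫ r in (0 : ℝ)..t, adjointField (u r) (x r) (l r)) ∧
    (∀ᵐ t ∂(volume.restrict (Icc 0 T)), ∀ v ∈ Icc (-u₁) u₂,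
      hamiltonian l₀ (l t) (x t) v ≤ hamiltonian l₀ (l t) (x t) (u t)) ∧
    (∀ᵐ t ∂(volume.restrict (Icc 0 T)), hamiltonian l₀ (l t) (x t) (u t) = 0)

/-! ### Bang-bang controls -/

/-- On `[0, T]` the control `u` has exactly the `N` switching times `t 1 < ⋯ < t N` in `(0, T)`,
and it equals `v k` on the `k`-th segment `(t k, t (k + 1))`, where `t 0 = 0`, `t (N + 1) = T`
(up to the values of `u` on a null set). -/
def IsBangBang (T : ℝ) (u : ℝ → ℝ) (N : ℕ) (t v : ℕ → ℝ) : Prop :=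
  t 0 = 0 ∧ t (N + 1) = T ∧ (∀ k ≤ N, t k < t (k + 1)) ∧
    ∀ k ≤ N, ∀ᵐ r, r ∈ Ioo (t k) (t (k + 1)) → u r = v k

/-- The form `XY`: an `X`-segment (`u = -u₁`), one switching, a `Y`-segment (`u = u₂`). -/
def IsOneSwitching (u₁ u₂ T : ℝ) (u : ℝ → ℝ) (t : ℕ → ℝ) : Prop :=
  IsBangBang T u 1 t (fun k => if Even k then -u₁ else u₂)

/-- The spiral form `YX…YXY` with `n` turns, i.e. `2n` switchings: the segments with even index
are `Y`-segments (`u = u₂`), those with odd index are `X`-segments (`u = -u₁`). -/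
def HasTurns (u₁ u₂ T : ℝ) (u : ℝ → ℝ) (n : ℕ) (t : ℕ → ℝ) : Prop :=
  IsBangBang T u (2 * n) t (fun k => if Even k then u₂ else -u₁)

/-! ### The explicit times -/

/-- `T₀`. -/
def timeZero (u₁ u₂ γ : ℝ) : ℝ :=
  1 / √u₁ * Real.arsinh
      (√(u₁ * (γ ^ 2 - 1) * (u₂ * γ ^ 2 - 1) / (γ ^ 2 * (u₁ + u₂) * (u₁ + 1)))) +
    1 / √u₂ * Real.arcsin
      (√(u₂ * (γ ^ 2 - 1) * (u₁ * γ ^ 2 + 1) / ((u₁ + u₂) * (u₂ * γ ^ 4 - 1))))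

/-- `c₁`, the constant of the first `Y`-segment. -/
def cFirst (u₂ : ℝ) : ℝ := u₂ + 1

/-- `c_{n+1}`, the constant of the last `Y`-segment. -/
def cLast (u₂ γ : ℝ) : ℝ := u₂ * γ ^ 2 + 1 / γ ^ 2

/-- `s₊`, the upper end of the interval for `s`. -/
def sPlus (u₂ : ℝ) : ℝ := (u₂ - 1) ^ 2 / 4

/-- `T_I`, the duration of the initial `Y`-segment. -/
def timeInitial (u₂ s : ℝ) : ℝ :=
  1 / (2 * √u₂) * Real.arccos
    (-((s * cFirst u₂ + u₂ * √(cFirst u₂ ^ 2 - 4 * (s + u₂))) /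
      ((s + u₂) * √(cFirst u₂ ^ 2 - 4 * u₂))))

/-- `T_F`, the duration of the final `Y`-segment. -/
def timeFinal (u₂ γ s : ℝ) : ℝ :=
  1 / (2 * √u₂) * Real.arccos
    ((-s * cLast u₂ γ + u₂ * √(cLast u₂ γ ^ 2 - 4 * (s + u₂))) /
      ((s + u₂) * √(cLast u₂ γ ^ 2 - 4 * u₂)))

/-- `T_X`, the duration of each `X`-segment. -/
def timeX (u₁ s : ℝ) : ℝ :=
  1 / (2 * √u₁) * Real.arcosh ((s + u₁) / (s - u₁))

/-- `T_Y`, the duration of each intermediate `Y`-segment. -/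
def timeY (u₂ s : ℝ) : ℝ :=
  1 / (2 * √u₂) * (2 * Real.pi - Real.arccos ((s - u₂) / (s + u₂)))

/-- `T_n = T_I + n T_X + (n - 1) T_Y + T_F`. -/
def timeTurns (u₁ u₂ γ : ℝ) (n : ℕ) (s : ℝ) : ℝ :=
  timeInitial u₂ s + n * timeX u₁ s + ((n : ℝ) - 1) * timeY u₂ s + timeFinal u₂ γ s

/-- `s` solves the transcendental equation for `n` turns in the interval `u₁ < s ≤ s₊`. -/
def IsRatio (u₁ u₂ γ : ℝ) (n : ℕ) (s : ℝ) : Prop :=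
  s ∈ Ioc u₁ (sPlus u₂) ∧
    (cFirst u₂ + √(cFirst u₂ ^ 2 - 4 * (s + u₂))) /
        (cLast u₂ γ + √(cLast u₂ γ ^ 2 - 4 * (s + u₂))) =
      ((s - u₁) / (s + u₂)) ^ n

/-- The segments of a schedule with `n` turns last `T_I`, then alternately `T_X` and `T_Y`, and
finally `T_F`. -/
def HasDurations (u₁ u₂ γ : ℝ) (n : ℕ) (s : ℝ) (t : ℕ → ℝ) : Prop :=
  t 1 - t 0 = timeInitial u₂ s ∧
    (∀ j < n, t (2 * j + 2) - t (2 * j + 1) = timeX u₁ s) ∧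
    (∀ j, 1 ≤ j → j < n → t (2 * j + 1) - t (2 * j) = timeY u₂ s) ∧
    t (2 * n + 1) - t (2 * n) = timeFinal u₂ γ s

end

end TrapCooling

open TrapCooling

/-! In the coordinates `q = x₁²`, `w = x₁ x₂`, `e = x₂² + 1 / x₁²` a constant control `u` gives a
linear system on the surface `q e - w² = 1`. Its flow is congruence of the symmetric matrix with
entries `q, w, w, e` by the fundamental matrix of `y'' = -u y`. Along an extremal the function `φ =
λ₂ x₁` decides the control by its sign. The vanishing of the Hamiltonian yields `φ'' = -4 u φ + 2
λ₀`, and `λ₀ q = φ' w` at each zero of `φ` (`IsBangBang.exists_switching_function`, with converse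
`IsBangBang.isExtremal`).

On an inner segment `φ` vanishes at both ends, which forces `C q + S w = 0` there ("balanced"; `C`,
`S` are the fundamental solutions at the duration of the segment). So the slope `w / q` is reversed
across the segment, all switchings have slopes `∓√s` with one common `s`, and `s` fixes the inner
durations. The values of `q` at the two ends of an inner segment have product `1 / (s - u₁)` for `X`
and `1 / (s + u₂)` for `Y`; telescoping relates the first and the last switching. There `q` is a
root of `(s + u₂) q² - c q + 1 = 0` with `c = c₁` or `c = c_{n+1}`. The last root is necessarily the
larger one; the first may be either and is labelled by `ε`. The smaller root, `ε = -1`, gives the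
equation of the theorem, and `ε = 1` a companion equation (`IsSpiral.hasShape`). Conversely each
solution produces an extremal (`exists_spiral`). For time-optimal transfers the balance comes from a
Lagrange multiplier argument on three consecutive durations (`balanced_of_eventually_le`), so the
maximum principle itself is not needed.

The branches are compared by calculus. With `G` the logarithm of the quotient of the two sides and
`T` the total duration, both as functions of `s`, one has `dT = dG / (2√s)`. Hence `M = T - G /
(2√s)` equals `T` at solutions and satisfies `M' = G / (4 s √s)`. On the branch `ε = -1`, `G` is
strictly decreasing, so the solution is unique. The branches meet at `s₊`, and the sign of `G` shows
that a companion solution is slower (`IsRatio.spiralTime_lt`). If the equation has no solution, a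
companion solution is slower than `T₀` (`oneX_lt`, `oneY_le_timeFinal`). For one switching, the two
conserved energies determine `q` at the switching. The bound on `n` follows from `n T_X(s₊) ≤ n
T_X(s) ≤ T`. -/

namespace TrapCooling

section

/-! ### The linear flow in the coordinates `(x₁², x₁ x₂, x₂² + 1 / x₁²)` -/

/-- The solution `C` of `C'' = -u C`, `C 0 = 1`, `C' 0 = 0`, for `u ≠ 0`. -/
noncomputable def gcos (u t : ℝ) : ℝ :=
  if 0 < u then Real.cos (√u * t) else Real.cosh (√(-u) * t)

/-- The solution `S` of `S'' = -u S`, `S 0 = 0`, `S' 0 = 1`, for `u ≠ 0`. -/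
noncomputable def gsin (u t : ℝ) : ℝ :=
  if 0 < u then Real.sin (√u * t) / √u else Real.sinh (√(-u) * t) / √(-u)

lemma gcos_of_pos {u : ℝ} (hu : 0 < u) (t : ℝ) : gcos u t = Real.cos (√u * t) := if_pos hu

lemma gsin_of_pos {u : ℝ} (hu : 0 < u) (t : ℝ) : gsin u t = Real.sin (√u * t) / √u := if_pos hu

lemma gcos_neg_control {u : ℝ} (hu : 0 < u) (t : ℝ) : gcos (-u) t = Real.cosh (√u * t) := by
  rw [gcos, if_neg (by linarith), neg_neg]

lemma gsin_neg_control {u : ℝ} (hu : 0 < u) (t : ℝ) :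
    gsin (-u) t = Real.sinh (√u * t) / √u := by
  rw [gsin, if_neg (by linarith), neg_neg]

@[simp] lemma gcos_zero (u : ℝ) : gcos u 0 = 1 := by simp [gcos]

@[simp] lemma gsin_zero (u : ℝ) : gsin u 0 = 0 := by simp [gsin]

@[simp] lemma gcos_neg (u t : ℝ) : gcos u (-t) = gcos u t := by simp [gcos]

@[simp] lemma gsin_neg (u t : ℝ) : gsin u (-t) = -gsin u t := by
  simp only [gsin, mul_neg, Real.sin_neg, Real.sinh_neg]
  split_ifs <;> ring

lemma gcos_sq_add {u : ℝ} (hu : u ≠ 0) (t : ℝ) : gcos u t ^ 2 + u * gsin u t ^ 2 = 1 := by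
  rcases lt_or_gt_of_ne hu with h | h
  · have h' : 0 < -u := by linarith
    obtain ⟨v, rfl⟩ : ∃ v, u = -v := ⟨-u, by ring⟩
    simp only [neg_neg] at h'
    rw [gcos_neg_control h', gsin_neg_control h', div_pow, Real.sq_sqrt h'.le]
    have := Real.cosh_sq (√v * t)
    field_simp
    linarith
  · rw [gcos_of_pos h, gsin_of_pos h, div_pow, Real.sq_sqrt h.le]
    have := Real.cos_sq_add_sin_sq (√u * t)
    field_simp
    linarith

lemma hasDerivAt_gsin {u : ℝ} (hu : u ≠ 0) (t : ℝ) : HasDerivAt (gsin u) (gcos u t) t := by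
  rcases lt_or_gt_of_ne hu with h | h
  · have h' : 0 < -u := by linarith
    obtain ⟨v, rfl⟩ : ∃ v, u = -v := ⟨-u, by ring⟩
    simp only [neg_neg] at h'
    have e : gsin (-v) = fun t => Real.sinh (√v * t) / √v := funext (gsin_neg_control h')
    rw [e, gcos_neg_control h']
    have hs : √v ≠ 0 := (Real.sqrt_pos.2 h').ne'
    have := (((hasDerivAt_id' t).const_mul (√v)).sinh).div_const (√v)
    exact this.congr_deriv (by field_simp)
  · have e : gsin u = fun t => Real.sin (√u * t) / √u := funext (gsin_of_pos h)
    rw [e, gcos_of_pos h]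
    have hs : √u ≠ 0 := (Real.sqrt_pos.2 h).ne'
    have := (((hasDerivAt_id' t).const_mul (√u)).sin).div_const (√u)
    exact this.congr_deriv (by field_simp)

lemma hasDerivAt_gcos {u : ℝ} (hu : u ≠ 0) (t : ℝ) :
    HasDerivAt (gcos u) (-u * gsin u t) t := by
  rcases lt_or_gt_of_ne hu with h | h
  · have h' : 0 < -u := by linarith
    obtain ⟨v, rfl⟩ : ∃ v, u = -v := ⟨-u, by ring⟩
    simp only [neg_neg] at h'
    have e : gcos (-v) = fun t => Real.cosh (√v * t) := funext (gcos_neg_control h')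
    rw [e, gsin_neg_control h']
    have hs : √v ≠ 0 := (Real.sqrt_pos.2 h').ne'
    have := ((hasDerivAt_id' t).const_mul (√v)).cosh
    have h2 := Real.sq_sqrt h'.le
    exact this.congr_deriv (by field_simp; rw [h2]; ring)
  · have e : gcos u = fun t => Real.cos (√u * t) := funext (gcos_of_pos h)
    rw [e, gsin_of_pos h]
    have hs : √u ≠ 0 := (Real.sqrt_pos.2 h).ne'
    have := ((hasDerivAt_id' t).const_mul (√u)).cos
    have h2 := Real.sq_sqrt h.le
    exact this.congr_deriv (by field_simp; rw [h2]; ring)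

lemma continuous_gsin {u : ℝ} (hu : u ≠ 0) : Continuous (gsin u) :=
  continuous_iff_continuousAt.2 fun t => (hasDerivAt_gsin hu t).continuousAt

lemma continuous_gcos {u : ℝ} (hu : u ≠ 0) : Continuous (gcos u) :=
  continuous_iff_continuousAt.2 fun t => (hasDerivAt_gcos hu t).continuousAt

/-- The flow of `q' = 2 w`, `w' = e - u q`, `e' = -2 u w`. -/
noncomputable def flow (u t : ℝ) (z : ℝ × ℝ × ℝ) : ℝ × ℝ × ℝ :=
  (gcos u t ^ 2 * z.1 + 2 * gcos u t * gsin u t * z.2.1 + gsin u t ^ 2 * z.2.2,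
    -u * gcos u t * gsin u t * z.1 + (gcos u t ^ 2 - u * gsin u t ^ 2) * z.2.1 +
      gcos u t * gsin u t * z.2.2,
    u ^ 2 * gsin u t ^ 2 * z.1 - 2 * u * gcos u t * gsin u t * z.2.1 + gcos u t ^ 2 * z.2.2)

/-- The region `q > 0`, `q e - w² = 1` which the phase space `x₁ > 0` is mapped onto. -/
def IsState (z : ℝ × ℝ × ℝ) : Prop := 0 < z.1 ∧ z.1 * z.2.2 - z.2.1 ^ 2 = 1

@[simp] lemma flow_zero (u : ℝ) (z : ℝ × ℝ × ℝ) : flow u 0 z = z := by simp [flow]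

lemma flow_flow_neg {u : ℝ} (hu : u ≠ 0) (t : ℝ) (z : ℝ × ℝ × ℝ) :
    flow u t (flow u (-t) z) = z := by
  have h := gcos_sq_add hu t
  obtain ⟨q, w, e⟩ := z
  simp only [flow, gcos_neg, gsin_neg, Prod.mk.injEq]
  set C := gcos u t
  set S := gsin u t
  refine ⟨?_, ?_, ?_⟩
  · linear_combination (q * (C ^ 2 + u * S ^ 2 + 1)) * h
  · linear_combination (w * (C ^ 2 + u * S ^ 2 + 1)) * h
  · linear_combination (e * (C ^ 2 + u * S ^ 2 + 1)) * h

lemma flow_neg_flow {u : ℝ} (hu : u ≠ 0) (t : ℝ) (z : ℝ × ℝ × ℝ) :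
    flow u (-t) (flow u t z) = z := by
  simpa using flow_flow_neg hu (-t) z

/-- The flow is a congruence by a matrix of determinant `C² + u S² = 1`, so it preserves the
determinant `q e - w²`. Positivity of `q` follows by completing a square after multiplication by the
initial `q`. -/
lemma flow_isState {u : ℝ} (hu : u ≠ 0) (t : ℝ) {z : ℝ × ℝ × ℝ} (hz : IsState z) :
    IsState (flow u t z) := by
  have h := gcos_sq_add hu t
  obtain ⟨q, w, e⟩ := z
  obtain ⟨hq, hd⟩ := hz
  simp only at hq hd
  simp only [flow, IsState]
  set C := gcos u t
  set S := gsin u t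
  constructor
  · have e1 : q * (C ^ 2 * q + 2 * C * S * w + S ^ 2 * e) = (C * q + S * w) ^ 2 + S ^ 2 := by
      linear_combination S ^ 2 * hd
    have : 0 < (C * q + S * w) ^ 2 + S ^ 2 := by
      rcases eq_or_ne S 0 with hS | hS
      · have hC : C ≠ 0 := by
          intro hC; rw [hS, hC] at h; norm_num at h
        rw [hS]; simp only [zero_mul, add_zero]
        positivity
      · positivity
    rw [← e1] at this
    exact (pos_iff_pos_of_mul_pos this).1 hq
  · linear_combination (C ^ 2 + u * S ^ 2) ^ 2 * hd + (C ^ 2 + u * S ^ 2 + 1) * h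

/-- The energy `e + u q` is a first integral. -/
lemma flow_energy {u : ℝ} (hu : u ≠ 0) (t : ℝ) (z : ℝ × ℝ × ℝ) :
    (flow u t z).2.2 + u * (flow u t z).1 = z.2.2 + u * z.1 := by
  have h := gcos_sq_add hu t
  simp only [flow]
  linear_combination (z.2.2 + u * z.1) * h

lemma hasDerivAt_flow_fst {u : ℝ} (hu : u ≠ 0) (t : ℝ) (z : ℝ × ℝ × ℝ) :
    HasDerivAt (fun t => (flow u t z).1) (2 * (flow u t z).2.1) t := by
  have hC := hasDerivAt_gcos hu t
  have hS := hasDerivAt_gsin hu t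
  have := (((hC.pow 2).mul_const z.1).add (((hC.const_mul 2).mul hS).mul_const z.2.1)).add
    ((hS.pow 2).mul_const z.2.2)
  refine this.congr_deriv ?_
  simp only [flow]; push_cast; ring

lemma hasDerivAt_flow_snd {u : ℝ} (hu : u ≠ 0) (t : ℝ) (z : ℝ × ℝ × ℝ) :
    HasDerivAt (fun t => (flow u t z).2.1) ((flow u t z).2.2 - u * (flow u t z).1) t := by
  have hC := hasDerivAt_gcos hu t
  have hS := hasDerivAt_gsin hu t
  have := ((((hC.const_mul (-u)).mul hS).mul_const z.1).add
    (((hC.pow 2).sub ((hS.pow 2).const_mul u)).mul_const z.2.1)).add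
    ((hC.mul hS).mul_const z.2.2)
  refine this.congr_deriv ?_
  simp only [flow]; push_cast; ring

lemma hasDerivAt_flow_trd {u : ℝ} (hu : u ≠ 0) (t : ℝ) (z : ℝ × ℝ × ℝ) :
    HasDerivAt (fun t => (flow u t z).2.2) (-2 * u * (flow u t z).2.1) t := by
  have hC := hasDerivAt_gcos hu t
  have hS := hasDerivAt_gsin hu t
  have := ((((hS.pow 2).const_mul (u ^ 2)).mul_const z.1).sub
    (((hC.const_mul (2 * u)).mul hS).mul_const z.2.1)).add ((hC.pow 2).mul_const z.2.2)
  refine this.congr_deriv ?_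
  simp only [flow]; push_cast; ring

/-- `(x₁, x₂) ↦ (x₁², x₁ x₂, x₂² + 1 / x₁²)`. -/
noncomputable def lift (x : ℝ × ℝ) : ℝ × ℝ × ℝ :=
  (x.1 ^ 2, x.1 * x.2, x.2 ^ 2 + 1 / x.1 ^ 2)

/-- The inverse of `lift`. -/
noncomputable def proj (z : ℝ × ℝ × ℝ) : ℝ × ℝ := (√z.1, z.2.1 / √z.1)

lemma proj_lift {x : ℝ × ℝ} (hx : 0 < x.1) : proj (lift x) = x := by
  ext
  · simp [proj, lift, Real.sqrt_sq hx.le]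
  · simp only [proj, lift, Real.sqrt_sq hx.le]; field_simp

lemma lift_proj {z : ℝ × ℝ × ℝ} (hz : IsState z) : lift (proj z) = z := by
  obtain ⟨q, w, e⟩ := z
  obtain ⟨hq, hd⟩ := hz
  simp only at hq hd
  have hs := Real.sqrt_pos.2 hq
  simp only [lift, proj, Prod.mk.injEq, div_pow, Real.sq_sqrt hq.le, true_and]
  refine ⟨by field_simp, ?_⟩
  field_simp; linarith

lemma state_ext {z z' : ℝ × ℝ × ℝ} (hz : IsState z) (hz' : IsState z') (h1 : z.1 = z'.1)
    (h2 : z.2.1 = z'.2.1) : z = z' := by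
  refine Prod.ext h1 (Prod.ext h2 ?_)
  have a := hz.2
  have b := hz'.2
  rw [← h1, ← h2] at b
  have := hz.1.ne'
  exact mul_left_cancel₀ this (by linarith)

lemma proj_fst_pos {z : ℝ × ℝ × ℝ} (hz : IsState z) : 0 < (proj z).1 := Real.sqrt_pos.2 hz.1

lemma hasDerivAt_proj_flow {u : ℝ} (hu : u ≠ 0) (t : ℝ) {z : ℝ × ℝ × ℝ} (hz : IsState z) :
    HasDerivAt (fun t => proj (flow u t z)) (field u (proj (flow u t z))) t := by
  have hst := flow_isState hu t hz
  have hq := hst.1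
  have hd := hst.2
  have hs := Real.sqrt_pos.2 hq
  have h1 := (hasDerivAt_flow_fst hu t z).sqrt hq.ne'
  have h2 := (hasDerivAt_flow_snd hu t z).div h1 hs.ne'
  have h2s := Real.sq_sqrt hq.le
  refine (h1.prodMk h2).congr_deriv ?_
  simp only [proj, field]
  ext
  · simp only; field_simp
  · simp only
    rw [h2s]
    set q := (flow u t z).1
    set w := (flow u t z).2.1
    set e := (flow u t z).2.2
    field_simp
    rw [show √q ^ 4 = (√q ^ 2) ^ 2 by ring, h2s]
    linear_combination q * hd

lemma hasDerivAt_lift {x : ℝ → ℝ × ℝ} {u t : ℝ} (hx : HasDerivAt x (field u (x t)) t)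
    (hp : 0 < (x t).1) :
    HasDerivAt (fun t => (lift (x t)).1) (2 * (lift (x t)).2.1) t ∧
    HasDerivAt (fun t => (lift (x t)).2.1) ((lift (x t)).2.2 - u * (lift (x t)).1) t ∧
    HasDerivAt (fun t => (lift (x t)).2.2) (-2 * u * (lift (x t)).2.1) t := by
  have h1 : HasDerivAt (fun t => (x t).1) (x t).2 t := hx.fst
  have h2 : HasDerivAt (fun t => (x t).2) (-u * (x t).1 + 1 / (x t).1 ^ 3) t := hx.snd
  refine ⟨?_, ?_, ?_⟩
  · refine (h1.pow 2).congr_deriv ?_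
    simp only [lift]; push_cast; ring
  · refine (h1.mul h2).congr_deriv ?_
    simp only [lift]; field_simp; ring
  · have h3 := (h2.pow 2).add ((hasDerivAt_const t (1 : ℝ)).div (h1.pow 2) (pow_pos hp 2).ne')
    refine h3.congr_deriv ?_
    simp only [lift, Pi.pow_apply]; push_cast; field_simp; ring

lemma eq_of_hasDerivAt_zero {f : ℝ → ℝ} {a b : ℝ} (hab : a ≤ b) (hc : ContinuousOn f (Icc a b))
    (hd : ∀ t ∈ Ioo a b, HasDerivAt f 0 t) : f b = f a := by
  rcases hab.eq_or_lt with rfl | h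
  · rfl
  obtain ⟨c, -, h2⟩ := exists_hasDerivAt_eq_slope f (fun _ => 0) h hc hd
  have : b - a ≠ 0 := by linarith
  field_simp at h2
  linarith

/-- Uniqueness for the linear system. -/
lemma eq_flow_of_hasDerivAt {u a b : ℝ} (hu : u ≠ 0) (hab : a ≤ b) {z : ℝ → ℝ × ℝ × ℝ}
    (hc : ContinuousOn z (Icc a b))
    (h1 : ∀ t ∈ Ioo a b, HasDerivAt (fun t => (z t).1) (2 * (z t).2.1) t)
    (h2 : ∀ t ∈ Ioo a b, HasDerivAt (fun t => (z t).2.1) ((z t).2.2 - u * (z t).1) t)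
    (h3 : ∀ t ∈ Ioo a b, HasDerivAt (fun t => (z t).2.2) (-2 * u * (z t).2.1) t) :
    z b = flow u (b - a) (z a) := by
  have hg := continuous_gcos hu
  have hs := continuous_gsin hu
  have dC : ∀ t, HasDerivAt (fun t => gcos u (b - t)) (u * gsin u (b - t)) t := fun t => by
    have := (hasDerivAt_gcos hu (b - t)).comp t ((hasDerivAt_id t).const_sub b)
    refine this.congr_deriv (by ring)
  have dS : ∀ t, HasDerivAt (fun t => gsin u (b - t)) (-gcos u (b - t)) t := fun t => by
    have := (hasDerivAt_gsin hu (b - t)).comp t ((hasDerivAt_id t).const_sub b)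
    refine this.congr_deriv (by ring)
  have c1 : ContinuousOn (fun t => (z t).1) (Icc a b) := hc.fst
  have c2 : ContinuousOn (fun t => (z t).2.1) (Icc a b) := hc.snd.fst
  have c3 : ContinuousOn (fun t => (z t).2.2) (Icc a b) := hc.snd.snd
  -- Each coordinate of `t ↦ flow u (b - t) (z t)` has derivative zero; its values at `b` and `a`
  -- are the two sides of the claim.
  have key : ∀ g : ℝ × ℝ × ℝ → ℝ, (g (flow u (b - b) (z b)) = g (flow u (b - a) (z a))) →
      g (z b) = g (flow u (b - a) (z a)) := by
    intro g hg; simpa using hg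
  refine Prod.ext (key (fun z => z.1) ?_) (Prod.ext (key (fun z => z.2.1) ?_)
    (key (fun z => z.2.2) ?_))
  · refine eq_of_hasDerivAt_zero (f := fun t => (flow u (b - t) (z t)).1) hab ?_ ?_
    · simp only [flow]; fun_prop
    · intro t ht
      have := (((dC t).pow 2).mul (h1 t ht)).add ((((dC t).const_mul 2).mul (dS t)).mul (h2 t ht))
        |>.add (((dS t).pow 2).mul (h3 t ht))
      refine this.congr_deriv ?_
      simp only [Pi.mul_apply, Pi.pow_apply]
      push_cast; ring
  · refine eq_of_hasDerivAt_zero (f := fun t => (flow u (b - t) (z t)).2.1) hab ?_ ?_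
    · simp only [flow]; fun_prop
    · intro t ht
      have := ((((dC t).const_mul (-u)).mul (dS t)).mul (h1 t ht)).add
        ((((dC t).pow 2).sub (((dS t).pow 2).const_mul u)).mul (h2 t ht))
        |>.add (((dC t).mul (dS t)).mul (h3 t ht))
      refine this.congr_deriv ?_
      simp only [Pi.mul_apply, Pi.sub_apply, Pi.pow_apply]
      push_cast; ring
  · refine eq_of_hasDerivAt_zero (f := fun t => (flow u (b - t) (z t)).2.2) hab ?_ ?_
    · simp only [flow]; fun_prop
    · intro t ht
      have := ((((dS t).pow 2).const_mul (u ^ 2)).mul (h1 t ht)).sub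
        ((((dC t).const_mul (2 * u)).mul (dS t)).mul (h2 t ht))
        |>.add (((dC t).pow 2).mul (h3 t ht))
      refine this.congr_deriv ?_
      simp only [Pi.mul_apply, Pi.pow_apply]
      push_cast; ring

/-- The solution of `φ'' = -4 u φ + 2 l₀` with `φ 0 = p`, `φ' 0 = r`. -/
noncomputable def swFun (u l₀ p r t : ℝ) : ℝ :=
  p * (gcos u t ^ 2 - u * gsin u t ^ 2) + r * (gsin u t * gcos u t) + l₀ * gsin u t ^ 2

/-- The derivative of `swFun`. -/
noncomputable def swFunDeriv (u l₀ p r t : ℝ) : ℝ :=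
  -4 * u * p * (gsin u t * gcos u t) + r * (gcos u t ^ 2 - u * gsin u t ^ 2) +
    2 * l₀ * (gsin u t * gcos u t)

lemma hasDerivAt_swFun {u : ℝ} (hu : u ≠ 0) (l₀ p r t : ℝ) :
    HasDerivAt (swFun u l₀ p r) (swFunDeriv u l₀ p r t) t := by
  have hC := hasDerivAt_gcos hu t
  have hS := hasDerivAt_gsin hu t
  have := ((((hC.pow 2).sub ((hS.pow 2).const_mul u)).const_mul p).add
    ((hS.mul hC).const_mul r)).add ((hS.pow 2).const_mul l₀)
  refine this.congr_deriv ?_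
  simp only [swFunDeriv]; push_cast; ring

lemma hasDerivAt_swFunDeriv {u : ℝ} (hu : u ≠ 0) (l₀ p r t : ℝ) :
    HasDerivAt (swFunDeriv u l₀ p r) (-4 * u * swFun u l₀ p r t + 2 * l₀) t := by
  have hC := hasDerivAt_gcos hu t
  have hS := hasDerivAt_gsin hu t
  have := ((((hS.mul hC).const_mul (-4 * u * p))).add
    (((hC.pow 2).sub ((hS.pow 2).const_mul u)).const_mul r)).add ((hS.mul hC).const_mul (2 * l₀))
  refine this.congr_deriv ?_
  have h := gcos_sq_add hu t
  simp only [swFun]; push_cast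
  linear_combination (2 * l₀) * h

/-- Propagating the data at time `t` to the time `r'` gives a value independent of `t`. Comparing
with `t = a` permits `r'` to lie on either side of `r`, which is needed for segments read backwards.
-/
lemma eq_swFun_of_hasDerivAt {u l₀ a b : ℝ} (hu : u ≠ 0) {f g : ℝ → ℝ}
    (hf : ContinuousOn f (Icc a b)) (hg : ContinuousOn g (Icc a b))
    (h1 : ∀ t ∈ Ioo a b, HasDerivAt f (g t) t)
    (h2 : ∀ t ∈ Ioo a b, HasDerivAt g (-4 * u * f t + 2 * l₀) t) {r r' : ℝ} (hr : r ∈ Icc a b)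
    (hr' : r' ∈ Icc a b) :
    f r' = swFun u l₀ (f r) (g r) (r' - r) := by
  have hgc := continuous_gcos hu
  have hgs := continuous_gsin hu
  have dC : ∀ t, HasDerivAt (fun t => gcos u (r' - t)) (u * gsin u (r' - t)) t := fun t => by
    have := (hasDerivAt_gcos hu (r' - t)).comp t ((hasDerivAt_id t).const_sub r')
    refine this.congr_deriv (by ring)
  have dS : ∀ t, HasDerivAt (fun t => gsin u (r' - t)) (-gcos u (r' - t)) t := fun t => by
    have := (hasDerivAt_gsin hu (r' - t)).comp t ((hasDerivAt_id t).const_sub r')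
    refine this.congr_deriv (by ring)
  have main : ∀ c ∈ Icc a b, swFun u l₀ (f c) (g c) (r' - c) =
      swFun u l₀ (f a) (g a) (r' - a) := by
    intro c hc
    have hsub : Icc a c ⊆ Icc a b := Icc_subset_Icc le_rfl hc.2
    refine eq_of_hasDerivAt_zero (f := fun t => swFun u l₀ (f t) (g t) (r' - t)) hc.1 ?_ ?_
    · have := hf.mono hsub
      have := hg.mono hsub
      simp only [swFun]; fun_prop
    · intro t ht
      have ht' : t ∈ Ioo a b := ⟨ht.1, ht.2.trans_le hc.2⟩
      have := (((h1 t ht').mul (((dC t).pow 2).sub (((dS t).pow 2).const_mul u))).add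
        ((h2 t ht').mul ((dS t).mul (dC t)))).add (((dS t).pow 2).const_mul l₀)
      refine this.congr_deriv ?_
      push_cast
      simp only [Pi.mul_apply, Pi.sub_apply, Pi.pow_apply]
      ring
  have e1 := main r hr
  have e2 := main r' hr'
  rw [e1, ← e2]
  simp [swFun]

end

section

/-! ### Piecewise smooth curves -/

lemma ae_restrict_uIoc_of_Ioo {a b : ℝ} (hab : a ≤ b) {p : ℝ → Prop}
    (h : ∀ᵐ r, r ∈ Ioo a b → p r) : ∀ᵐ r ∂(volume.restrict (uIoc a b)), p r := by
  rw [uIoc_of_le hab, ← Measure.restrict_congr_set (Ioo_ae_eq_Ioc (a := a) (b := b))]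
  exact (ae_restrict_iff' measurableSet_Ioo).2 h

lemma monotone_le_of_le {t : ℕ → ℝ} {N : ℕ} (ht : ∀ k ≤ N, t k ≤ t (k + 1)) {i j : ℕ}
    (hij : i ≤ j) (hj : j ≤ N + 1) : t i ≤ t j := by
  induction j, hij using Nat.le_induction with
  | base => exact le_rfl
  | succ j h ih => exact (ih (by omega)).trans (ht j (by omega))

lemma exists_glue {E : Type*} (N : ℕ) {t : ℕ → ℝ} (ht : ∀ k ≤ N, t k ≤ t (k + 1))
    (Y : ℕ → ℝ → E) (hY : ∀ k < N, Y k (t (k + 1)) = Y (k + 1) (t (k + 1))) :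
    ∃ y : ℝ → E, ∀ k ≤ N, ∀ r ∈ Icc (t k) (t (k + 1)), y r = Y k r := by
  induction N with
  | zero => exact ⟨Y 0, fun k hk r _ => by rw [Nat.le_zero.1 hk]⟩
  | succ N ih =>
    obtain ⟨y, hy⟩ := ih (fun k hk => ht k (by omega)) (fun k hk => hY k (by omega))
    refine ⟨fun r => if r ≤ t (N + 1) then y r else Y (N + 1) r, fun k hk r hr => ?_⟩
    rcases Nat.lt_or_ge k (N + 1) with h | h
    · have : r ≤ t (N + 1) := hr.2.trans (monotone_le_of_le ht (by omega) (by omega))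
      simp only [if_pos this]
      exact hy k (by omega) r hr
    · obtain rfl : k = N + 1 := by omega
      by_cases h1 : r ≤ t (N + 1)
      · obtain rfl : r = t (N + 1) := le_antisymm h1 hr.1
        simp only [le_refl, if_true]
        rw [hy N le_rfl _ ⟨ht N (by omega), le_rfl⟩, hY N (by omega)]
      · simp only [if_neg h1]

/-- Taking one of the values `v k` at every real time makes the control constraint hold without an
exceptional set. -/
lemma exists_control (N : ℕ) {t : ℕ → ℝ} (ht : ∀ k ≤ N, t k ≤ t (k + 1)) (v : ℕ → ℝ) :
    ∃ u : ℝ → ℝ, Measurable u ∧ (∀ r, ∃ k ≤ N, u r = v k) ∧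
      ∀ k ≤ N, ∀ r ∈ Ioo (t k) (t (k + 1)), u r = v k := by
  induction N with
  | zero =>
    exact ⟨fun _ => v 0, measurable_const, fun r => ⟨0, le_rfl, rfl⟩,
      fun k hk r _ => by rw [Nat.le_zero.1 hk]⟩
  | succ N ih =>
    obtain ⟨u, hm, h1, h2⟩ := ih (fun k hk => ht k (by omega))
    refine ⟨fun r => if r < t (N + 1) then u r else v (N + 1),
      hm.ite measurableSet_Iio measurable_const, fun r => ?_, fun k hk r hr => ?_⟩
    · by_cases h : r < t (N + 1)
      · obtain ⟨k, hk, e⟩ := h1 r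
        exact ⟨k, by omega, by simp only [if_pos h, e]⟩
      · exact ⟨N + 1, le_rfl, by simp only [if_neg h]⟩
    · rcases Nat.lt_or_ge k (N + 1) with h | h
      · have : r < t (N + 1) := hr.2.trans_le (monotone_le_of_le ht (by omega) (by omega))
        simp only [if_pos this]
        exact h2 k (by omega) r hr
      · obtain rfl : k = N + 1 := by omega
        simp only [if_neg hr.1.not_gt]

lemma continuousOn_of_glue {E : Type*} [TopologicalSpace E] (N : ℕ) {t : ℕ → ℝ}
    (ht : ∀ k ≤ N, t k ≤ t (k + 1)) {y : ℝ → E}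
    (hy : ∀ k ≤ N, ContinuousOn y (Icc (t k) (t (k + 1)))) :
    ContinuousOn y (Icc (t 0) (t (N + 1))) := by
  induction N with
  | zero => exact hy 0 le_rfl
  | succ N ih =>
    have h1 := ih (fun k hk => ht k (by omega)) (fun k hk => hy k (by omega))
    have := h1.union_of_isClosed (hy (N + 1) le_rfl) isClosed_Icc isClosed_Icc
    rwa [Icc_union_Icc_eq_Icc (monotone_le_of_le ht (by omega) (by omega)) (ht _ le_rfl)] at this

variable {E : Type*} [NormedAddCommGroup E] [NormedSpace ℝ E] [CompleteSpace E]

/-- The passage from classical solutions on the pieces to a Carathéodory solution; it serves the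
state and the costate alike. -/
lemma integral_of_glue (N : ℕ) {t : ℕ → ℝ} (ht : ∀ k ≤ N, t k ≤ t (k + 1)) {y g : ℝ → E}
    {Y Y' : ℕ → ℝ → E} (hy : ∀ k ≤ N, ∀ r ∈ Icc (t k) (t (k + 1)), y r = Y k r)
    (hd : ∀ k ≤ N, ∀ r, HasDerivAt (Y k) (Y' k r) r)
    (hc : ∀ k ≤ N, ContinuousOn (Y' k) (Icc (t k) (t (k + 1))))
    (hg : ∀ k ≤ N, ∀ᵐ r, r ∈ Ioo (t k) (t (k + 1)) → g r = Y' k r) :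
    IntervalIntegrable g volume (t 0) (t (N + 1)) ∧
    ∀ r ∈ Icc (t 0) (t (N + 1)), y r = y (t 0) + ∫ s in (t 0)..r, g s := by
  have piece : ∀ k ≤ N, ∀ r ∈ Icc (t k) (t (k + 1)), IntervalIntegrable g volume (t k) r ∧
      ∫ s in (t k)..r, g s = y r - y (t k) := by
    intro k hk r hr
    have hae : Y' k =ᵐ[volume.restrict (uIoc (t k) r)] g := by
      refine ae_restrict_uIoc_of_Ioo hr.1 ?_
      filter_upwards [hg k hk] with s hs h
      exact (hs ⟨h.1, h.2.trans_le hr.2⟩).symm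
    have hcont : ContinuousOn (Y' k) (uIcc (t k) r) := by
      rw [uIcc_of_le hr.1]
      exact (hc k hk).mono (Icc_subset_Icc le_rfl hr.2)
    have hint : IntervalIntegrable (Y' k) volume (t k) r := hcont.intervalIntegrable
    refine ⟨hint.congr_ae hae, ?_⟩
    rw [← intervalIntegral.integral_congr_ae_restrict hae,
      intervalIntegral.integral_eq_sub_of_hasDerivAt (fun s _ => hd k hk s) hint,
      hy k hk r hr, hy k hk (t k) ⟨le_rfl, ht k hk⟩]
  have main : ∀ k ≤ N, IntervalIntegrable g volume (t 0) (t (k + 1)) ∧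
      ∀ r ∈ Icc (t 0) (t (k + 1)), y r = y (t 0) + ∫ s in (t 0)..r, g s := by
    intro k
    induction k with
    | zero =>
      intro hk
      refine ⟨(piece 0 hk _ ⟨ht 0 hk, le_rfl⟩).1, fun r hr => ?_⟩
      rw [(piece 0 hk r hr).2]; abel
    | succ k ih =>
      intro hk
      obtain ⟨i1, i2⟩ := ih (by omega)
      refine ⟨i1.trans (piece (k + 1) hk _ ⟨ht _ hk, le_rfl⟩).1, fun r hr => ?_⟩
      rcases le_total r (t (k + 1)) with h | h
      · exact i2 r ⟨hr.1, h⟩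
      · obtain ⟨p1, p2⟩ := piece (k + 1) hk r ⟨h, hr.2⟩
        rw [← intervalIntegral.integral_add_adjacent_intervals i1 p1, p2]
        have := i2 (t (k + 1)) ⟨monotone_le_of_le ht (by omega) (by omega), le_rfl⟩
        rw [← add_assoc, ← this]; abel
  exact main N le_rfl

/-- The opposite passage: inside a piece the integrand agrees almost everywhere with a continuous
function, so the fundamental theorem of calculus applies at every point. -/
lemma hasDerivAt_of_integral (N : ℕ) {t : ℕ → ℝ} (ht : ∀ k ≤ N, t k ≤ t (k + 1)) {y g : ℝ → E}
    {h : ℕ → ℝ → E} (hy : ∀ r ∈ Icc (t 0) (t (N + 1)), y r = y (t 0) + ∫ s in (t 0)..r, g s)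
    (hc : ∀ k ≤ N, ContinuousOn (h k) (Icc (t k) (t (k + 1))))
    (hg : ∀ k ≤ N, ∀ᵐ r, r ∈ Ioo (t k) (t (k + 1)) → g r = h k r) {k : ℕ} (hk : k ≤ N) {r : ℝ}
    (hr : r ∈ Ioo (t k) (t (k + 1))) : HasDerivAt y (h k r) r := by
  have piece : ∀ k ≤ N, ∀ r ∈ Icc (t k) (t (k + 1)), IntervalIntegrable g volume (t k) r ∧
      ∫ s in (t k)..r, g s = ∫ s in (t k)..r, h k s := by
    intro k hk r hr
    have hae : h k =ᵐ[volume.restrict (uIoc (t k) r)] g := by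
      refine ae_restrict_uIoc_of_Ioo hr.1 ?_
      filter_upwards [hg k hk] with s hs h
      exact (hs ⟨h.1, h.2.trans_le hr.2⟩).symm
    have hcont : ContinuousOn (h k) (uIcc (t k) r) := by
      rw [uIcc_of_le hr.1]
      exact (hc k hk).mono (Icc_subset_Icc le_rfl hr.2)
    exact ⟨hcont.intervalIntegrable.congr_ae hae,
      (intervalIntegral.integral_congr_ae_restrict hae).symm⟩
  have hint : IntervalIntegrable g volume (t 0) (t k) :=
    IntervalIntegrable.trans_iterate fun i hi =>
      (piece i (by omega) _ ⟨ht i (by omega), le_rfl⟩).1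
  have hcr : ContinuousOn (h k) (Ioo (t k) (t (k + 1))) := (hc k hk).mono Ioo_subset_Icc_self
  have hd : HasDerivAt (fun r => (y (t 0) + ∫ s in (t 0)..(t k), g s) + ∫ s in (t k)..r, h k s)
      (h k r) r := by
    refine HasDerivAt.const_add _ ?_
    refine intervalIntegral.integral_hasDerivAt_right ?_ ?_ (hcr.continuousAt (Ioo_mem_nhds hr.1 hr.2))
    · refine ContinuousOn.intervalIntegrable ?_
      rw [uIcc_of_le hr.1.le]
      exact (hc k hk).mono (Icc_subset_Icc le_rfl hr.2.le)
    · exact hcr.stronglyMeasurableAtFilter isOpen_Ioo r hr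
  refine hd.congr_of_eventuallyEq ?_
  filter_upwards [Ioo_mem_nhds hr.1 hr.2] with r' hr'
  have p := piece k hk r' ⟨hr'.1.le, hr'.2.le⟩
  rw [hy r' ⟨(monotone_le_of_le ht (Nat.zero_le k) (by omega)).trans hr'.1.le,
    hr'.2.le.trans (monotone_le_of_le ht (by omega) le_rfl)⟩,
    ← intervalIntegral.integral_add_adjacent_intervals hint p.1, p.2, add_assoc]

/-! ### Bang-bang trajectories -/

lemma IsBangBang.le {T : ℝ} {u : ℝ → ℝ} {N : ℕ} {t v : ℕ → ℝ} (h : IsBangBang T u N t v) :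
    ∀ k ≤ N, t k ≤ t (k + 1) := fun k hk => (h.2.2.1 k hk).le

lemma IsBangBang.Icc_subset {T : ℝ} {u : ℝ → ℝ} {N : ℕ} {t v : ℕ → ℝ} (h : IsBangBang T u N t v)
    {k : ℕ} (hk : k ≤ N) : Icc (t k) (t (k + 1)) ⊆ Icc 0 T := by
  rw [← h.1, ← h.2.1]
  exact Icc_subset_Icc (monotone_le_of_le h.le (Nat.zero_le k) (by omega))
    (monotone_le_of_le h.le (by omega) le_rfl)

lemma continuousOn_field {x : ℝ → ℝ × ℝ} {s : Set ℝ} (hc : ContinuousOn x s)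
    (hp : ∀ r ∈ s, 0 < (x r).1) (v : ℝ) : ContinuousOn (fun r => field v (x r)) s := by
  have h1 : ContinuousOn (fun r => (x r).1) s := hc.fst
  have h2 : ContinuousOn (fun r => (x r).2) s := hc.snd
  refine h2.prodMk ((continuousOn_const.mul h1).add (continuousOn_const.div (h1.pow 3) ?_))
  exact fun r hr => (pow_pos (hp r hr) 3).ne'

lemma continuousOn_lift {x : ℝ → ℝ × ℝ} {s : Set ℝ} (hc : ContinuousOn x s)
    (hp : ∀ r ∈ s, 0 < (x r).1) : ContinuousOn (fun r => lift (x r)) s := by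
  have h1 : ContinuousOn (fun r => (x r).1) s := hc.fst
  have h2 : ContinuousOn (fun r => (x r).2) s := hc.snd
  refine (h1.pow 2).prodMk ((h1.mul h2).prodMk ((h2.pow 2).add
    (continuousOn_const.div (h1.pow 2) ?_)))
  exact fun r hr => (pow_pos (hp r hr) 2).ne'

variable {u₁ u₂ γ T : ℝ} {x : ℝ → ℝ × ℝ} {u : ℝ → ℝ} {N : ℕ} {t v : ℕ → ℝ}

lemma IsBangBang.hasDerivAt (hb : IsBangBang T u N t v)
    (hx : IsControlledTrajectory u₁ u₂ T x u) {k : ℕ} (hk : k ≤ N) {r : ℝ}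
    (hr : r ∈ Ioo (t k) (t (k + 1))) : HasDerivAt x (field (v k) (x r)) r := by
  refine hasDerivAt_of_integral N hb.le (g := fun r => field (u r) (x r))
    (h := fun k r => field (v k) (x r)) ?_ ?_ ?_ hk hr
  · rw [hb.1, hb.2.1]; exact hx.solves
  · exact fun k hk => continuousOn_field (hx.continuousOn.mono (hb.Icc_subset hk))
      (fun r hr => hx.pos r (hb.Icc_subset hk hr)) _
  · intro k hk
    filter_upwards [hb.2.2.2 k hk] with r h1 h2
    rw [h1 h2]

lemma IsBangBang.lift_eq_flow (hb : IsBangBang T u N t v)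
    (hx : IsControlledTrajectory u₁ u₂ T x u) {k : ℕ} (hk : k ≤ N) (hv : v k ≠ 0) {r r' : ℝ}
    (hr : t k ≤ r) (hrr : r ≤ r') (hr' : r' ≤ t (k + 1)) :
    lift (x r') = flow (v k) (r' - r) (lift (x r)) := by
  have hs : Icc r r' ⊆ Icc 0 T := (Icc_subset_Icc hr hr').trans (hb.Icc_subset hk)
  have hd : ∀ s ∈ Ioo r r', HasDerivAt x (field (v k) (x s)) s := fun s hs =>
    hb.hasDerivAt hx hk ⟨hr.trans_lt hs.1, hs.2.trans_le hr'⟩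
  have hp : ∀ s ∈ Ioo r r', 0 < (x s).1 := fun s h => hx.pos s (hs (Ioo_subset_Icc_self h))
  exact eq_flow_of_hasDerivAt (z := fun s => lift (x s)) hv hrr
    (continuousOn_lift (hx.continuousOn.mono hs) fun s h => hx.pos s (hs h))
    (fun s h => (hasDerivAt_lift (hd s h) (hp s h)).1)
    (fun s h => (hasDerivAt_lift (hd s h) (hp s h)).2.1)
    (fun s h => (hasDerivAt_lift (hd s h) (hp s h)).2.2)

/-- Segments of length zero are admitted, so that degenerate competitors of an optimal transfer need
no separate treatment. -/
lemma exists_transfer {z : ℕ → ℝ × ℝ × ℝ} (hγ : 0 < γ) (h0 : t 0 = 0)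
    (ht : ∀ k ≤ N, t k ≤ t (k + 1)) (hv : ∀ k ≤ N, v k ∈ Icc (-u₁) u₂) (hv0 : ∀ k ≤ N, v k ≠ 0)
    (hz : ∀ k ≤ N, z (k + 1) = flow (v k) (t (k + 1) - t k) (z k)) (hz0 : z 0 = (1, 0, 1))
    (hzN : z (N + 1) = (γ ^ 2, 0, 1 / γ ^ 2)) :
    ∃ x u, IsTransfer u₁ u₂ γ (t (N + 1)) x u ∧
      (∀ k ≤ N, ∀ r ∈ Icc (t k) (t (k + 1)), x r = proj (flow (v k) (r - t k) (z k))) ∧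
      ∀ k ≤ N, ∀ r ∈ Ioo (t k) (t (k + 1)), u r = v k := by
  have hst : ∀ k ≤ N + 1, IsState (z k) := by
    intro k
    induction k with
    | zero => intro _; rw [hz0]; norm_num [IsState]
    | succ k ih =>
      intro hk
      rw [hz k (by omega)]
      exact flow_isState (hv0 k (by omega)) _ (ih (by omega))
  obtain ⟨u, hm, hu1, hu2⟩ := exists_control N ht v
  obtain ⟨x, hx⟩ := exists_glue N ht (fun k r => proj (flow (v k) (r - t k) (z k))) (by
    intro k hk
    simp only [sub_self, flow_zero]
    rw [hz k hk.le])
  have hd : ∀ k ≤ N, ∀ r, HasDerivAt (fun r => proj (flow (v k) (r - t k) (z k)))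
      (field (v k) (proj (flow (v k) (r - t k) (z k)))) r := by
    intro k hk r
    have := (hasDerivAt_proj_flow (hv0 k hk) (r - t k) (hst k (by omega)))
    exact this.comp_sub_const r (t k)
  have hcY : ∀ k ≤ N, Continuous (fun r => proj (flow (v k) (r - t k) (z k))) := fun k hk =>
    continuous_iff_continuousAt.2 fun r => (hd k hk r).continuousAt
  have hpY : ∀ k ≤ N, ∀ r, 0 < (proj (flow (v k) (r - t k) (z k))).1 := fun k hk r =>
    proj_fst_pos (flow_isState (hv0 k hk) _ (hst k (by omega)))
  have hcont : ContinuousOn x (Icc (t 0) (t (N + 1))) :=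
    continuousOn_of_glue N ht fun k hk => (hcY k hk).continuousOn.congr (hx k hk)
  have hsol := (integral_of_glue N ht (y := x) (g := fun r => field (u r) (x r))
    (Y' := fun k r => field (v k) (proj (flow (v k) (r - t k) (z k)))) hx hd
    (fun k hk => continuousOn_field (hcY k hk).continuousOn (fun r _ => hpY k hk r) _)
    (fun k hk => Filter.Eventually.of_forall fun r hr => by
      rw [hu2 k hk r hr, hx k hk r (Ioo_subset_Icc_self hr)])).2
  rw [h0] at hcont hsol
  have hT : 0 ≤ t (N + 1) := h0 ▸ monotone_le_of_le ht (Nat.zero_le _) le_rfl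
  have hx0 : x (t 0) = proj (z 0) := by
    rw [hx 0 (Nat.zero_le _) _ ⟨le_rfl, ht 0 (Nat.zero_le _)⟩, sub_self, flow_zero]
  have hxN : x (t (N + 1)) = proj (z (N + 1)) := by
    rw [hx N le_rfl _ ⟨ht N le_rfl, le_rfl⟩, ← hz N le_rfl]
  refine ⟨x, u, ⟨⟨hT, hm.aemeasurable, ?_, hcont, ?_, hsol⟩, ?_, ?_⟩, hx, hu2⟩
  · refine Filter.Eventually.of_forall fun r => ?_
    obtain ⟨k, hk, e⟩ := hu1 r
    exact e ▸ hv k hk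
  · intro r hr
    have : ∃ k ≤ N, r ∈ Icc (t k) (t (k + 1)) := by
      have key : ∀ m ≤ N, r ∈ Icc (t 0) (t (m + 1)) → ∃ k ≤ m, r ∈ Icc (t k) (t (k + 1)) := by
        intro m
        induction m with
        | zero => exact fun _ h => ⟨0, le_rfl, h⟩
        | succ m ih =>
          intro hm h
          rcases le_total r (t (m + 1)) with h1 | h1
          · obtain ⟨k, hk, e⟩ := ih (by omega) ⟨h.1, h1⟩
            exact ⟨k, by omega, e⟩
          · exact ⟨m + 1, le_rfl, h1, h.2⟩
      exact key N le_rfl (by rwa [h0])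
    obtain ⟨k, hk, h⟩ := this
    rw [hx k hk r h]
    exact hpY k hk r
  · rw [h0] at hx0
    rw [hx0, hz0]; simp [proj]
  · rw [hxN, hzN]; simp [proj, Real.sqrt_sq hγ.le]

end

section

/-! ### Extremals and switching functions -/

/-- Upgrades the almost-everywhere conditions of an extremal to all times of a closed segment, in
particular to the switching times. -/
lemma le_on_Icc_of_ae {f g : ℝ → ℝ} {a b : ℝ} (hab : a < b) (hf : ContinuousOn f (Icc a b))
    (hg : ContinuousOn g (Icc a b)) (h : ∀ᵐ r, r ∈ Ioo a b → f r ≤ g r) :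
    ∀ r ∈ Icc a b, f r ≤ g r := by
  have hae : (fun r => max (f r) (g r)) =ᵐ[volume.restrict (Icc a b)] g := by
    rw [← Measure.restrict_congr_set (Ioo_ae_eq_Icc (a := a) (b := b))]
    refine (ae_restrict_iff' measurableSet_Ioo).2 ?_
    filter_upwards [h] with r hr h1
    exact max_eq_right (hr h1)
  intro r hr
  have := Measure.eqOn_Icc_of_ae_eq volume hab.ne hae (hf.sup hg) hg hr
  exact max_eq_right_iff.1 this

variable {u₁ u₂ γ T : ℝ} {x : ℝ → ℝ × ℝ} {u : ℝ → ℝ} {N : ℕ} {t v : ℕ → ℝ}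

lemma IsBangBang.ae_of_ae_restrict (hb : IsBangBang T u N t v) {p : ℝ → ℝ → Prop}
    (h : ∀ᵐ r ∂(volume.restrict (Icc 0 T)), p r (u r)) {k : ℕ} (hk : k ≤ N) :
    ∀ᵐ r, r ∈ Ioo (t k) (t (k + 1)) → p r (v k) := by
  filter_upwards [(ae_restrict_iff' measurableSet_Icc).1 h, hb.2.2.2 k hk] with r h1 h2 h3
  exact h2 h3 ▸ h1 (hb.Icc_subset hk (Ioo_subset_Icc_self h3))

/-- The switching function `φ = λ₂ x₁` of an extremal and its derivative `ψ`. -/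
lemma IsBangBang.exists_switching_function (hb : IsBangBang T u N t v)
    (hx : IsControlledTrajectory u₁ u₂ T x u) (he : IsExtremal u₁ u₂ T x u)
    (hv0 : ∀ k ≤ N, v k ≠ 0) :
    ∃ (l₀ : ℝ) (φ ψ : ℝ → ℝ),
      (∀ k ≤ N, ∀ r ∈ Icc (t k) (t (k + 1)), ∀ r' ∈ Icc (t k) (t (k + 1)),
        φ r' = swFun (v k) l₀ (φ r) (ψ r) (r' - r)) ∧
      (∀ k ≤ N, ∀ r ∈ Icc (t k) (t (k + 1)), ∀ c ∈ Icc (-u₁) u₂, φ r * (v k - c) ≤ 0) ∧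
      (∀ k ≤ N, ∀ r ∈ Icc (t k) (t (k + 1)), φ r = 0 →
        ψ r ≠ 0 ∧ l₀ * (lift (x r)).1 = ψ r * (lift (x r)).2.1) := by
  obtain ⟨l₀, l, -, hlc, hl0, hl, hmax, hH⟩ := he
  have hl1 : ContinuousOn (fun r => (l r).1) (Icc 0 T) := hlc.fst
  have hl2 : ContinuousOn (fun r => (l r).2) (Icc 0 T) := hlc.snd
  have hx1 : ContinuousOn (fun r => (x r).1) (Icc 0 T) := hx.continuousOn.fst
  have hx2 : ContinuousOn (fun r => (x r).2) (Icc 0 T) := hx.continuousOn.snd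
  have hHc : ∀ c, ContinuousOn (fun r => hamiltonian l₀ (l r) (x r) c) (Icc 0 T) := fun c => by
    have hf := continuousOn_field hx.continuousOn hx.pos c
    exact (continuousOn_const.add (hl1.mul hf.fst)).add (hl2.mul hf.snd)
  have H0 : ∀ k ≤ N, ∀ r ∈ Icc (t k) (t (k + 1)), hamiltonian l₀ (l r) (x r) (v k) = 0 := by
    intro k hk r hr
    have hae := hb.ae_of_ae_restrict (p := fun r c => hamiltonian l₀ (l r) (x r) c = 0) hH hk
    refine le_antisymm ?_ ?_
    · exact le_on_Icc_of_ae (hb.2.2.1 k hk) ((hHc _).mono (hb.Icc_subset hk)) continuousOn_const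
        (hae.mono fun r h h1 => (h h1).le) r hr
    · exact le_on_Icc_of_ae (hb.2.2.1 k hk) continuousOn_const ((hHc _).mono (hb.Icc_subset hk))
        (hae.mono fun r h h1 => (h h1).ge) r hr
  have dl : ∀ k ≤ N, ∀ r ∈ Ioo (t k) (t (k + 1)),
      HasDerivAt l (adjointField (v k) (x r) (l r)) r := by
    intro k hk r hr
    refine hasDerivAt_of_integral N hb.le (g := fun r => adjointField (u r) (x r) (l r))
      (h := fun k r => adjointField (v k) (x r) (l r)) ?_ ?_ ?_ hk hr
    · rw [hb.1, hb.2.1]; exact hl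
    · intro k hk
      have hs := hb.Icc_subset hk
      refine ((hl2.mono hs).mul (continuousOn_const.add (continuousOn_const.div
        ((hx1.mono hs).pow 4) ?_))).prodMk (hl1.mono hs).neg
      exact fun r hr => (pow_pos (hx.pos r (hs hr)) 4).ne'
    · intro k hk
      filter_upwards [hb.2.2.2 k hk] with r h1 h2
      rw [h1 h2]
  refine ⟨l₀, fun r => (l r).2 * (x r).1, fun r => -(l r).1 * (x r).1 + (l r).2 * (x r).2,
    ?_, ?_, ?_⟩
  · intro k hk r hr r' hr'
    have hs := hb.Icc_subset hk
    refine eq_swFun_of_hasDerivAt (hv0 k hk) ((hl2.mul hx1).mono hs)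
      (((hl1.neg.mul hx1).add (hl2.mul hx2)).mono hs) ?_ ?_ hr hr'
    · intro s h
      have h1 := dl k hk s h
      have h2 := hb.hasDerivAt hx hk h
      have h11 : HasDerivAt (fun r => (l r).1) _ s := h1.fst
      have h12 : HasDerivAt (fun r => (l r).2) _ s := h1.snd
      have h21 : HasDerivAt (fun r => (x r).1) _ s := h2.fst
      have h22 : HasDerivAt (fun r => (x r).2) _ s := h2.snd
      exact (h12.mul h21).congr_deriv (by
        simp only [adjointField, field, Pi.add_apply, Pi.mul_apply, Pi.neg_apply])
    · intro s h
      have h1 := dl k hk s h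
      have h2 := hb.hasDerivAt hx hk h
      have h11 : HasDerivAt (fun r => (l r).1) _ s := h1.fst
      have h12 : HasDerivAt (fun r => (l r).2) _ s := h1.snd
      have h21 : HasDerivAt (fun r => (x r).1) _ s := h2.fst
      have h22 : HasDerivAt (fun r => (x r).2) _ s := h2.snd
      have hp := hx.pos s (hs (Ioo_subset_Icc_self h))
      -- The derivative of `ψ` contains `λ₁ x₂`; the vanishing Hamiltonian trades this term for `l₀`
      -- and `φ`, which closes the equation for `φ`.
      have e := H0 k hk s (Ioo_subset_Icc_self h)
      refine ((h11.neg.mul h21).add (h12.mul h22)).congr_deriv ?_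
      simp only [adjointField, field, hamiltonian] at e ⊢
      simp only [Pi.neg_apply, Pi.mul_apply]
      have e2 : 3 / (x s).1 ^ 4 * (x s).1 = 3 * (1 / (x s).1 ^ 3) := by field_simp
      linear_combination (-2) * e - (l s).2 * e2
  · intro k hk r hr c hc
    have hs := hb.Icc_subset hk
    have hae := hb.ae_of_ae_restrict (p := fun r b => ∀ c ∈ Icc (-u₁) u₂,
      hamiltonian l₀ (l r) (x r) c ≤ hamiltonian l₀ (l r) (x r) b) hmax hk
    have := le_on_Icc_of_ae (hb.2.2.1 k hk) ((hHc c).mono hs) ((hHc (v k)).mono hs)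
      (hae.mono fun r h h1 => h h1 c hc) r hr
    simp only [hamiltonian, field] at this
    simp only
    linarith
  · intro k hk r hr h0
    have hrT := hb.Icc_subset hk hr
    have hp := hx.pos r hrT
    have e := H0 k hk r hr
    -- At a zero of `φ` only `λ₁` survives, and it is nonzero; the Hamiltonian becomes `l₀ + λ₁ x₂ =
    -- 0`.
    have h2 : (l r).2 = 0 := by
      rcases mul_eq_zero.1 h0 with h | h
      · exact h
      · exact absurd h hp.ne'
    have h1 : (l r).1 ≠ 0 := fun h => hl0 r hrT (Prod.ext h h2)
    simp only [hamiltonian, field, h2] at e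
    simp only [h2, lift]
    constructor
    · simpa using ⟨h1, hp.ne'⟩
    · linear_combination (x r).1 ^ 2 * e

/-- The Hamiltonian vanishes along a segment if it does so at a switching. -/
lemma switching_identity {u l₀ ρ : ℝ} (hu : u ≠ 0) (s : ℝ) {z : ℝ × ℝ × ℝ}
    (h : l₀ * z.1 = ρ * z.2.1) :
    l₀ * (flow u s z).1 + swFun u l₀ 0 ρ s * ((flow u s z).2.2 - u * (flow u s z).1) -
      swFunDeriv u l₀ 0 ρ s * (flow u s z).2.1 = 0 := by
  have hk := gcos_sq_add hu s
  obtain ⟨q, w, e⟩ := z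
  simp only [flow, swFun, swFunDeriv] at h ⊢
  set C := gcos u s
  set S := gsin u s
  linear_combination h + (-ρ * w * (C ^ 2 + u * S ^ 2 + 1) - 2 * l₀ * S * C * w + l₀ * q -
    l₀ * (e - u * q) * S ^ 2) * hk

/-- The costate is recovered from `φ` and `ψ = φ'` by `λ₂ = φ / x₁` and `λ₁ = (φ x₂ / x₁ - ψ) / x₁`.
On each segment `φ` is given by its derivative `ρ k` at a zero `a k`, which may be any reference
time; the Hamiltonian vanishes there by `hρ`, hence on the whole segment by `switching_identity`.
Since `l₀ < 0`, this also prevents the costate from vanishing. -/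
lemma IsBangBang.isExtremal (hb : IsBangBang T u N t v)
    (hv0 : ∀ k ≤ N, v k ≠ 0) {l₀ : ℝ} (hl₀ : l₀ < 0) {a ρ : ℕ → ℝ} {z : ℕ → ℝ × ℝ × ℝ}
    (hz : ∀ k ≤ N, IsState (z k))
    (hx : ∀ k ≤ N, ∀ r ∈ Icc (t k) (t (k + 1)), x r = proj (flow (v k) (r - a k) (z k)))
    (hm : ∀ k < N, swFun (v k) l₀ 0 (ρ k) (t (k + 1) - a k) =
      swFun (v (k + 1)) l₀ 0 (ρ (k + 1)) (t (k + 1) - a (k + 1)))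
    (hm' : ∀ k < N, swFunDeriv (v k) l₀ 0 (ρ k) (t (k + 1) - a k) =
      swFunDeriv (v (k + 1)) l₀ 0 (ρ (k + 1)) (t (k + 1) - a (k + 1)))
    (hs : ∀ k ≤ N, ∀ r ∈ Icc (t k) (t (k + 1)), ∀ c ∈ Icc (-u₁) u₂,
      swFun (v k) l₀ 0 (ρ k) (r - a k) * (v k - c) ≤ 0)
    (hρ : ∀ k ≤ N, l₀ * (z k).1 = ρ k * (z k).2.1) : IsExtremal u₁ u₂ T x u := by
  obtain ⟨p, hp⟩ := exists_glue N hb.le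
    (fun k r => (swFun (v k) l₀ 0 (ρ k) (r - a k), swFunDeriv (v k) l₀ 0 (ρ k) (r - a k)))
    (fun k hk => Prod.ext (hm k hk) (hm' k hk))
  let X : ℕ → ℝ → ℝ × ℝ := fun k r => proj (flow (v k) (r - a k) (z k))
  let P : ℕ → ℝ → ℝ := fun k r => swFun (v k) l₀ 0 (ρ k) (r - a k)
  let Q : ℕ → ℝ → ℝ := fun k r => swFunDeriv (v k) l₀ 0 (ρ k) (r - a k)
  let L : ℕ → ℝ → ℝ × ℝ := fun k r =>
    ((P k r * (X k r).2 / (X k r).1 - Q k r) / (X k r).1, P k r / (X k r).1)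
  have hX1 : ∀ k ≤ N, ∀ r, 0 < (X k r).1 := fun k hk r =>
    proj_fst_pos (flow_isState (hv0 k hk) _ (hz k hk))
  have dX : ∀ k ≤ N, ∀ r, HasDerivAt (X k) (field (v k) (X k r)) r := fun k hk r =>
    (hasDerivAt_proj_flow (hv0 k hk) (r - a k) (hz k hk)).comp_sub_const r (a k)
  have dP : ∀ k ≤ N, ∀ r, HasDerivAt (P k) (Q k r) r := fun k hk r =>
    (hasDerivAt_swFun (hv0 k hk) l₀ 0 (ρ k) (r - a k)).comp_sub_const r (a k)
  have dQ : ∀ k ≤ N, ∀ r, HasDerivAt (Q k) (-4 * v k * P k r + 2 * l₀) r := fun k hk r =>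
    (hasDerivAt_swFunDeriv (hv0 k hk) l₀ 0 (ρ k) (r - a k)).comp_sub_const r (a k)
  have hJ : ∀ k ≤ N, ∀ r, hamiltonian l₀ (L k r) (X k r) (v k) = 0 := by
    intro k hk r
    have h1 := switching_identity (hv0 k hk) (r - a k) (hρ k hk)
    have h2 : flow (v k) (r - a k) (z k) = lift (X k r) :=
      (lift_proj (flow_isState (hv0 k hk) _ (hz k hk))).symm
    change l₀ * (flow (v k) (r - a k) (z k)).1 + P k r * ((flow (v k) (r - a k) (z k)).2.2 -
      v k * (flow (v k) (r - a k) (z k)).1) - Q k r * (flow (v k) (r - a k) (z k)).2.1 = 0 at h1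
    rw [h2] at h1
    simp only [lift] at h1
    simp only [hamiltonian, field, L]
    have hp1 := hX1 k hk r
    field_simp
    field_simp at h1
    linear_combination h1
  have dL : ∀ k ≤ N, ∀ r, HasDerivAt (L k) (adjointField (v k) (X k r) (L k r)) r := by
    intro k hk r
    have hp1 := hX1 k hk r
    have h1 := (dX k hk r).fst
    have h2 := (dX k hk r).snd
    have hh := hJ k hk r
    have d2 := (dP k hk r).div h1 hp1.ne'
    have d1 := ((((dP k hk r).mul h2).div h1 hp1.ne').sub (dQ k hk r)).div h1 hp1.ne'
    refine (d1.prodMk d2).congr_deriv ?_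
    simp only [hamiltonian, field, L] at hh
    simp only [adjointField, field, L, Pi.mul_apply, Pi.sub_apply, Pi.div_apply]
    ext
    · simp only
      field_simp
      field_simp at hh
      linear_combination (-2) * hh
    · simp only
      field_simp
      ring
  have hcL : ∀ k ≤ N, Continuous (L k) := fun k hk =>
    continuous_iff_continuousAt.2 fun r => (dL k hk r).continuousAt
  have hcX : ∀ k ≤ N, Continuous (X k) := fun k hk =>
    continuous_iff_continuousAt.2 fun r => (dX k hk r).continuousAt
  let l : ℝ → ℝ × ℝ := fun r =>
    (((p r).1 * (x r).2 / (x r).1 - (p r).2) / (x r).1, (p r).1 / (x r).1)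
  have hl : ∀ k ≤ N, ∀ r ∈ Icc (t k) (t (k + 1)), l r = L k r := by
    intro k hk r hr
    simp only [l, L, hp k hk r hr, hx k hk r hr, P, Q, X]
  have hseg : ∀ r ∈ Icc 0 T, ∃ k ≤ N, r ∈ Icc (t k) (t (k + 1)) := by
    intro r hr
    rw [← hb.1, ← hb.2.1] at hr
    have key : ∀ m ≤ N, r ∈ Icc (t 0) (t (m + 1)) → ∃ k ≤ m, r ∈ Icc (t k) (t (k + 1)) := by
      intro m
      induction m with
      | zero => exact fun _ h => ⟨0, le_rfl, h⟩
      | succ m ih =>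
        intro hm h
        rcases le_total r (t (m + 1)) with h1 | h1
        · obtain ⟨k, hk, e⟩ := ih (by omega) ⟨h.1, h1⟩
          exact ⟨k, by omega, e⟩
        · exact ⟨m + 1, le_rfl, h1, h.2⟩
    exact key N le_rfl hr
  have hae : ∀ᵐ r, r ∈ Icc 0 T → ∃ k ≤ N, r ∈ Icc (t k) (t (k + 1)) ∧ u r = v k := by
    have h1 : ∀ᵐ r, ∀ k ≤ N, r ∈ Ioo (t k) (t (k + 1)) → u r = v k :=
      ae_all_iff.2 fun k => by
        by_cases hk : k ≤ N
        · filter_upwards [hb.2.2.2 k hk] with r h _ using h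
        · exact Filter.Eventually.of_forall fun r h => absurd h hk
    have h2 : ∀ᵐ r : ℝ, ∀ k, r ≠ t k := ae_all_iff.2 fun k => by
      simp [ae_iff]
    filter_upwards [h1, h2] with r h1 h2 hr
    obtain ⟨k, hk, h⟩ := hseg r hr
    exact ⟨k, hk, h, h1 k hk ⟨lt_of_le_of_ne h.1 (h2 k).symm, lt_of_le_of_ne h.2 (h2 _)⟩⟩
  have hcont := continuousOn_of_glue N hb.le fun k hk => (hcL k hk).continuousOn.congr (hl k hk)
  have hint := (integral_of_glue N hb.le (y := l) (g := fun r => adjointField (u r) (x r) (l r))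
    (Y' := fun k r => adjointField (v k) (X k r) (L k r)) hl dL (by
      intro k hk
      have c1 := hcX k hk
      have c2 := hcL k hk
      refine ContinuousOn.prodMk (c2.snd.continuousOn.mul (continuousOn_const.add
        (continuousOn_const.div (c1.fst.continuousOn.pow 4) ?_))) c2.fst.continuousOn.neg
      exact fun r _ => (pow_pos (hX1 k hk r) 4).ne') (by
      intro k hk
      filter_upwards [hb.2.2.2 k hk] with r h1 h2
      rw [h1 h2, hx k hk r (Ioo_subset_Icc_self h2), hl k hk r (Ioo_subset_Icc_self h2)])).2
  rw [hb.1, hb.2.1] at hcont hint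
  refine ⟨l₀, l, hl₀.le, hcont, ?_, hint, ?_, ?_⟩
  · intro r hr h0
    obtain ⟨k, hk, hr⟩ := hseg r hr
    have := hJ k hk r
    rw [← hl k hk r hr, h0] at this
    simp [hamiltonian] at this
    exact hl₀.ne this
  · refine (ae_restrict_iff' measurableSet_Icc).2 ?_
    filter_upwards [hae] with r h hr c hc
    obtain ⟨k, hk, hr, e⟩ := h hr
    rw [e, hl k hk r hr, hx k hk r hr]
    have h1 := hs k hk r hr c hc
    have hp1 := hX1 k hk r
    change P k r * (v k - c) ≤ 0 at h1
    change hamiltonian l₀ (L k r) (X k r) c ≤ hamiltonian l₀ (L k r) (X k r) (v k)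
    simp only [hamiltonian, field, L]
    have e2 : ∀ b : ℝ, P k r / (X k r).1 * (-b * (X k r).1 + 1 / (X k r).1 ^ 3) =
        -b * P k r + P k r / (X k r).1 * (1 / (X k r).1 ^ 3) := fun b => by field_simp
    rw [e2, e2]
    linarith
  · refine (ae_restrict_iff' measurableSet_Icc).2 ?_
    filter_upwards [hae] with r h hr
    obtain ⟨k, hk, hr, e⟩ := h hr
    rw [e, hl k hk r hr, hx k hk r hr]
    exact hJ k hk r

end

section

/-! ### The durations of the segments -/

lemma gcos_sq_eq {u : ℝ} (hu : 0 < u) (t : ℝ) :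
    gcos u t ^ 2 = (1 + Real.cos (2 * √u * t)) / 2 := by
  rw [gcos_of_pos hu, mul_assoc, Real.cos_two_mul]; ring

lemma gsin_sq_eq {u : ℝ} (hu : 0 < u) (t : ℝ) :
    gsin u t ^ 2 = (1 - Real.cos (2 * √u * t)) / (2 * u) := by
  have h := gcos_sq_add hu.ne' t
  rw [gcos_sq_eq hu] at h
  field_simp
  linarith

lemma gcos_mul_gsin {u : ℝ} (hu : 0 < u) (t : ℝ) :
    gcos u t * gsin u t = Real.sin (2 * √u * t) / (2 * √u) := by
  have := Real.sqrt_pos.2 hu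
  rw [gcos_of_pos hu, gsin_of_pos hu, mul_assoc 2, Real.sin_two_mul]
  field_simp

lemma gsin_pos {u t : ℝ} (hu : 0 < u) (ht : 0 < t) (h : √u * t < Real.pi) : 0 < gsin u t := by
  have := Real.sqrt_pos.2 hu
  rw [gsin_of_pos hu]
  exact div_pos (Real.sin_pos_of_pos_of_lt_pi (by positivity) h) this

lemma gsin_neg_control_pos {u t : ℝ} (hu : 0 < u) (ht : 0 < t) : 0 < gsin (-u) t := by
  have := Real.sqrt_pos.2 hu
  rw [gsin_neg_control hu]
  exact div_pos (Real.sinh_pos_iff.2 (by positivity)) this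

lemma gcos_neg_control_pos {u : ℝ} (hu : 0 < u) (t : ℝ) : 0 < gcos (-u) t := by
  rw [gcos_neg_control hu]; exact Real.cosh_pos _

/-- The time in which the motion with control `u` and energy `c` goes from its largest radius to
the slope `x₂ / x₁ = -√s`, which it reaches first for `ε = 1` and then for `ε = -1`. -/
noncomputable def arcTime (u c ε s : ℝ) : ℝ :=
  1 / (2 * √u) * Real.arccos
    ((-(s * c) + ε * (u * √(c ^ 2 - 4 * (s + u)))) / ((s + u) * √(c ^ 2 - 4 * u)))

lemma timeInitial_eq (u₂ s : ℝ) : timeInitial u₂ s = arcTime u₂ (cFirst u₂) (-1) s := by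
  rw [timeInitial, arcTime, ← neg_div]
  congr 4; ring

lemma timeFinal_eq (u₂ γ s : ℝ) : timeFinal u₂ γ s = arcTime u₂ (cLast u₂ γ) 1 s := by
  rw [timeFinal, arcTime, one_mul, neg_mul]

lemma sqrt_energy {u g : ℝ} (hg : 0 < g) (hug : 1 ≤ u * g ^ 2) :
    √((u * g + 1 / g) ^ 2 - 4 * u) = u * g - 1 / g := by
  rw [show (u * g + 1 / g) ^ 2 - 4 * u = (u * g - 1 / g) ^ 2 by field_simp; ring]
  refine Real.sqrt_sq ?_
  rw [sub_nonneg, div_le_iff₀ hg]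
  linarith

lemma flow_apse {u g t : ℝ} (hu : 0 < u) (hg : 0 < g) :
    (flow u t (g, 0, 1 / g)).1 =
      (u * g + 1 / g + (u * g - 1 / g) * Real.cos (2 * √u * t)) / (2 * u) ∧
    (flow u t (g, 0, 1 / g)).2.1 =
      -((u * g - 1 / g) * Real.sin (2 * √u * t) / (2 * √u)) := by
  have h1 := gcos_sq_eq hu t
  have h2 := gsin_sq_eq hu t
  have h3 := gcos_mul_gsin hu t
  have hs := Real.sqrt_pos.2 hu
  simp only [flow]
  constructor
  · rw [h1, h2]; field_simp; ring
  · rw [show -u * gcos u t * gsin u t * g + (gcos u t ^ 2 - u * gsin u t ^ 2) * 0 +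
      gcos u t * gsin u t * (1 / g) = -((u * g - 1 / g) * (gcos u t * gsin u t)) by ring, h3]
    ring

lemma isState_apse {g : ℝ} (hg : 0 < g) : IsState (g, 0, 1 / g) :=
  ⟨hg, by simp only; field_simp; ring⟩

/-- The relation `1 - cos² = sin²` for the angle in `arcTime`, cleared of denominators. -/
lemma arc_identity {u s c D R ε : ℝ} (hD : D ^ 2 = c ^ 2 - 4 * u)
    (hR : R ^ 2 = c ^ 2 - 4 * (s + u)) (hε : ε ^ 2 = 1) :
    ((s + u) * D) ^ 2 - (-(s * c) + ε * (u * R)) ^ 2 = s * u * (c + ε * R) ^ 2 := by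
  linear_combination (s + u) ^ 2 * hD - u * (s + u) * hR - u * (s + u) * R ^ 2 * hε

lemma add_mul_pos_of_sq {c R ε : ℝ} (hc : 0 < c) (hR : R ^ 2 < c ^ 2) (hε : ε ^ 2 = 1) :
    0 < c + ε * R := by
  have h : |ε * R| < c := abs_lt_of_sq_lt_sq (by rw [mul_pow, hε, one_mul]; exact hR) hc.le
  linarith [neg_abs_le (ε * R)]

lemma cos_sin_arcTime {u c D ε s : ℝ} (hu : 0 < u) (hc0 : 0 < c) (hD : 0 < D)
    (hD2 : D ^ 2 = c ^ 2 - 4 * u) (hs : 0 < s) (hε : ε ^ 2 = 1) (hc : 4 * (s + u) ≤ c ^ 2) :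
    Real.cos (2 * √u * arcTime u c ε s) =
      (-(s * c) + ε * (u * √(c ^ 2 - 4 * (s + u)))) / ((s + u) * D) ∧
    Real.sin (2 * √u * arcTime u c ε s) =
      √s * √u * (c + ε * √(c ^ 2 - 4 * (s + u))) / ((s + u) * D) := by
  have hDs : √(c ^ 2 - 4 * u) = D := by rw [← hD2, Real.sqrt_sq hD.le]
  have hR2 : √(c ^ 2 - 4 * (s + u)) ^ 2 = c ^ 2 - 4 * (s + u) := Real.sq_sqrt (by linarith)
  rw [arcTime, hDs]
  generalize √(c ^ 2 - 4 * (s + u)) = R at *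
  have hpos := add_mul_pos_of_sq hc0 (R := R) (by linarith) hε
  have hid := arc_identity hD2 hR2 hε
  have hu' := Real.sqrt_pos.2 hu
  have hs' := Real.sqrt_pos.2 hs
  have hσ : 0 < s + u := by linarith
  have e1 : 1 - ((-(s * c) + ε * (u * R)) / ((s + u) * D)) ^ 2 =
      (√s * √u * (c + ε * R) / ((s + u) * D)) ^ 2 := by
    rw [div_pow, div_pow, mul_pow (√s * √u), mul_pow √s, Real.sq_sqrt hs.le, Real.sq_sqrt hu.le, ← hid]
    field_simp
  rw [← mul_assoc, mul_one_div_cancel (by positivity), one_mul]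
  generalize (-(s * c) + ε * (u * R)) / ((s + u) * D) = y at *
  have hy := abs_le.1 (abs_le_of_sq_le_sq (a := y) (b := 1)
    (by linarith [sq_nonneg (√s * √u * (c + ε * R) / ((s + u) * D))]) zero_le_one)
  rw [Real.cos_arccos hy.1 hy.2, Real.sin_arccos, e1, Real.sqrt_sq (by positivity)]
  exact ⟨rfl, rfl⟩

/-- Energy `c`, determinant one and slope `-√s` combine into `(s + u) q² - c q + 1 = 0`, and `ε`
selects the root. The apse `(g, 0, 1 / g)` carries the energy `u g + 1 / g`. -/
lemma flow_arcTime {u g ε s : ℝ} (hu : 0 < u) (hg : 0 < g) (hug : 1 < u * g ^ 2) (hs : 0 < s)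
    (hε : ε ^ 2 = 1) (hc : 4 * (s + u) ≤ (u * g + 1 / g) ^ 2) :
    (flow u (arcTime u (u * g + 1 / g) ε s) (g, 0, 1 / g)).1 =
      (u * g + 1 / g + ε * √((u * g + 1 / g) ^ 2 - 4 * (s + u))) / (2 * (s + u)) ∧
    (flow u (arcTime u (u * g + 1 / g) ε s) (g, 0, 1 / g)).2.1 =
      -(√s * ((u * g + 1 / g + ε * √((u * g + 1 / g) ^ 2 - 4 * (s + u))) / (2 * (s + u)))) := by
  have hDpos : 0 < u * g - 1 / g := by
    rw [sub_pos, div_lt_iff₀ hg]; linarith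
  have hD2 : (u * g - 1 / g) ^ 2 = (u * g + 1 / g) ^ 2 - 4 * u := by field_simp; ring
  have hcpos : 0 < u * g + 1 / g := by positivity
  obtain ⟨h1, h2⟩ := flow_apse (t := arcTime u (u * g + 1 / g) ε s) hu hg
  obtain ⟨h3, h4⟩ := cos_sin_arcTime hu hcpos hDpos hD2 hs hε hc
  have hu' := Real.sqrt_pos.2 hu
  have hσ : 0 < s + u := by linarith
  rw [h1, h2, h3, h4]
  generalize u * g - 1 / g = D at *
  generalize u * g + 1 / g = c at *
  generalize √(c ^ 2 - 4 * (s + u)) = R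
  constructor
  · field_simp; ring
  · field_simp

lemma arcTime_of_flow {u g s τ : ℝ} (hu : 0 < u) (hg : 0 < g) (hug : 1 ≤ u * g ^ 2) (hs : 0 < s)
    (hτ : 0 < τ) (hτ' : √u * τ < Real.pi)
    (hw : (flow u τ (g, 0, 1 / g)).2.1 = -(√s * (flow u τ (g, 0, 1 / g)).1)) :
    4 * (s + u) ≤ (u * g + 1 / g) ^ 2 ∧ ∃ ε : ℝ, (ε = 1 ∨ ε = -1) ∧
      τ = arcTime u (u * g + 1 / g) ε s ∧
      (flow u τ (g, 0, 1 / g)).1 =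
        (u * g + 1 / g + ε * √((u * g + 1 / g) ^ 2 - 4 * (s + u))) / (2 * (s + u)) := by
  have hst := flow_isState hu.ne' τ (isState_apse hg)
  have hen := flow_energy hu.ne' τ (g, 0, 1 / g)
  obtain ⟨h1, h2⟩ := flow_apse (t := τ) hu hg
  have hD := sqrt_energy hg hug
  have hs' := Real.sqrt_pos.2 hs
  have hu' := Real.sqrt_pos.2 hu
  have hDnn : 0 ≤ u * g - 1 / g := by
    rw [sub_nonneg, div_le_iff₀ hg]; linarith
  simp only at hen
  set q := (flow u τ (g, 0, 1 / g)).1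
  set w := (flow u τ (g, 0, 1 / g)).2.1
  set c := u * g + 1 / g
  set D := u * g - 1 / g
  have hq := hst.1
  have hd := hst.2
  have hquad : (s + u) * q ^ 2 - c * q + 1 = 0 := by
    have hs2 := Real.sq_sqrt hs.le
    have e : (flow u τ (g, 0, 1 / g)).2.2 = c - u * q := by simp only [c]; linarith
    change q * (flow u τ (g, 0, 1 / g)).2.2 - w ^ 2 = 1 at hd
    rw [e, hw, neg_sq, mul_pow, hs2] at hd
    linarith
  have hsq : (2 * (s + u) * q - c) ^ 2 = c ^ 2 - 4 * (s + u) := by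
    linear_combination 4 * (s + u) * hquad
  -- The negative slope places the doubled angle in the first half period, where `arccos` inverts
  -- `cos`.
  have hsin : 0 < D * Real.sin (2 * √u * τ) := by
    have : D * Real.sin (2 * √u * τ) = 2 * √u * (√s * q) := by
      rw [h2] at hw; field_simp at hw; linarith
    rw [this]; positivity
  have hDpos : 0 < D := by
    rcases hDnn.eq_or_lt with h | h
    · rw [← h] at hsin; simp at hsin
    · exact h
  have hsin' : 0 < Real.sin (2 * √u * τ) := (pos_iff_pos_of_mul_pos hsin).1 hDpos
  have hle : 2 * √u * τ ≤ Real.pi := by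
    by_contra! h
    have := Real.sin_nonpos_of_nonpos_of_neg_pi_le (x := 2 * √u * τ - 2 * Real.pi)
      (by linarith) (by linarith)
    rw [Real.sin_sub_two_pi] at this
    linarith
  have hσ : 0 < s + u := by linarith
  have hsqrt : √(c ^ 2 - 4 * (s + u)) = |2 * (s + u) * q - c| := by
    rw [← hsq, Real.sqrt_sq_eq_abs]
  refine ⟨by nlinarith [sq_nonneg (2 * (s + u) * q - c)], ?_⟩
  obtain ⟨ε, hε, hεq⟩ : ∃ ε : ℝ, (ε = 1 ∨ ε = -1) ∧
      ε * √(c ^ 2 - 4 * (s + u)) = 2 * (s + u) * q - c := by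
    rw [hsqrt]
    rcases abs_cases (2 * (s + u) * q - c) with ⟨h, -⟩ | ⟨h, -⟩
    · exact ⟨1, Or.inl rfl, by rw [h]; ring⟩
    · exact ⟨-1, Or.inr rfl, by rw [h]; ring⟩
  refine ⟨ε, hε, ?_, ?_⟩
  · rw [arcTime, hD, show ε * (u * √(c ^ 2 - 4 * (s + u))) = u * (2 * (s + u) * q - c) by
      rw [← hεq]; ring]
    have : (-(s * c) + u * (2 * (s + u) * q - c)) / ((s + u) * D) = Real.cos (2 * √u * τ) := by
      rw [h1]; field_simp; ring
    rw [this, Real.arccos_cos (by positivity) hle]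
    field_simp
  · rw [hεq]; field_simp; ring

/-- `C = √s S` is the condition for carrying the slope `-√s` to `√s`; together with `C² - u S² = 1`
it gives `S² (s - u) = 1`. -/
lemma timeX_spec {u s : ℝ} (hu : 0 < u) (hs : u < s) :
    0 < timeX u s ∧ gcos (-u) (timeX u s) = √s * gsin (-u) (timeX u s) ∧
      gsin (-u) (timeX u s) ^ 2 * (s - u) = 1 := by
  have hsu : 0 < s - u := by linarith
  have hu' := Real.sqrt_pos.2 hu
  have hs0 : 0 < s := by linarith
  have h1 : 1 < (s + u) / (s - u) := by rw [lt_div_iff₀ hsu]; linarith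
  have hpos : 0 < timeX u s := by
    rw [timeX]; exact mul_pos (by positivity) (Real.arcosh_pos h1)
  have hθ : 2 * (√u * timeX u s) = Real.arcosh ((s + u) / (s - u)) := by
    rw [timeX]; field_simp
  have hc : Real.cosh (2 * (√u * timeX u s)) = (s + u) / (s - u) := by
    rw [hθ, Real.cosh_arcosh h1.le]
  have hS := gsin_neg_control_pos hu hpos
  have hC := gcos_neg_control_pos hu (timeX u s)
  have hk := gcos_sq_add (u := -u) (by linarith) (timeX u s)
  have h3 : gcos (-u) (timeX u s) ^ 2 + u * gsin (-u) (timeX u s) ^ 2 = (s + u) / (s - u) := by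
    rw [← hc, Real.cosh_two_mul, gcos_neg_control hu, gsin_neg_control hu, div_pow,
      Real.sq_sqrt hu.le]
    field_simp
  have h4 : gsin (-u) (timeX u s) ^ 2 * (s - u) = 1 := by
    field_simp at h3
    have : 2 * u * (gsin (-u) (timeX u s) ^ 2 * (s - u)) = 2 * u * 1 := by
      linear_combination h3 - (s - u) * hk
    exact mul_left_cancel₀ (by positivity) this
  refine ⟨hpos, ?_, h4⟩
  refine (pow_left_inj₀ hC.le (by positivity) two_ne_zero).1 ?_
  rw [mul_pow, Real.sq_sqrt hs0.le]
  linear_combination hk - h4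

lemma eq_timeX {u s τ : ℝ} (hu : 0 < u) (hs : 0 < s) (hτ : 0 < τ)
    (h : gcos (-u) τ = √s * gsin (-u) τ) : u < s ∧ τ = timeX u s := by
  have hS := gsin_neg_control_pos hu hτ
  have hk := gcos_sq_add (u := -u) (by linarith) τ
  have hu' := Real.sqrt_pos.2 hu
  rw [h, mul_pow, Real.sq_sqrt hs.le] at hk
  have h1 : gsin (-u) τ ^ 2 * (s - u) = 1 := by linarith
  have hsu : 0 < s - u := by
    refine (pos_iff_pos_of_mul_pos (a := gsin (-u) τ ^ 2) (by rw [h1]; exact one_pos)).1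
      (by positivity)
  refine ⟨by linarith, ?_⟩
  have h3 : Real.cosh (2 * (√u * τ)) = (s + u) / (s - u) := by
    have : Real.cosh (2 * (√u * τ)) = gcos (-u) τ ^ 2 + u * gsin (-u) τ ^ 2 := by
      rw [Real.cosh_two_mul, gcos_neg_control hu, gsin_neg_control hu, div_pow,
        Real.sq_sqrt hu.le]
      field_simp
    rw [this, h, mul_pow, Real.sq_sqrt hs.le, eq_div_iff hsu.ne']
    linear_combination (s + u) * h1
  rw [timeX, ← h3, Real.arcosh_cosh (by positivity)]
  field_simp

/-- Here the slope goes from `√s` to `-√s`, so `C / S` must be negative and the angle `√u T_Y` lies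
in the second quadrant. This is the source of `2 π - arccos` in `timeY`. -/
lemma timeY_spec {u s : ℝ} (hu : 0 < u) (hs : 0 < s) :
    0 < timeY u s ∧ √u * timeY u s < Real.pi ∧ Real.pi / 2 < √u * timeY u s ∧
      gcos u (timeY u s) = -(√s * gsin u (timeY u s)) ∧ gsin u (timeY u s) ^ 2 * (s + u) = 1 := by
  have hu' := Real.sqrt_pos.2 hu
  have hpi := Real.pi_pos
  set y := (s - u) / (s + u) with hy
  have hσ : 0 < s + u := by linarith
  have hy1 : y < 1 := by rw [hy, div_lt_one hσ]; linarith
  have hy2 : -1 < y := by rw [hy, lt_div_iff₀ hσ]; linarith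
  have ha1 : 0 < Real.arccos y := Real.arccos_pos.2 hy1
  have ha2 : Real.arccos y < Real.pi := by
    refine lt_of_le_of_ne (Real.arccos_le_pi y) fun h => ?_
    have := Real.arccos_eq_pi.1 h
    linarith
  have hθ : 2 * √u * timeY u s = 2 * Real.pi - Real.arccos y := by
    rw [timeY, ← hy]; field_simp
  have hpos : 0 < timeY u s := by
    refine (pos_iff_pos_of_mul_pos (a := 2 * √u) (by rw [hθ]; linarith)).1 (by positivity)
  have hlt : √u * timeY u s < Real.pi := by linarith
  have hgt : Real.pi / 2 < √u * timeY u s := by linarith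
  have hc : Real.cos (2 * √u * timeY u s) = y := by
    rw [hθ, Real.cos_two_pi_sub, Real.cos_arccos hy2.le hy1.le]
  have hS := gsin_pos hu hpos hlt
  have hC : gcos u (timeY u s) < 0 := by
    rw [gcos_of_pos hu]
    exact Real.cos_neg_of_pi_div_two_lt_of_lt hgt (by linarith)
  have h1 := gcos_sq_eq hu (timeY u s)
  have h2 := gsin_sq_eq hu (timeY u s)
  rw [hc, hy] at h1 h2
  have h4 : gsin u (timeY u s) ^ 2 * (s + u) = 1 := by
    rw [h2]; field_simp; ring
  refine ⟨hpos, hlt, hgt, ?_, h4⟩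
  have : -gcos u (timeY u s) = √s * gsin u (timeY u s) := by
    refine (pow_left_inj₀ (by linarith) (by positivity) two_ne_zero).1 ?_
    have hk := gcos_sq_add hu.ne' (timeY u s)
    rw [mul_pow, Real.sq_sqrt hs.le]
    linear_combination hk - h4
  linarith

lemma eq_timeY {u s τ : ℝ} (hu : 0 < u) (hs : 0 < s) (hτ : 0 < τ) (hτ' : √u * τ < Real.pi)
    (h : gcos u τ = -(√s * gsin u τ)) : τ = timeY u s ∧ gsin u τ ^ 2 * (s + u) = 1 := by
  have hS := gsin_pos hu hτ hτ'
  have hk := gcos_sq_add hu.ne' τ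
  have hu' := Real.sqrt_pos.2 hu
  have hs' := Real.sqrt_pos.2 hs
  have hσ : 0 < s + u := by linarith
  have h1 : gsin u τ ^ 2 * (s + u) = 1 := by
    rw [h, neg_sq, mul_pow, Real.sq_sqrt hs.le] at hk; linarith
  refine ⟨?_, h1⟩
  have hC : gcos u τ < 0 := by rw [h]; have := mul_pos hs' hS; linarith
  have hge : Real.pi / 2 ≤ √u * τ := by
    by_contra! hlt
    have := Real.cos_pos_of_mem_Ioo ⟨by have := mul_pos hu' hτ; linarith [Real.pi_pos], hlt⟩
    rw [← gcos_of_pos hu] at this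
    linarith
  have h3 : Real.cos (2 * Real.pi - 2 * √u * τ) = (s - u) / (s + u) := by
    have h2 := gcos_sq_eq hu τ
    rw [Real.cos_two_pi_sub, eq_div_iff hσ.ne']
    linear_combination (-2 * (s + u)) * h2 + 2 * (s + u) * hk - 2 * u * h1
  rw [timeY, ← h3, Real.arccos_cos (by linarith) (by linarith)]
  field_simp; ring

/-- A segment whose initial slope is opposite to `C / S`. -/
lemma flow_of_balanced {u κ τ : ℝ} (hu : u ≠ 0) {z : ℝ × ℝ × ℝ} (hz : IsState z)
    (hw : z.2.1 = -(κ * z.1)) (hC : gcos u τ = κ * gsin u τ) :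
    (flow u τ z).1 * z.1 = gsin u τ ^ 2 ∧ (flow u τ z).2.1 = κ * (flow u τ z).1 := by
  have hk := gcos_sq_add hu τ
  obtain ⟨q, w, e⟩ := z
  obtain ⟨hq, hd⟩ := hz
  simp only at hq hd hw
  simp only [flow]
  rw [hC] at hk ⊢
  set S := gsin u τ
  subst hw
  constructor
  · linear_combination S ^ 2 * hd
  · have : q * ((-u * (κ * S) * S * q + ((κ * S) ^ 2 - u * S ^ 2) * (-(κ * q)) + κ * S * S * e) -
        κ * ((κ * S) ^ 2 * q + 2 * (κ * S) * S * (-(κ * q)) + S ^ 2 * e)) = 0 := by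
      ring
    have := (mul_eq_zero.1 this).resolve_left hq.ne'
    linarith

end

section

/-! ### Spirals: chains of segments whose slopes alternate -/

/-- The controls of the form `YX…YXY`. -/
noncomputable def turnControl (u₁ u₂ : ℝ) (k : ℕ) : ℝ := if Even k then u₂ else -u₁

lemma turnControl_even {u₁ u₂ : ℝ} (j : ℕ) : turnControl u₁ u₂ (2 * j) = u₂ :=
  if_pos (even_two_mul j)

lemma turnControl_odd {u₁ u₂ : ℝ} (j : ℕ) : turnControl u₁ u₂ (2 * j + 1) = -u₁ :=
  if_neg (by simp)

lemma turnControl_ne_zero {u₁ u₂ : ℝ} (h₁ : 0 < u₁) (h₂ : 0 < u₂) (k : ℕ) :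
    turnControl u₁ u₂ k ≠ 0 := by
  rw [turnControl]; split_ifs <;> linarith

lemma turnControl_mem {u₁ u₂ : ℝ} (h₁ : 0 < u₁) (h₂ : 0 < u₂) (k : ℕ) :
    turnControl u₁ u₂ k ∈ Icc (-u₁) u₂ := by
  rw [turnControl]; split_ifs <;> constructor <;> linarith

/-- A chain of `2 n + 1` segments from `(1, 0)` to `(γ, 0)` whose inner segments are balanced. -/
structure IsSpiral (u₁ u₂ γ : ℝ) (n : ℕ) (τ : ℕ → ℝ) (z : ℕ → ℝ × ℝ × ℝ) : Prop where
  start : z 0 = (1, 0, 1)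
  finish : z (2 * n + 1) = (γ ^ 2, 0, 1 / γ ^ 2)
  step : ∀ k ≤ 2 * n, z (k + 1) = flow (turnControl u₁ u₂ k) (τ k) (z k)
  pos : ∀ k ≤ 2 * n, 0 < τ k
  lt_pi : ∀ k ≤ 2 * n, Even k → √u₂ * τ k < Real.pi
  balanced : ∀ k, 1 ≤ k → k < 2 * n → gcos (turnControl u₁ u₂ k) (τ k) * (z k).1 +
    gsin (turnControl u₁ u₂ k) (τ k) * (z k).2.1 = 0

/-- The explicit durations of a spiral with switching slopes `∓ √s`. -/
structure HasShape (u₁ u₂ γ : ℝ) (n : ℕ) (ε s : ℝ) (τ : ℕ → ℝ) : Prop where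
  lt : u₁ < s
  le : s ≤ sPlus u₂
  first : τ 0 = arcTime u₂ (cFirst u₂) ε s
  odd : ∀ j < n, τ (2 * j + 1) = timeX u₁ s
  even : ∀ j, 1 ≤ j → j < n → τ (2 * j) = timeY u₂ s
  last : τ (2 * n) = timeFinal u₂ γ s
  ratio : (cFirst u₂ - ε * √(cFirst u₂ ^ 2 - 4 * (s + u₂))) /
    (cLast u₂ γ + √(cLast u₂ γ ^ 2 - 4 * (s + u₂))) = ((s - u₁) / (s + u₂)) ^ n

/-- Time reversal. -/
def reverse (z : ℝ × ℝ × ℝ) : ℝ × ℝ × ℝ := (z.1, -z.2.1, z.2.2)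

lemma flow_reverse (u t : ℝ) (z : ℝ × ℝ × ℝ) :
    flow u t (reverse z) = reverse (flow u (-t) z) := by
  simp only [flow, reverse, gcos_neg, gsin_neg, Prod.mk.injEq]
  refine ⟨by ring, by ring, by ring⟩

lemma reverse_isState {z : ℝ × ℝ × ℝ} (hz : IsState z) : IsState (reverse z) :=
  ⟨hz.1, by simpa [reverse] using hz.2⟩

lemma cFirst_lt_cLast {u₂ γ : ℝ} (hu₂ : 1 ≤ u₂) (hγ : 1 < γ) : cFirst u₂ < cLast u₂ γ := by
  have h : 1 < γ ^ 2 := one_lt_pow₀ hγ two_ne_zero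
  have e : cLast u₂ γ - cFirst u₂ = (γ ^ 2 - 1) * (u₂ * γ ^ 2 - 1) / γ ^ 2 := by
    rw [cLast, cFirst]; field_simp; ring
  have : 0 < (γ ^ 2 - 1) * (u₂ * γ ^ 2 - 1) / γ ^ 2 :=
    div_pos (mul_pos (by linarith) (by nlinarith)) (by linarith)
  linarith

lemma cFirst_eq (u₂ : ℝ) : cFirst u₂ = u₂ * 1 + 1 / 1 := by rw [cFirst]; norm_num

lemma cLast_eq (u₂ γ : ℝ) : cLast u₂ γ = u₂ * γ ^ 2 + 1 / γ ^ 2 := rfl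

lemma le_sPlus_iff {u₂ s : ℝ} : s ≤ sPlus u₂ ↔ 4 * (s + u₂) ≤ cFirst u₂ ^ 2 := by
  rw [sPlus, cFirst, le_div_iff₀ (by norm_num)]
  constructor <;> intro h <;> linarith

lemma ratio_pos_lt_one {u₁ u₂ s : ℝ} (hu₁ : 0 < u₁) (hu₂ : 0 < u₂) (hs : u₁ < s) :
    0 < (s - u₁) / (s + u₂) ∧ (s - u₁) / (s + u₂) < 1 := by
  have : 0 < s + u₂ := by linarith
  exact ⟨div_pos (by linarith) this, by rw [div_lt_one this]; linarith⟩

lemma IsSpiral.isState {u₁ u₂ γ : ℝ} {n : ℕ} {τ : ℕ → ℝ} {z : ℕ → ℝ × ℝ × ℝ}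
    (h : IsSpiral u₁ u₂ γ n τ z) (hu₁ : 0 < u₁) (hu₂ : 0 < u₂) :
    ∀ k ≤ 2 * n + 1, IsState (z k) := by
  intro k
  induction k with
  | zero => intro _; rw [h.start]; norm_num [IsState]
  | succ k ih =>
    intro hk
    rw [h.step k (by omega)]
    exact flow_isState (turnControl_ne_zero hu₁ hu₂ k) _ (ih (by omega))

/-- Since `(c - R) (c + R) = 4 σ`, the product relation rewrites as a quotient. The smaller root at
the end would give `cₙ + Rₙ = ρ (c₁ + ε R₁)`, which is impossible because `ρ < 1`, `c₁ < cₙ` and `R₁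
≤ Rₙ`. -/
lemma ratio_of_product {c₁ cₙ R₁ Rₙ σ ε ε' ρ q₁ q₂ : ℝ} (hσ : 0 < σ) (hc₁ : 0 < c₁)
    (hcc : c₁ < cₙ) (hR₁ : R₁ ^ 2 = c₁ ^ 2 - 4 * σ) (hRₙ : Rₙ ^ 2 = cₙ ^ 2 - 4 * σ)
    (h₁ : 0 ≤ R₁) (hn : 0 ≤ Rₙ) (hε : ε = 1 ∨ ε = -1) (hε' : ε' = 1 ∨ ε' = -1)
    (hq₁ : q₁ = (c₁ + ε * R₁) / (2 * σ)) (hq₂ : q₂ = (cₙ + ε' * Rₙ) / (2 * σ)) (hρ : 0 < ρ)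
    (hρ1 : ρ < 1) (hprod : ρ * σ * (q₁ * q₂) = 1) :
    ε' = 1 ∧ (c₁ - ε * R₁) / (cₙ + Rₙ) = ρ := by
  have hRR : R₁ ≤ Rₙ := (pow_le_pow_iff_left₀ h₁ hn two_ne_zero).1 (by rw [hR₁, hRₙ]; nlinarith)
  have hlt : R₁ < c₁ := lt_of_pow_lt_pow_left₀ 2 hc₁.le (by rw [hR₁]; linarith)
  have hpm : 0 < c₁ + ε * R₁ ∧ 0 < c₁ - ε * R₁ ∧ c₁ + ε * R₁ ≤ c₁ + R₁ := by
    rcases hε with rfl | rfl <;> refine ⟨?_, ?_, ?_⟩ <;> linarith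
  have hn' : 0 < cₙ + Rₙ := by linarith
  have hε2 : ε ^ 2 = 1 := by rcases hε with rfl | rfl <;> norm_num
  have en : (cₙ + Rₙ) * (cₙ - Rₙ) = 4 * σ := by linear_combination -hRₙ
  have e1 : (c₁ + ε * R₁) * (c₁ - ε * R₁) = 4 * σ := by
    linear_combination -hR₁ - R₁ ^ 2 * hε2
  rw [hq₁, hq₂] at hprod
  rcases hε' with rfl | rfl
  · refine ⟨rfl, ?_⟩
    have h3 : ρ * ((c₁ + ε * R₁) * (cₙ + Rₙ)) = 4 * σ := by
      field_simp at hprod; linarith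
    rw [div_eq_iff hn'.ne']
    refine mul_left_cancel₀ hpm.1.ne' ?_
    rw [e1, ← h3]; ring
  · exfalso
    have h3 : ρ * ((c₁ + ε * R₁) * (cₙ - Rₙ)) = 4 * σ := by
      field_simp at hprod; linarith
    have h4 : cₙ - Rₙ > 0 := (pos_iff_pos_of_mul_pos (by rw [en]; linarith)).1 hn'
    have h5 : ρ * (c₁ + ε * R₁) = cₙ + Rₙ :=
      mul_right_cancel₀ h4.ne' (by rw [en, ← h3]; ring)
    nlinarith [hpm.1, hpm.2.2]

-- Balance reverses the slope across each inner segment, so the slope at the first switching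
-- determines all the others. What remains are the two outer arcs, each read off from its apse, and
-- the telescoped product of the values of `q`.
set_option maxHeartbeats 800000 in
lemma IsSpiral.hasShape {u₁ u₂ γ : ℝ} {n : ℕ} {τ : ℕ → ℝ} {z : ℕ → ℝ × ℝ × ℝ}
    (h : IsSpiral u₁ u₂ γ n τ z) (hu₁ : 0 < u₁) (hu₂ : 1 ≤ u₂) (hγ : 1 < γ) (hn : 1 ≤ n) :
    ∃ ε s : ℝ, (ε = 1 ∨ ε = -1) ∧ HasShape u₁ u₂ γ n ε s τ := by
  have hu₂' : 0 < u₂ := by linarith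
  have hst := h.isState hu₁ hu₂'
  have hγ2 : 1 < γ ^ 2 := one_lt_pow₀ hγ two_ne_zero
  have hq1 := (hst 1 (by omega)).1
  have hS1 : 0 < gsin (-u₁) (τ 1) := gsin_neg_control_pos hu₁ (h.pos 1 (by omega))
  have hC1 := gcos_neg_control_pos hu₁ (τ 1)
  have hb1 := h.balanced 1 le_rfl (by omega)
  rw [turnControl_odd 0] at hb1
  -- On an `X`-segment `C` and `S` are positive, so the balance forces the entering slope to be
  -- negative; it is then written as `-√s`.
  have hw1 : (z 1).2.1 < 0 := by
    by_contra! hc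
    have := mul_pos hC1 hq1
    have := mul_nonneg hS1.le hc
    linarith
  obtain ⟨κ, hκ⟩ : ∃ κ, κ = -((z 1).2.1 / (z 1).1) := ⟨_, rfl⟩
  have hκ0 : 0 < κ := by rw [hκ, neg_pos]; exact div_neg_of_neg_of_pos hw1 hq1
  have hw1' : (z 1).2.1 = -(κ * (z 1).1) := by rw [hκ]; field_simp
  obtain ⟨s, hs⟩ : ∃ s, s = κ ^ 2 := ⟨_, rfl⟩
  have hs0 : 0 < s := by rw [hs]; positivity
  have hκs : κ = √s := by rw [hs, Real.sqrt_sq hκ0.le]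
  rw [hκs] at hw1' hκ0
  -- the inner `X`-segments
  have hX : ∀ j < n, (z (2 * j + 1)).2.1 = -(√s * (z (2 * j + 1)).1) →
      τ (2 * j + 1) = timeX u₁ s ∧ u₁ < s ∧
      (s - u₁) * ((z (2 * j + 2)).1 * (z (2 * j + 1)).1) = 1 ∧
      (z (2 * j + 2)).2.1 = √s * (z (2 * j + 2)).1 := by
    intro j hj hw
    have hb := h.balanced (2 * j + 1) (by omega) (by omega)
    have hsx := h.step (2 * j + 1) (by omega)
    rw [turnControl_odd] at hb hsx
    have hq := (hst (2 * j + 1) (by omega)).1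
    have hC : gcos (-u₁) (τ (2 * j + 1)) = √s * gsin (-u₁) (τ (2 * j + 1)) := by
      rw [hw] at hb
      have : (z (2 * j + 1)).1 * (gcos (-u₁) (τ (2 * j + 1)) -
        √s * gsin (-u₁) (τ (2 * j + 1))) = 0 := by linarith
      have := (mul_eq_zero.1 this).resolve_left hq.ne'
      linarith
    obtain ⟨h1, h2⟩ := eq_timeX hu₁ hs0 (h.pos (2 * j + 1) (by omega)) hC
    obtain ⟨h3, h4⟩ := flow_of_balanced (by linarith) (hst (2 * j + 1) (by omega)) hw hC
    rw [← hsx] at h3 h4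
    refine ⟨h2, h1, ?_, h4⟩
    rw [show 2 * j + 2 = 2 * j + 1 + 1 by ring, h3]
    have hk := gcos_sq_add (u := -u₁) (by linarith) (τ (2 * j + 1))
    rw [hC, mul_pow, Real.sq_sqrt hs0.le] at hk
    linarith
  have hY : ∀ j, 1 ≤ j → j < n → (z (2 * j)).2.1 = √s * (z (2 * j)).1 →
      τ (2 * j) = timeY u₂ s ∧ (s + u₂) * ((z (2 * j + 1)).1 * (z (2 * j)).1) = 1 ∧
      (z (2 * j + 1)).2.1 = -(√s * (z (2 * j + 1)).1) := by
    intro j hj1 hj hw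
    have hb := h.balanced (2 * j) (by omega) (by omega)
    have hsx := h.step (2 * j) (by omega)
    rw [turnControl_even] at hb hsx
    have hq := (hst (2 * j) (by omega)).1
    have hC : gcos u₂ (τ (2 * j)) = -√s * gsin u₂ (τ (2 * j)) := by
      rw [hw] at hb
      have : (z (2 * j)).1 * (gcos u₂ (τ (2 * j)) + √s * gsin u₂ (τ (2 * j))) = 0 := by linarith
      have := (mul_eq_zero.1 this).resolve_left hq.ne'
      linarith
    obtain ⟨h1, h2⟩ := eq_timeY hu₂' hs0 (h.pos (2 * j) (by omega))
      (h.lt_pi _ (by omega) (even_two_mul j)) (by rw [hC, neg_mul])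
    obtain ⟨h3, h4⟩ := flow_of_balanced (κ := -√s) hu₂'.ne' (hst (2 * j) (by omega))
      (by rw [hw]; ring) hC
    rw [← hsx] at h3 h4
    exact ⟨h1, by rw [h3]; linarith, by rw [h4, neg_mul]⟩
  have hsu : u₁ < s := (hX 0 (by omega) hw1').2.1
  have hsu' : 0 < s - u₁ := by linarith
  have hσ : 0 < s + u₂ := by linarith
  obtain ⟨r, hr⟩ : ∃ r, r = (s - u₁) / (s + u₂) := ⟨_, rfl⟩
  have hr0 : 0 < r := hr ▸ (ratio_pos_lt_one hu₁ hu₂' hsu).1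
  have hr1 : r < 1 := hr ▸ (ratio_pos_lt_one hu₁ hu₂' hsu).2
  -- An `X`-segment followed by a `Y`-segment multiplies `q` by `r`: the intermediate value cancels
  -- between the two product relations.
  have hind : ∀ j < n, (z (2 * j + 1)).2.1 = -(√s * (z (2 * j + 1)).1) ∧
      (z (2 * j + 1)).1 = r ^ j * (z 1).1 := by
    intro j
    induction j with
    | zero => exact fun _ => ⟨hw1', by simp⟩
    | succ j ih =>
      intro hj
      obtain ⟨i1, i2⟩ := ih (by omega)
      obtain ⟨-, -, x3, x4⟩ := hX j (by omega) i1
      obtain ⟨-, y2, y3⟩ := hY (j + 1) (by omega) hj x4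
      refine ⟨y3, ?_⟩
      rw [pow_succ, mul_assoc, mul_comm r, ← mul_assoc, ← i2, hr]
      have hqz := (hst (2 * j + 2) (by omega)).1
      rw [show 2 * (j + 1) = 2 * j + 2 by ring] at y2 ⊢
      have : (z (2 * j + 2)).1 * ((z (2 * j + 2 + 1)).1 * (s + u₂)) =
          (z (2 * j + 2)).1 * ((z (2 * j + 1)).1 * (s - u₁)) := by linarith
      have := mul_left_cancel₀ hqz.ne' this
      field_simp
      linarith
  -- the first segment
  have h0s := h.step 0 (by omega)
  have e1 : ((1 : ℝ), (0 : ℝ), (1 : ℝ)) = (1, 0, 1 / 1) := by norm_num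
  rw [turnControl_even 0, h.start, e1] at h0s
  obtain ⟨f1, ε, hε, f2, f3⟩ := arcTime_of_flow hu₂' one_pos (by linarith) hs0 (h.pos 0 (by omega))
    (h.lt_pi 0 (by omega) Even.zero) (by rw [← h0s]; exact hw1')
  rw [← cFirst_eq] at f1 f2 f3
  rw [← h0s] at f3
  -- the last segment
  obtain ⟨m, rfl⟩ : ∃ m, n = m + 1 := ⟨n - 1, by omega⟩
  obtain ⟨l1, l2⟩ := hind m (by omega)
  obtain ⟨-, -, l3, l4⟩ := hX m (by omega) l1
  have hls := h.step (2 * (m + 1)) le_rfl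
  rw [h.finish, turnControl_even] at hls
  -- Reversing time turns the last segment into an arc that starts at the apse `γ²`, with the
  -- opposite slope at the switching.
  have hrev : flow u₂ (τ (2 * (m + 1))) (γ ^ 2, 0, 1 / γ ^ 2) = reverse (z (2 * (m + 1))) := by
    have : ((γ ^ 2, 0, 1 / γ ^ 2) : ℝ × ℝ × ℝ) = reverse (γ ^ 2, 0, 1 / γ ^ 2) := by
      simp [reverse]
    rw [this, flow_reverse, hls, flow_neg_flow hu₂'.ne']
  have hγu : 1 < u₂ * (γ ^ 2) ^ 2 := by nlinarith
  obtain ⟨g1, ε', hε', g2, g3⟩ := arcTime_of_flow (u := u₂) (g := γ ^ 2) hu₂' (by linarith)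
    hγu.le hs0 (h.pos (2 * (m + 1)) le_rfl) (h.lt_pi _ le_rfl (even_two_mul _)) (by
      rw [hrev]; simp only [reverse, mul_add, mul_one] at l4 ⊢; rw [l4])
  rw [← cLast_eq] at g1 g2 g3
  rw [hrev] at g3
  simp only [reverse] at g3
  have hε2 : ε ^ 2 = 1 := by rcases hε with rfl | rfl <;> norm_num
  have hprod : r ^ (m + 1) * (s + u₂) * ((z 1).1 * (z (2 * (m + 1))).1) = 1 := by
    have : r ^ (m + 1) * (s + u₂) = r ^ m * (s - u₁) := by
      rw [pow_succ, mul_assoc, hr]; field_simp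
    rw [this, show 2 * (m + 1) = 2 * m + 2 by ring]
    rw [l2] at l3
    linarith
  obtain ⟨rfl, hratio⟩ := ratio_of_product hσ (by rw [cFirst]; linarith) (cFirst_lt_cLast hu₂ hγ)
    (Real.sq_sqrt (by linarith)) (Real.sq_sqrt (by linarith)) (Real.sqrt_nonneg _)
    (Real.sqrt_nonneg _) hε hε' f3 g3 (pow_pos hr0 _) (pow_lt_one₀ hr0.le hr1 (Nat.succ_ne_zero m))
    hprod
  refine ⟨ε, s, hε, hsu, le_sPlus_iff.2 f1, f2, fun j hj => (hX j hj (hind j hj).1).1,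
    ?_, by rw [timeFinal_eq]; exact g2, by rw [hratio, hr]⟩
  intro j hj1 hj
  obtain ⟨i, rfl⟩ : ∃ i, j = i + 1 := ⟨j - 1, by omega⟩
  exact (hY (i + 1) hj1 hj (hX i (by omega) (hind i (by omega)).1).2.2.2).1

end

section

/-! ### Extremals with turns are spirals -/

lemma gsin_sub {u : ℝ} (hu : u ≠ 0) (a b : ℝ) :
    gsin u (a - b) = gsin u a * gcos u b - gcos u a * gsin u b := by
  rcases lt_or_gt_of_ne hu with h | h
  · obtain ⟨v, rfl⟩ : ∃ v, u = -v := ⟨-u, by ring⟩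
    have h' : 0 < v := by linarith
    simp only [gsin_neg_control h', gcos_neg_control h', mul_sub, Real.sinh_sub]
    ring
  · simp only [gsin_of_pos h, gcos_of_pos h, mul_sub, Real.sin_sub]
    ring

/-- A switching function vanishing at time `0` is `S (ψ C + l₀ S)`, of period `π / √u`, and has a
simple zero there. It therefore takes opposite signs just after `0` and just before `π / √u`, so a
segment with constant sign is shorter than the period. -/
lemma lt_pi_of_sign {u l₀ ψ τ : ℝ} (hu : 0 < u) (hψ : ψ ≠ 0)
    (h : ∀ σ ∈ Icc 0 τ, swFun u l₀ 0 ψ σ ≤ 0) : √u * τ < Real.pi := by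
  by_contra! hτ
  have hu' := Real.sqrt_pos.2 hu
  have hP : 0 < Real.pi / √u := div_pos Real.pi_pos hu'
  have hPτ : Real.pi / √u ≤ τ := by rw [div_le_iff₀ hu']; linarith
  have hcont : Continuous fun σ => |ψ| * gcos u σ + l₀ * gsin u σ :=
    (continuous_const.mul (continuous_gcos hu.ne')).add
      (continuous_const.mul (continuous_gsin hu.ne'))
  have h0 : 0 < |ψ| * gcos u 0 + l₀ * gsin u 0 := by simpa using hψ
  have hev := (hcont.tendsto 0).eventually (lt_mem_nhds h0)
  obtain ⟨δ, hδ, hball⟩ := Metric.eventually_nhds_iff.1 hev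
  obtain ⟨σ, hσ1, hσ2⟩ : ∃ σ, 0 < σ ∧ σ < min δ (Real.pi / √u) :=
    exists_between (lt_min hδ hP)
  have hσδ := hσ2.trans_le (min_le_left _ _)
  have hσP := hσ2.trans_le (min_le_right _ _)
  have hσπ : √u * σ < Real.pi := by rwa [lt_div_iff₀ hu', mul_comm] at hσP
  have hpos : 0 < |ψ| * gcos u σ + l₀ * gsin u σ :=
    hball (by rw [Real.dist_eq, sub_zero, abs_of_pos hσ1]; exact hσδ)
  have hS := gsin_pos hu hσ1 hσπ
  have e1 := h σ ⟨hσ1.le, by linarith⟩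
  have e2 := h (Real.pi / √u - σ) ⟨by linarith, by linarith⟩
  have hmul : √u * (Real.pi / √u - σ) = Real.pi - √u * σ := by field_simp
  have c1 : gcos u (Real.pi / √u - σ) = -gcos u σ := by
    rw [gcos_of_pos hu, gcos_of_pos hu, hmul, Real.cos_pi_sub]
  have c2 : gsin u (Real.pi / √u - σ) = gsin u σ := by
    rw [gsin_of_pos hu, gsin_of_pos hu, hmul, Real.sin_pi_sub]
  simp only [swFun, c1, c2] at e1 e2
  have e1' : ψ * gcos u σ + l₀ * gsin u σ ≤ 0 := by
    by_contra! hc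
    have := mul_pos hS hc
    nlinarith
  have e2' : -ψ * gcos u σ + l₀ * gsin u σ ≤ 0 := by
    by_contra! hc
    have := mul_pos hS hc
    nlinarith
  rcases abs_cases ψ with ⟨ha, -⟩ | ⟨ha, -⟩ <;> rw [ha] at hpos <;> linarith

variable {u₁ u₂ γ T : ℝ} {x : ℝ → ℝ × ℝ} {u : ℝ → ℝ} {n : ℕ} {t : ℕ → ℝ}

lemma lift_start (hx : IsTransfer u₁ u₂ γ T x u) : lift (x 0) = (1, 0, 1) := by
  rw [hx.start]; simp [lift]

lemma lift_finish (hx : IsTransfer u₁ u₂ γ T x u) : lift (x T) = (γ ^ 2, 0, 1 / γ ^ 2) := by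
  rw [hx.finish]; simp [lift]

/-- The switching function vanishes between segments of opposite controls. -/
lemma switching_zero {v v' φ : ℝ} (h₁ : 0 < u₁) (h₂ : 0 < u₂)
    (hv : v = u₂ ∧ v' = -u₁ ∨ v = -u₁ ∧ v' = u₂)
    (h : ∀ c ∈ Icc (-u₁) u₂, φ * (v - c) ≤ 0) (h' : ∀ c ∈ Icc (-u₁) u₂, φ * (v' - c) ≤ 0) :
    φ = 0 := by
  have m1 : -u₁ ∈ Icc (-u₁) u₂ := ⟨le_rfl, by linarith⟩
  have m2 : u₂ ∈ Icc (-u₁) u₂ := ⟨by linarith, le_rfl⟩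
  have a1 := h _ m1
  have a2 := h _ m2
  have a3 := h' _ m1
  have a4 := h' _ m2
  rcases hv with ⟨rfl, rfl⟩ | ⟨rfl, rfl⟩ <;> nlinarith

lemma nonpos_of_max {φ : ℝ} (h₁ : 0 < u₁) (h₂ : 0 < u₂)
    (h : ∀ c ∈ Icc (-u₁) u₂, φ * (u₂ - c) ≤ 0) : φ ≤ 0 := by
  have := h (-u₁) ⟨le_rfl, by linarith⟩
  by_contra! hc
  nlinarith

/-- The zeros of `φ` at both ends of an inner segment give `ψ C + l₀ S = 0`, and the Hamiltonian at
its start gives `l₀ q = ψ w`; eliminating `l₀` leaves the balance, as `ψ ≠ 0`. -/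
lemma HasTurns.isSpiral (hb : HasTurns u₁ u₂ T u n t) (hx : IsTransfer u₁ u₂ γ T x u)
    (he : IsExtremal u₁ u₂ T x u) (h₁ : 0 < u₁) (h₂ : 0 < u₂) (hn : 1 ≤ n) :
    IsSpiral u₁ u₂ γ n (fun k => t (k + 1) - t k) (fun k => lift (x (t k))) := by
  have hv0 : ∀ k ≤ 2 * n, turnControl u₁ u₂ k ≠ 0 := fun k _ => turnControl_ne_zero h₁ h₂ k
  change IsBangBang T u (2 * n) t (turnControl u₁ u₂) at hb
  obtain ⟨l₀, φ, ψ, hφ, hsg, hsw⟩ := hb.exists_switching_function hx.trajectory he hv0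
  have hle := hb.le
  have hlt := hb.2.2.1
  have hzero : ∀ k, 1 ≤ k → k ≤ 2 * n → φ (t k) = 0 := by
    intro k hk1 hk
    obtain ⟨m, rfl⟩ : ∃ m, k = m + 1 := ⟨k - 1, by omega⟩
    refine switching_zero h₁ h₂ ?_ (hsg m (by omega) (t (m + 1)) ⟨hle m (by omega), le_rfl⟩)
      (hsg (m + 1) hk _ ⟨le_rfl, hle _ hk⟩)
    rcases Nat.even_or_odd' m with ⟨j, rfl | rfl⟩
    · exact Or.inl ⟨turnControl_even j, turnControl_odd j⟩
    · exact Or.inr ⟨turnControl_odd j, turnControl_even (j + 1)⟩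
  refine ⟨?_, ?_, ?_, ?_, ?_, ?_⟩
  · simp only [hb.1]; exact lift_start hx
  · simp only [hb.2.1]; exact lift_finish hx
  · exact fun k hk => hb.lift_eq_flow hx.trajectory hk (hv0 k hk) le_rfl (hle k hk) le_rfl
  · exact fun k hk => sub_pos.2 (hlt k hk)
  · intro k hk hev
    have hvk : turnControl u₁ u₂ k = u₂ := if_pos hev
    have hsgn : ∀ r ∈ Icc (t k) (t (k + 1)), φ r ≤ 0 := fun r hr =>
      nonpos_of_max h₁ h₂ (by have := hsg k hk r hr; rwa [hvk] at this)
    by_cases hk1 : 1 ≤ k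
    · have h0 := hzero k hk1 hk
      refine lt_pi_of_sign h₂ (hsw k hk _ ⟨le_rfl, hle k hk⟩ h0).1 (l₀ := l₀) fun σ hσ => ?_
      have hm : t k + σ ∈ Icc (t k) (t (k + 1)) := ⟨by linarith [hσ.1], by linarith [hσ.2]⟩
      have := hφ k hk (t k) ⟨le_rfl, hle k hk⟩ _ hm
      rw [h0, hvk, add_sub_cancel_left] at this
      rw [← this]
      exact hsgn _ hm
    · obtain rfl : k = 0 := by omega
      -- On the initial segment `φ` is only known to vanish at the right end, so the period argument
      -- runs backwards from there.
      have h0 := hzero 1 le_rfl (by omega)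
      refine lt_pi_of_sign h₂ (neg_ne_zero.2 (hsw 0 hk _ ⟨hle 0 hk, le_rfl⟩ h0).1) (l₀ := l₀)
        fun σ hσ => ?_
      have hm : t (0 + 1) - σ ∈ Icc (t 0) (t (0 + 1)) :=
        ⟨by linarith [hσ.2], by linarith [hσ.1]⟩
      have := hφ 0 hk (t (0 + 1)) ⟨hle 0 hk, le_rfl⟩ _ hm
      have e : ∀ p, swFun u₂ l₀ 0 (-p) σ = swFun u₂ l₀ 0 p (-σ) := fun p => by
        simp only [swFun, gcos_neg, gsin_neg]; ring
      rw [zero_add] at this hm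
      rw [h0, hvk, sub_sub_cancel_left] at this
      rw [e, zero_add, ← this]
      exact hsgn _ hm
  · intro k hk1 hk
    have h0 := hzero k hk1 hk.le
    have h1 := hzero (k + 1) (by omega) (by omega)
    have hm : t k ∈ Icc (t k) (t (k + 1)) := ⟨le_rfl, hle k hk.le⟩
    obtain ⟨hψ, hH⟩ := hsw k hk.le _ hm h0
    have e := hφ k hk.le _ hm (t (k + 1)) ⟨hle k hk.le, le_rfl⟩
    have hS : gsin (turnControl u₁ u₂ k) (t (k + 1) - t k) ≠ 0 := by
      have hpos := sub_pos.2 (hlt k hk.le)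
      rcases Nat.even_or_odd' k with ⟨j, rfl | rfl⟩
      · have hpi : √u₂ * (t (2 * j + 1) - t (2 * j)) < Real.pi := by
          refine lt_pi_of_sign h₂ hψ (l₀ := l₀) fun σ hσ => ?_
          have hm' : t (2 * j) + σ ∈ Icc (t (2 * j)) (t (2 * j + 1)) :=
            ⟨by linarith [hσ.1], by linarith [hσ.2]⟩
          have := hφ _ hk.le (t (2 * j)) hm _ hm'
          rw [h0, turnControl_even, add_sub_cancel_left] at this
          rw [← this]
          have := hsg _ hk.le _ hm'
          rw [turnControl_even] at this
          exact nonpos_of_max h₁ h₂ this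
        rw [turnControl_even]
        exact (gsin_pos h₂ hpos hpi).ne'
      · rw [turnControl_odd]
        exact (gsin_neg_control_pos h₁ hpos).ne'
    rw [h0, h1] at e
    simp only [swFun] at e
    set C := gcos (turnControl u₁ u₂ k) (t (k + 1) - t k)
    set S := gsin (turnControl u₁ u₂ k) (t (k + 1) - t k)
    have e' : S * (ψ (t k) * C + l₀ * S) = 0 := by linarith
    have e2 := (mul_eq_zero.1 e').resolve_left hS
    have : ψ (t k) * (C * (lift (x (t k))).1 + S * (lift (x (t k))).2.1) = 0 := by
      linear_combination (lift (x (t k))).1 * e2 - S * hH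
    exact (mul_eq_zero.1 this).resolve_left hψ

/-! ### Total durations -/

/-- The total duration of a spiral. -/
noncomputable def spiralTime (u₁ u₂ γ : ℝ) (n : ℕ) (ε s : ℝ) : ℝ :=
  arcTime u₂ (cFirst u₂) ε s + n * timeX u₁ s + ((n : ℝ) - 1) * timeY u₂ s + timeFinal u₂ γ s

lemma timeTurns_eq (u₁ u₂ γ : ℝ) (n : ℕ) (s : ℝ) :
    timeTurns u₁ u₂ γ n s = spiralTime u₁ u₂ γ n (-1) s := by
  rw [timeTurns, spiralTime, timeInitial_eq]

lemma sum_alternating (τ : ℕ → ℝ) (m : ℕ) : ∑ k ∈ Finset.range (2 * (m + 1) + 1), τ k =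
    τ 0 + ∑ j ∈ Finset.range (m + 1), τ (2 * j + 1) +
      ∑ j ∈ Finset.range m, τ (2 * (j + 1)) + τ (2 * (m + 1)) := by
  induction m with
  | zero => simp [Finset.sum_range_succ]
  | succ m ih =>
    rw [show 2 * (m + 1 + 1) + 1 = 2 * (m + 1) + 1 + 1 + 1 by ring, Finset.sum_range_succ,
      Finset.sum_range_succ, ih, Finset.sum_range_succ _ (m + 1),
      Finset.sum_range_succ (fun j => τ (2 * (j + 1))) m]
    rw [show 2 * (m + 1 + 1) = 2 * (m + 1) + 1 + 1 by ring]
    ring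

lemma HasShape.sum_eq {ε s : ℝ} {τ : ℕ → ℝ} (h : HasShape u₁ u₂ γ n ε s τ) (hn : 1 ≤ n) :
    ∑ k ∈ Finset.range (2 * n + 1), τ k = spiralTime u₁ u₂ γ n ε s := by
  obtain ⟨m, rfl⟩ : ∃ m, n = m + 1 := ⟨n - 1, by omega⟩
  rw [sum_alternating, h.first, h.last, spiralTime,
    Finset.sum_congr rfl fun j hj => h.odd j (Finset.mem_range.1 hj),
    Finset.sum_congr rfl fun j hj => h.even (j + 1) (by omega)
      (by have := Finset.mem_range.1 hj; omega)]
  simp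

lemma IsBangBang.sum_eq {N : ℕ} {v : ℕ → ℝ} (hb : IsBangBang T u N t v) :
    ∑ k ∈ Finset.range (N + 1), (t (k + 1) - t k) = T := by
  rw [Finset.sum_range_sub, hb.1, hb.2.1, sub_zero]

end

section

/-! ### Existence of the extremals with turns -/

/-- The states at the switchings of the chain of segments with durations `τ`. -/
noncomputable def chainState (u₁ u₂ : ℝ) (τ : ℕ → ℝ) : ℕ → ℝ × ℝ × ℝ
  | 0 => (1, 0, 1)
  | k + 1 => flow (turnControl u₁ u₂ k) (τ k) (chainState u₁ u₂ τ k)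

lemma chainState_isState {u₁ u₂ : ℝ} (h₁ : 0 < u₁) (h₂ : 0 < u₂) (τ : ℕ → ℝ) :
    ∀ k, IsState (chainState u₁ u₂ τ k)
  | 0 => by norm_num [IsState, chainState]
  | k + 1 => flow_isState (turnControl_ne_zero h₁ h₂ k) _ (chainState_isState h₁ h₂ τ k)

variable {u₁ u₂ γ T : ℝ} {x : ℝ → ℝ × ℝ} {u : ℝ → ℝ} {n : ℕ} {t τ : ℕ → ℝ} {ε s : ℝ}

lemma HasShape.one_lt (h : HasShape u₁ u₂ γ n ε s τ) (h₁ : 0 < u₁) (h₂ : 1 ≤ u₂) : 1 < u₂ := by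
  rcases h₂.eq_or_lt with rfl | h'
  · have := h.lt.trans_le h.le
    norm_num [sPlus] at this
    linarith
  · exact h'

lemma arcTime_nonneg (u c ε s : ℝ) : 0 ≤ arcTime u c ε s :=
  mul_nonneg (by positivity) (Real.arccos_nonneg _)

lemma sqrt_mul_arcTime_le {u c ε s : ℝ} (hu : 0 < u) : √u * arcTime u c ε s ≤ Real.pi / 2 := by
  have hu' := Real.sqrt_pos.2 hu
  rw [arcTime, ← mul_assoc, show √u * (1 / (2 * √u)) = 1 / 2 by field_simp]
  linarith [Real.arccos_le_pi ((-(s * c) + ε * (u * √(c ^ 2 - 4 * (s + u)))) /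
    ((s + u) * √(c ^ 2 - 4 * u)))]

/-! ### The states along a chain with the prescribed durations -/

section Chain

lemma HasShape.chain_first (h : HasShape u₁ u₂ γ n ε s τ) (hε : ε ^ 2 = 1) (h₁ : 0 < u₁)
    (h₂ : 1 ≤ u₂) :
    (chainState u₁ u₂ τ 1).1 =
      (cFirst u₂ + ε * √(cFirst u₂ ^ 2 - 4 * (s + u₂))) / (2 * (s + u₂)) ∧
    (chainState u₁ u₂ τ 1).2.1 = -(√s * (chainState u₁ u₂ τ 1).1) := by
  have hu := h.one_lt h₁ h₂
  have hs : 0 < s := h₁.trans h.lt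
  have hle := le_sPlus_iff.1 h.le
  rw [cFirst_eq] at hle
  obtain ⟨a1, a2⟩ := flow_arcTime (u := u₂) (g := 1) (by linarith) one_pos (by linarith) hs hε hle
  have e : chainState u₁ u₂ τ 1 = flow u₂ (arcTime u₂ (u₂ * 1 + 1 / 1) ε s) (1, 0, 1 / 1) := by
    rw [chainState, chainState, turnControl_even 0, h.first, ← cFirst_eq]
    norm_num
  rw [e, cFirst_eq, a2, a1]
  exact ⟨rfl, rfl⟩

lemma HasShape.chain_X (h : HasShape u₁ u₂ γ n ε s τ) (h₁ : 0 < u₁) (h₂ : 1 ≤ u₂) {j : ℕ}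
    (hj : j < n) (hw : (chainState u₁ u₂ τ (2 * j + 1)).2.1 =
      -(√s * (chainState u₁ u₂ τ (2 * j + 1)).1)) :
    (chainState u₁ u₂ τ (2 * j + 2)).1 * (chainState u₁ u₂ τ (2 * j + 1)).1 * (s - u₁) = 1 ∧
    (chainState u₁ u₂ τ (2 * j + 2)).2.1 = √s * (chainState u₁ u₂ τ (2 * j + 2)).1 := by
  have hst := chainState_isState (u₂ := u₂) h₁ (by linarith) τ (2 * j + 1)
  obtain ⟨-, hC, hS⟩ := timeX_spec h₁ h.lt
  obtain ⟨a1, a2⟩ := flow_of_balanced (by linarith) hst hw hC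
  have e : chainState u₁ u₂ τ (2 * j + 2) = flow (-u₁) (timeX u₁ s)
      (chainState u₁ u₂ τ (2 * j + 1)) := by
    rw [chainState, turnControl_odd, h.odd j hj]
  rw [e, a1, hS]
  exact ⟨rfl, a2⟩

lemma HasShape.chain_Y (h : HasShape u₁ u₂ γ n ε s τ) (h₁ : 0 < u₁) (h₂ : 1 ≤ u₂) {j : ℕ}
    (hj1 : 1 ≤ j) (hj : j < n) (hw : (chainState u₁ u₂ τ (2 * j)).2.1 =
      √s * (chainState u₁ u₂ τ (2 * j)).1) :
    (chainState u₁ u₂ τ (2 * j + 1)).1 * (chainState u₁ u₂ τ (2 * j)).1 * (s + u₂) = 1 ∧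
    (chainState u₁ u₂ τ (2 * j + 1)).2.1 = -(√s * (chainState u₁ u₂ τ (2 * j + 1)).1) := by
  have hu : 0 < u₂ := by linarith
  have hst := chainState_isState h₁ hu τ (2 * j)
  obtain ⟨-, -, -, hC, hS⟩ := timeY_spec hu (h₁.trans h.lt)
  obtain ⟨a1, a2⟩ := flow_of_balanced (κ := -√s) hu.ne' hst (by rw [hw]; ring)
    (by rw [hC]; ring)
  have e : chainState u₁ u₂ τ (2 * j + 1) = flow u₂ (timeY u₂ s)
      (chainState u₁ u₂ τ (2 * j)) := by
    rw [chainState, turnControl_even, h.even j hj1 hj]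
  rw [e, a1, hS]
  exact ⟨rfl, by rw [a2]; ring⟩

lemma HasShape.chain_odd (h : HasShape u₁ u₂ γ n ε s τ) (hε : ε ^ 2 = 1) (h₁ : 0 < u₁)
    (h₂ : 1 ≤ u₂) : ∀ j < n,
    (chainState u₁ u₂ τ (2 * j + 1)).2.1 = -(√s * (chainState u₁ u₂ τ (2 * j + 1)).1) ∧
    (chainState u₁ u₂ τ (2 * j + 1)).1 =
      ((s - u₁) / (s + u₂)) ^ j * (chainState u₁ u₂ τ 1).1 := by
  intro j
  induction j with
  | zero => exact fun _ => ⟨(h.chain_first hε h₁ h₂).2, by simp⟩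
  | succ j ih =>
    intro hj
    obtain ⟨i1, i2⟩ := ih (by omega)
    obtain ⟨x1, x2⟩ := h.chain_X h₁ h₂ (by omega) i1
    obtain ⟨y1, y2⟩ := h.chain_Y h₁ h₂ (j := j + 1) (by omega) hj x2
    refine ⟨y2, ?_⟩
    have hq := (chainState_isState (u₂ := u₂) h₁ (by linarith) τ (2 * j + 2)).1
    have hσ : 0 < s + u₂ := by linarith [h.lt]
    rw [pow_succ, mul_right_comm, ← i2]
    rw [show 2 * (j + 1) = 2 * j + 2 by ring] at y1 ⊢
    rw [mul_div_assoc', eq_div_iff hσ.ne']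
    refine mul_left_cancel₀ hq.ne' ?_
    linarith

lemma HasShape.chain_even (h : HasShape u₁ u₂ γ n ε s τ) (hε : ε ^ 2 = 1) (h₁ : 0 < u₁)
    (h₂ : 1 ≤ u₂) {j : ℕ} (hj1 : 1 ≤ j) (hj : j ≤ n) :
    (chainState u₁ u₂ τ (2 * j)).2.1 = √s * (chainState u₁ u₂ τ (2 * j)).1 := by
  obtain ⟨m, rfl⟩ : ∃ m, j = m + 1 := ⟨j - 1, by omega⟩
  exact (h.chain_X h₁ h₂ (j := m) (by omega) (h.chain_odd hε h₁ h₂ m (by omega)).1).2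

/-- The ratio equation says precisely that the chain reaches its last switching at the larger root
for the energy `c_{n+1}`. There it agrees with the time-reversed arc from the target apse, so the
final duration leads to `γ²`. -/
lemma HasShape.chain_last (h : HasShape u₁ u₂ γ n ε s τ) (hε : ε ^ 2 = 1) (h₁ : 0 < u₁)
    (h₂ : 1 ≤ u₂) (hγ : 1 < γ) (hn : 1 ≤ n) :
    chainState u₁ u₂ τ (2 * n + 1) = (γ ^ 2, 0, 1 / γ ^ 2) := by
  have hu : 0 < u₂ := by linarith
  have hs : 0 < s := h₁.trans h.lt
  have hσ : 0 < s + u₂ := by linarith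
  have hγ2 : 1 < γ ^ 2 := one_lt_pow₀ hγ two_ne_zero
  have hγu : 1 < u₂ * (γ ^ 2) ^ 2 := by nlinarith
  have hle := le_sPlus_iff.1 h.le
  have hcc := cFirst_lt_cLast h₂ hγ
  have hc1 : 0 < cFirst u₂ := by rw [cFirst]; linarith
  have hlen : 4 * (s + u₂) ≤ cLast u₂ γ ^ 2 := by nlinarith
  have hst := chainState_isState (u₂ := u₂) h₁ hu τ (2 * n)
  have hwl := h.chain_even hε h₁ h₂ hn le_rfl
  obtain ⟨m, rfl⟩ : ∃ m, n = m + 1 := ⟨n - 1, by omega⟩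
  obtain ⟨i1, i2⟩ := h.chain_odd hε h₁ h₂ m (by omega)
  obtain ⟨x1, -⟩ := h.chain_X h₁ h₂ (j := m) (by omega) i1
  have f1 := (h.chain_first hε h₁ h₂).1
  have hq : (chainState u₁ u₂ τ (2 * (m + 1))).1 =
      (cLast u₂ γ + 1 * √(cLast u₂ γ ^ 2 - 4 * (s + u₂))) / (2 * (s + u₂)) := by
    have hr := h.ratio
    have hR1 : √(cFirst u₂ ^ 2 - 4 * (s + u₂)) ^ 2 = cFirst u₂ ^ 2 - 4 * (s + u₂) :=
      Real.sq_sqrt (by linarith)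
    have hn' : 0 < cLast u₂ γ + √(cLast u₂ γ ^ 2 - 4 * (s + u₂)) := by
      have := Real.sqrt_nonneg (cLast u₂ γ ^ 2 - 4 * (s + u₂))
      linarith
    have hpm := add_mul_pos_of_sq hc1 (R := √(cFirst u₂ ^ 2 - 4 * (s + u₂)))
      (by rw [hR1]; linarith) hε
    have hsu : 0 < s - u₁ := by linarith [h.lt]
    rw [show 2 * (m + 1) = 2 * m + 2 by ring]
    rw [i2, f1] at x1
    generalize √(cFirst u₂ ^ 2 - 4 * (s + u₂)) = R₁ at *
    generalize √(cLast u₂ γ ^ 2 - 4 * (s + u₂)) = Rₙ at *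
    generalize (chainState u₁ u₂ τ (2 * m + 2)).1 = q at *
    have e1 : (cFirst u₂ + ε * R₁) * (cFirst u₂ - ε * R₁) = 4 * (s + u₂) := by
      linear_combination -hR1 - R₁ ^ 2 * hε
    rw [div_eq_iff hn'.ne', pow_succ] at hr
    generalize hρ : ((s - u₁) / (s + u₂)) ^ m = ρ at *
    have hρ0 : 0 < ρ := by rw [← hρ]; exact pow_pos (div_pos hsu hσ) m
    rw [hr] at e1
    field_simp at e1 x1 ⊢
    have hk : 0 < (cFirst u₂ + ε * R₁) * ρ * (s - u₁) := by positivity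
    refine mul_right_cancel₀ hk.ne' ?_
    linear_combination (2 * (s + u₂)) * x1 - e1
  obtain ⟨a1, a2⟩ := flow_arcTime (u := u₂) (g := γ ^ 2) (ε := 1) hu (by linarith) hγu hs
    (by norm_num) (by rw [← cLast_eq]; exact hlen)
  rw [← cLast_eq, ← timeFinal_eq] at a1 a2
  have e : chainState u₁ u₂ τ (2 * (m + 1)) =
      reverse (flow u₂ (timeFinal u₂ γ s) (γ ^ 2, 0, 1 / γ ^ 2)) := by
    refine state_ext hst (reverse_isState (flow_isState hu.ne' _ (isState_apse (by linarith)))) ?_ ?_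
    · simp only [reverse]; rw [a1, hq]
    · simp only [reverse]; rw [a2, hwl, hq, neg_neg]
  have e3 : ((γ ^ 2, 0, 1 / γ ^ 2) : ℝ × ℝ × ℝ) = reverse (γ ^ 2, 0, 1 / γ ^ 2) := by
    simp [reverse]
  rw [chainState, turnControl_even, h.last, e, flow_reverse, flow_neg_flow hu.ne', ← e3]

end Chain

/-- The outer durations are arccosines and hence nonnegative; they are not zero because `w` vanishes
at exactly one end of each outer segment. -/
lemma HasShape.pos (h : HasShape u₁ u₂ γ n ε s τ) (hε : ε ^ 2 = 1) (h₁ : 0 < u₁)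
    (h₂ : 1 ≤ u₂) (hγ : 1 < γ) (hn : 1 ≤ n) : ∀ k ≤ 2 * n, 0 < τ k := by
  intro k hk
  have hu : 0 < u₂ := by linarith
  have hs : 0 < s := h₁.trans h.lt
  have hne : ∀ k ≤ 2 * n, (chainState u₁ u₂ τ k).2.1 ≠ 0 ∨
      (chainState u₁ u₂ τ (k + 1)).2.1 ≠ 0 → (chainState u₁ u₂ τ k).2.1 = 0 ∨
      (chainState u₁ u₂ τ (k + 1)).2.1 = 0 → τ k ≠ 0 := by
    intro k hk h1 h2 h0
    have : chainState u₁ u₂ τ (k + 1) = chainState u₁ u₂ τ k := by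
      rw [chainState, h0, flow_zero]
    rw [this] at h1 h2
    tauto
  have hs' := Real.sqrt_pos.2 hs
  by_cases hk0 : k = 0
  · subst hk0
    refine lt_of_le_of_ne (h.first ▸ arcTime_nonneg _ _ _ _) (Ne.symm (hne 0 hk ?_ ?_))
    · right
      rw [(h.chain_first hε h₁ h₂).2]
      have := (chainState_isState h₁ hu τ 1).1
      exact neg_ne_zero.2 (mul_pos hs' this).ne'
    · left; rfl
  by_cases hkn : k = 2 * n
  · subst hkn
    refine lt_of_le_of_ne (by rw [h.last, timeFinal_eq]; exact arcTime_nonneg _ _ _ _)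
      (Ne.symm (hne _ hk ?_ ?_))
    · left
      rw [h.chain_even hε h₁ h₂ hn le_rfl]
      exact (mul_pos hs' (chainState_isState h₁ hu τ (2 * n)).1).ne'
    · right; rw [h.chain_last hε h₁ h₂ hγ hn]
  rcases Nat.even_or_odd' k with ⟨j, rfl | rfl⟩
  · rw [h.even j (by omega) (by omega)]
    exact (timeY_spec hu hs).1
  · rw [h.odd j (by omega)]
    exact (timeX_spec h₁ h.lt).1

/-- The durations `T_I, T_X, T_Y, …, T_X, T_F`. -/
noncomputable def turnDuration (u₁ u₂ γ : ℝ) (n : ℕ) (s : ℝ) (k : ℕ) : ℝ :=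
  if k = 0 then timeInitial u₂ s else if k = 2 * n then timeFinal u₂ γ s
  else if Even k then timeY u₂ s else timeX u₁ s

lemma IsRatio.hasShape (h : IsRatio u₁ u₂ γ n s) (hn : 1 ≤ n) :
    HasShape u₁ u₂ γ n (-1) s (turnDuration u₁ u₂ γ n s) := by
  refine ⟨h.1.1, h.1.2, ?_, fun j hj => ?_, fun j hj1 hj => ?_, ?_, ?_⟩
  · rw [turnDuration, if_pos rfl, timeInitial_eq]
  · rw [turnDuration, if_neg (by omega), if_neg (by omega), if_neg (by simp)]
  · rw [turnDuration, if_neg (by omega), if_neg (by omega), if_pos (even_two_mul j)]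
  · rw [turnDuration, if_neg (by omega), if_pos rfl]
  · rw [← h.2, neg_one_mul, sub_neg_eq_add]

/-- After a balanced segment the switching function is zero again with the opposite derivative. So
the derivatives `± 1 / √s` at the switchings fit together along the chain. -/
lemma swFun_balanced {u κ τ : ℝ} (hC : gcos u τ = κ * gsin u τ) (hκ : κ ≠ 0)
    (hS : gsin u τ ^ 2 * (κ ^ 2 + u) = 1) :
    swFun u (-1) 0 (1 / κ) τ = 0 ∧ swFunDeriv u (-1) 0 (1 / κ) τ = -(1 / κ) := by
  simp only [swFun, swFunDeriv, hC]
  constructor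
  · field_simp; ring
  · field_simp; linear_combination -hS

/-- Up to the factor `κ`, the switching function is `S(σ) (C(σ) - κ S(σ))`, and by the addition
theorem the second factor is `S(τ - σ) / S(τ)`. -/
lemma swFun_sign {u κ τ σ : ℝ} (hu : u ≠ 0) (hC : gcos u τ = κ * gsin u τ) (hκ : κ ≠ 0)
    (hS : 0 < gsin u τ) (h1 : 0 ≤ gsin u σ) (h2 : 0 ≤ gsin u (τ - σ)) :
    0 ≤ κ * swFun u (-1) 0 (1 / κ) σ := by
  rw [gsin_sub hu, hC] at h2
  have : 0 ≤ gcos u σ - κ * gsin u σ := by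
    refine nonneg_of_mul_nonneg_right (a := gsin u τ) ?_ hS
    linarith
  have e : κ * swFun u (-1) 0 (1 / κ) σ = gsin u σ * (gcos u σ - κ * gsin u σ) := by
    simp only [swFun]; field_simp; ring
  rw [e]
  exact mul_nonneg h1 this

lemma gcos_gsin_nonneg {u σ : ℝ} (hu : 0 < u) (h0 : 0 ≤ σ) (h : √u * σ ≤ Real.pi / 2) :
    0 ≤ gcos u σ ∧ 0 ≤ gsin u σ := by
  have hu' := Real.sqrt_pos.2 hu
  have := mul_nonneg hu'.le h0
  rw [gcos_of_pos hu, gsin_of_pos hu]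
  exact ⟨Real.cos_nonneg_of_neg_pi_div_two_le_of_le (by linarith) h,
    div_nonneg (Real.sin_nonneg_of_nonneg_of_le_pi this (by linarith)) hu'.le⟩

lemma gsin_nonneg {u σ : ℝ} (hu : 0 < u) (h0 : 0 ≤ σ) (h : √u * σ ≤ Real.pi) :
    0 ≤ gsin u σ := by
  have hu' := Real.sqrt_pos.2 hu
  rw [gsin_of_pos hu]
  exact div_nonneg (Real.sin_nonneg_of_nonneg_of_le_pi (mul_nonneg hu'.le h0) h) hu'.le

lemma gsin_neg_control_nonneg {u σ : ℝ} (hu : 0 < u) (h0 : 0 ≤ σ) : 0 ≤ gsin (-u) σ := by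
  have hu' := Real.sqrt_pos.2 hu
  rw [gsin_neg_control hu]
  exact div_nonneg (Real.sinh_nonneg_iff.2 (by positivity)) hu'.le

/-- The multiplier is normalized by `l₀ = -1`; then `l₀ q = φ' w` dictates the derivative `± 1 / √s`
of `φ` at each switching, and only matching and signs remain. Both values of `ε` are covered. -/
lemma exists_spiral (h : HasShape u₁ u₂ γ n ε s τ) (hε : ε ^ 2 = 1) (h₁ : 0 < u₁) (h₂ : 1 ≤ u₂)
    (hγ : 1 < γ) (hn : 1 ≤ n) :
    ∃ x u, IsTransfer u₁ u₂ γ (∑ k ∈ Finset.range (2 * n + 1), τ k) x u ∧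
      IsExtremal u₁ u₂ (∑ k ∈ Finset.range (2 * n + 1), τ k) x u ∧
      HasTurns u₁ u₂ (∑ k ∈ Finset.range (2 * n + 1), τ k) u n
        (fun k => ∑ i ∈ Finset.range k, τ i) := by
  have hu : 0 < u₂ := by linarith
  have hs : 0 < s := h₁.trans h.lt
  have hs' := Real.sqrt_pos.2 hs
  have hpos := h.pos hε h₁ h₂ hγ hn
  obtain ⟨t, ht⟩ : ∃ t : ℕ → ℝ, t = fun k => ∑ i ∈ Finset.range k, τ i := ⟨_, rfl⟩
  have hdt : ∀ k, t (k + 1) - t k = τ k := fun k => by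
    simp only [ht, Finset.sum_range_succ]; ring
  have hlt : ∀ k ≤ 2 * n, t k < t (k + 1) := fun k hk => by linarith [hdt k, hpos k hk]
  have ht0 : t 0 = 0 := by simp [ht]
  have hv0 : ∀ k ≤ 2 * n, turnControl u₁ u₂ k ≠ 0 := fun k _ => turnControl_ne_zero h₁ hu k
  obtain ⟨x, u, hx, hxz, hux⟩ := exists_transfer (u₁ := u₁) (u₂ := u₂) (N := 2 * n) (t := t)
    (v := turnControl u₁ u₂) (z := chainState u₁ u₂ τ) (γ := γ) (by linarith) ht0
    (fun k hk => (hlt k hk).le) (fun k _ => turnControl_mem h₁ hu k) hv0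
    (fun k _ => by rw [hdt]; rfl) rfl (h.chain_last hε h₁ h₂ hγ hn)
  have hT : t (2 * n + 1) = ∑ k ∈ Finset.range (2 * n + 1), τ k := by rw [ht]
  have hb : IsBangBang (t (2 * n + 1)) u (2 * n) t (turnControl u₁ u₂) :=
    ⟨ht0, rfl, hlt, fun k hk => Filter.Eventually.of_forall (hux k hk)⟩
  rw [← hT, ← ht]
  refine ⟨x, u, hx, ?_, hb⟩
  have hst := chainState_isState (u₂ := u₂) h₁ hu τ
  have hslope : ∀ k, 1 ≤ k → k ≤ 2 * n → (if Even k then -1 else 1) *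
      (chainState u₁ u₂ τ k).2.1 = -(√s * (chainState u₁ u₂ τ k).1) := by
    intro k hk1 hk
    rcases Nat.even_or_odd' k with ⟨j, rfl | rfl⟩
    · rw [if_pos (even_two_mul j), h.chain_even hε h₁ h₂ (by omega) (by omega)]; ring
    · rw [if_neg (by simp), (h.chain_odd hε h₁ h₂ j (by omega)).1]; ring
  -- Each segment is described from its initial switching, except the first, where `φ` vanishes only
  -- at the end: that segment is described backwards from `t 1`.
  let a : ℕ → ℝ := fun k => if k = 0 then t 1 else t k
  let ρ : ℕ → ℝ := fun k => if k = 0 then 1 / √s else 1 / ((if Even k then -1 else 1) * √s)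
  let z : ℕ → ℝ × ℝ × ℝ := fun k => if k = 0 then chainState u₁ u₂ τ 1 else chainState u₁ u₂ τ k
  have ha : ∀ k, k ≠ 0 → a k = t k := fun k hk => if_neg hk
  have hρ : ∀ k, k ≠ 0 → ρ k = 1 / ((if Even k then -1 else 1) * √s) := fun k hk => if_neg hk
  have hz : ∀ k, k ≠ 0 → z k = chainState u₁ u₂ τ k := fun k hk => if_neg hk
  -- inner segments are balanced
  have hbal : ∀ k, 1 ≤ k → k < 2 * n → gcos (turnControl u₁ u₂ k) (τ k) =
      ((if Even k then -1 else 1) * √s) * gsin (turnControl u₁ u₂ k) (τ k) ∧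
      gsin (turnControl u₁ u₂ k) (τ k) ^ 2 * (((if Even k then -1 else 1) * √s) ^ 2 +
        turnControl u₁ u₂ k) = 1 ∧ 0 < gsin (turnControl u₁ u₂ k) (τ k) := by
    intro k hk1 hk
    rcases Nat.even_or_odd' k with ⟨j, rfl | rfl⟩
    · obtain ⟨y1, y2, -, y3, y4⟩ := timeY_spec hu hs
      rw [if_pos (even_two_mul j), turnControl_even, h.even j (by omega) (by omega), mul_pow,
        Real.sq_sqrt hs.le]
      exact ⟨by rw [y3]; ring, by linarith, gsin_pos hu y1 y2⟩
    · obtain ⟨y1, y3, y4⟩ := timeX_spec h₁ h.lt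
      rw [if_neg (by simp), turnControl_odd, h.odd j (by omega), mul_pow, Real.sq_sqrt hs.le]
      exact ⟨by rw [y3]; ring, by linarith, gsin_neg_control_pos h₁ y1⟩
  have hκ0 : ∀ k : ℕ, (if Even k then (-1 : ℝ) else 1) * √s ≠ 0 := fun k => by
    split_ifs <;> simp [hs'.ne']
  have hmatch : ∀ k < 2 * n,
      swFun (turnControl u₁ u₂ k) (-1) 0 (ρ k) (t (k + 1) - a k) = 0 ∧
      swFunDeriv (turnControl u₁ u₂ k) (-1) 0 (ρ k) (t (k + 1) - a k) = ρ (k + 1) := by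
    intro k hk
    by_cases hk0 : k = 0
    · subst hk0
      simp [a, ρ, swFun, swFunDeriv]
    · obtain ⟨b1, b2, -⟩ := hbal k (by omega) hk
      rw [ha k hk0, hρ k hk0, hdt, hρ (k + 1) (by omega)]
      obtain ⟨c1, c2⟩ := swFun_balanced b1 (hκ0 k) b2
      refine ⟨c1, ?_⟩
      rw [c2]
      by_cases hev : Even k
      · rw [if_pos hev, if_neg (Nat.not_even_iff_odd.2 hev.add_one)]; field_simp
      · rw [if_neg hev, if_pos (Nat.not_even_iff_odd.1 hev).add_one]; field_simp
  have hstart : ∀ k, swFun (turnControl u₁ u₂ (k + 1)) (-1) 0 (ρ (k + 1))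
      (t (k + 1) - a (k + 1)) = 0 ∧ swFunDeriv (turnControl u₁ u₂ (k + 1)) (-1) 0 (ρ (k + 1))
      (t (k + 1) - a (k + 1)) = ρ (k + 1) := by
    intro k
    rw [ha (k + 1) (by omega)]
    simp [swFun, swFunDeriv]
  -- The outer `Y`-arcs stay within a quarter turn of the switching, where `C` and `S` are
  -- nonnegative and both terms of `φ` are nonpositive.
  have hYle : ∀ σ, 0 ≤ σ → √u₂ * σ ≤ Real.pi / 2 →
      swFun u₂ (-1) 0 (-(1 / √s)) σ ≤ 0 := by
    intro σ h0 hσ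
    obtain ⟨c1, c2⟩ := gcos_gsin_nonneg hu h0 hσ
    simp only [swFun]
    have := mul_nonneg (one_div_nonneg.2 hs'.le) (mul_nonneg c2 c1)
    nlinarith [sq_nonneg (gsin u₂ σ)]
  have hu2' := Real.sqrt_pos.2 hu
  refine hb.isExtremal hv0 (l₀ := -1) (by norm_num) (a := a) (ρ := ρ) (z := z) ?_ ?_ ?_ ?_ ?_ ?_
  · intro k _
    by_cases hk0 : k = 0
    · subst hk0; exact hst 1
    · rw [hz k hk0]; exact hst k
  · intro k hk r hr
    by_cases hk0 : k = 0
    · subst hk0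
      have e1 := hb.lift_eq_flow hx.trajectory hk (hv0 0 hk) hr.1 hr.2 le_rfl
      have e2 : lift (x (t (0 + 1))) = z 0 := by
        rw [hxz 0 hk _ ⟨(hlt 0 hk).le, le_rfl⟩, lift_proj (flow_isState (hv0 0 hk) _ (hst 0)), hdt]
        rfl
      change x r = proj (flow _ (r - t (0 + 1)) (z 0))
      rw [← e2, e1, ← neg_sub, flow_neg_flow (hv0 0 hk), proj_lift]
      exact hx.trajectory.pos r (hb.Icc_subset hk hr)
    · rw [hz k hk0, ha k hk0]; exact hxz k hk r hr
  · intro k hk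
    rw [(hmatch k hk).1, (hstart k).1]
  · intro k hk
    rw [(hmatch k hk).2, (hstart k).2]
  · intro k hk r hr c hc
    by_cases hk0 : k = 0
    · subst hk0
      have e : swFun u₂ (-1) 0 (1 / √s) (r - t 1) = swFun u₂ (-1) 0 (-(1 / √s)) (t 1 - r) := by
        rw [← neg_sub (t 1) r]
        simp only [swFun, gcos_neg, gsin_neg]; ring
      change swFun (turnControl u₁ u₂ (2 * 0)) (-1) 0 (1 / √s) (r - t 1) * _ ≤ 0
      rw [turnControl_even, e]
      refine mul_nonpos_of_nonpos_of_nonneg (hYle _ (by linarith [hr.2]) ?_) ?_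
      · have h1 : t 1 - r ≤ τ 0 := by linarith [hdt 0, hr.1]
        exact (mul_le_mul_of_nonneg_left h1 hu2'.le).trans (h.first ▸ sqrt_mul_arcTime_le hu)
      · linarith [hc.2]
    · have hr1 : 0 ≤ r - t k := by linarith [hr.1]
      have hr2 : r - t k ≤ τ k := by linarith [hdt k, hr.2]
      rw [ha k hk0, hρ k hk0]
      by_cases hkn : k = 2 * n
      · subst hkn
        rw [turnControl_even, if_pos (even_two_mul n)]
        refine mul_nonpos_of_nonpos_of_nonneg ?_ (by linarith [hc.2])
        rw [show 1 / (-1 * √s) = -(1 / √s) by field_simp]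
        refine hYle _ hr1 ((mul_le_mul_of_nonneg_left hr2 hu2'.le).trans ?_)
        rw [h.last, timeFinal_eq]
        exact sqrt_mul_arcTime_le hu
      · obtain ⟨b1, b2, b3⟩ := hbal k (by omega) (by omega)
        have hsgn : 0 ≤ gsin (turnControl u₁ u₂ k) (r - t k) ∧
            0 ≤ gsin (turnControl u₁ u₂ k) (τ k - (r - t k)) := by
          rcases Nat.even_or_odd' k with ⟨j, rfl | rfl⟩
          · have hpi := (timeY_spec hu hs).2.1
            rw [← h.even j (by omega) (by omega)] at hpi
            rw [turnControl_even]
            exact ⟨gsin_nonneg hu hr1 ((mul_le_mul_of_nonneg_left hr2 hu2'.le).trans hpi.le),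
              gsin_nonneg hu (by linarith) ((mul_le_mul_of_nonneg_left (by linarith)
                hu2'.le).trans hpi.le)⟩
          · rw [turnControl_odd]
            exact ⟨gsin_neg_control_nonneg h₁ hr1, gsin_neg_control_nonneg h₁ (by linarith)⟩
        have key := swFun_sign (hv0 k hk) b1 (hκ0 k) b3 hsgn.1 hsgn.2
        by_cases hev : Even k
        · have hc' : turnControl u₁ u₂ k = u₂ := if_pos hev
          rw [if_pos hev] at key ⊢
          refine mul_nonpos_of_nonpos_of_nonneg ?_ (by rw [hc']; linarith [hc.2])
          nlinarith
        · have hc' : turnControl u₁ u₂ k = -u₁ := if_neg hev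
          rw [if_neg hev] at key ⊢
          refine mul_nonpos_of_nonneg_of_nonpos ?_ (by rw [hc']; linarith [hc.1])
          nlinarith
  · intro k hk
    by_cases hk0 : k = 0
    · subst hk0
      change -1 * (chainState u₁ u₂ τ 1).1 = 1 / √s * (chainState u₁ u₂ τ 1).2.1
      rw [(h.chain_first hε h₁ h₂).2]; field_simp
    · rw [hz k hk0, hρ k hk0]
      have := hslope k (by omega) hk
      have h1 := hκ0 k
      have e : ((if Even k then (-1 : ℝ) else 1)) * (if Even k then (-1 : ℝ) else 1) = 1 := by
        split_ifs <;> norm_num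
      generalize (if Even k then (-1 : ℝ) else 1) = δ at *
      have hδ : δ ≠ 0 := left_ne_zero_of_mul h1
      have : (chainState u₁ u₂ τ k).2.1 = -(δ * √s * (chainState u₁ u₂ τ k).1) := by
        refine mul_left_cancel₀ hδ ?_
        linear_combination this + √s * (chainState u₁ u₂ τ k).1 * e
      rw [this]; field_simp

end

section

/-! ### One switching -/

/-- The duration of the `X`-segment of the one-switching extremal. -/
noncomputable def oneX (u₁ u₂ γ : ℝ) : ℝ := 1 / √u₁ * Real.arsinh
  (√(u₁ * (γ ^ 2 - 1) * (u₂ * γ ^ 2 - 1) / (γ ^ 2 * (u₁ + u₂) * (u₁ + 1))))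

/-- The duration of the `Y`-segment of the one-switching extremal. -/
noncomputable def oneY (u₁ u₂ γ : ℝ) : ℝ := 1 / √u₂ * Real.arcsin
  (√(u₂ * (γ ^ 2 - 1) * (u₁ * γ ^ 2 + 1) / ((u₁ + u₂) * (u₂ * γ ^ 4 - 1))))

lemma timeZero_eq (u₁ u₂ γ : ℝ) : timeZero u₁ u₂ γ = oneX u₁ u₂ γ + oneY u₁ u₂ γ := rfl

/-- The value of `x₁²` at the switching. -/
noncomputable def oneQ (u₁ u₂ γ : ℝ) : ℝ := (cLast u₂ γ + u₁ - 1) / (u₁ + u₂)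

variable {u₁ u₂ γ T : ℝ} {x : ℝ → ℝ × ℝ} {u : ℝ → ℝ} {t : ℕ → ℝ}

/-- Identifies the radicand in `oneX` as the `sinh²` that carries `q` from `1` to the switching;
`oneQ_eq'` does the same for the `sin²` counted back from `γ²`. -/
lemma oneQ_eq (h₁ : 0 < u₁) (h₂ : 1 ≤ u₂) (hγ : 1 < γ) : oneQ u₁ u₂ γ =
    1 + (u₁ + 1) * ((u₁ * (γ ^ 2 - 1) * (u₂ * γ ^ 2 - 1) / (γ ^ 2 * (u₁ + u₂) * (u₁ + 1))) / u₁) := by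
  have : 0 < γ := by linarith
  have : 0 < u₁ + u₂ := by linarith
  rw [oneQ, cLast]
  field_simp
  ring

lemma oneQ_eq' (h₁ : 0 < u₁) (h₂ : 1 ≤ u₂) (hγ : 1 < γ) : oneQ u₁ u₂ γ = γ ^ 2 -
    (u₂ * γ ^ 2 - 1 / γ ^ 2) / u₂ *
      (u₂ * (γ ^ 2 - 1) * (u₁ * γ ^ 2 + 1) / ((u₁ + u₂) * (u₂ * γ ^ 4 - 1))) := by
  have : 0 < γ := by linarith
  have : 0 < u₁ + u₂ := by linarith
  have h4 : 1 < γ ^ 4 := one_lt_pow₀ hγ (by norm_num)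
  have : 0 < u₂ * γ ^ 4 - 1 := by nlinarith
  rw [oneQ, cLast]
  field_simp
  ring

lemma one_lt_oneQ (h₁ : 0 < u₁) (h₂ : 1 ≤ u₂) (hγ : 1 < γ) : 1 < oneQ u₁ u₂ γ := by
  have := cFirst_lt_cLast h₂ hγ
  rw [oneQ, lt_div_iff₀ (by linarith)]
  rw [cFirst] at this
  linarith

lemma oneA_pos (h₁ : 0 < u₁) (h₂ : 1 ≤ u₂) (hγ : 1 < γ) :
    0 < u₁ * (γ ^ 2 - 1) * (u₂ * γ ^ 2 - 1) / (γ ^ 2 * (u₁ + u₂) * (u₁ + 1)) := by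
  have h2 : 1 < γ ^ 2 := one_lt_pow₀ hγ (by norm_num)
  have : 0 < u₂ * γ ^ 2 - 1 := by nlinarith
  have : 0 < γ ^ 2 - 1 := by linarith
  have : 0 < u₁ + u₂ := by linarith
  positivity

lemma oneB_pos (h₁ : 0 < u₁) (h₂ : 1 ≤ u₂) (hγ : 1 < γ) :
    0 < u₂ * (γ ^ 2 - 1) * (u₁ * γ ^ 2 + 1) / ((u₁ + u₂) * (u₂ * γ ^ 4 - 1)) := by
  have h2 : 1 < γ ^ 2 := one_lt_pow₀ hγ (by norm_num)
  have h4 : 1 < γ ^ 4 := one_lt_pow₀ hγ (by norm_num)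
  have : 0 < u₂ * γ ^ 4 - 1 := by nlinarith
  have : 0 < γ ^ 2 - 1 := by linarith
  have : 0 < u₁ + u₂ := by linarith
  positivity

lemma apse_energy_pos (h₂ : 1 ≤ u₂) (hγ : 1 < γ) : 0 < u₂ * γ ^ 2 - 1 / γ ^ 2 := by
  have h2 : 1 < γ ^ 2 := one_lt_pow₀ hγ (by norm_num)
  have : 1 / γ ^ 2 < 1 := by rw [div_lt_one (by linarith)]; exact h2
  nlinarith

/-- A larger value would push `q` at the switching below `1 / (u₂ γ²) ≤ 1`, the other apse of the
final orbit, whereas that `q` exceeds `1`. -/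
lemma oneB_le_one (h₁ : 0 < u₁) (h₂ : 1 ≤ u₂) (hγ : 1 < γ) :
    u₂ * (γ ^ 2 - 1) * (u₁ * γ ^ 2 + 1) / ((u₁ + u₂) * (u₂ * γ ^ 4 - 1)) ≤ 1 := by
  have h1 := one_lt_oneQ h₁ h₂ hγ
  rw [oneQ_eq' h₁ h₂ hγ] at h1
  have hD := apse_energy_pos h₂ hγ
  have hu : 0 < u₂ := by linarith
  have h2 : 1 < γ ^ 2 := one_lt_pow₀ hγ (by norm_num)
  generalize u₂ * (γ ^ 2 - 1) * (u₁ * γ ^ 2 + 1) / ((u₁ + u₂) * (u₂ * γ ^ 4 - 1)) = B at *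
  by_contra! hc
  have e : (u₂ * γ ^ 2 - 1 / γ ^ 2) / u₂ = γ ^ 2 - 1 / γ ^ 2 / u₂ := by field_simp
  have h3 : 0 < (u₂ * γ ^ 2 - 1 / γ ^ 2) / u₂ := div_pos hD hu
  have h5 : 1 / γ ^ 2 / u₂ ≤ 1 := by
    rw [div_le_one hu, div_le_iff₀ (by linarith)]; nlinarith
  nlinarith

/-- The first segment of a one-switching transfer. -/
lemma flow_X_start (h₁ : 0 < u₁) (a : ℝ) :
    (flow (-u₁) a (1, 0, 1)).1 = 1 + (u₁ + 1) * gsin (-u₁) a ^ 2 ∧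
    (flow (-u₁) a (1, 0, 1)).2.1 = (u₁ + 1) * (gcos (-u₁) a * gsin (-u₁) a) := by
  have hk := gcos_sq_add (u := -u₁) (by linarith) a
  simp only [flow]
  constructor
  · linear_combination hk
  · ring

lemma flow_Y_apse (hu : 0 < u₂) (b : ℝ) :
    (flow u₂ b (γ ^ 2, 0, 1 / γ ^ 2)).1 = γ ^ 2 - (u₂ * γ ^ 2 - 1 / γ ^ 2) * gsin u₂ b ^ 2 ∧
    (flow u₂ b (γ ^ 2, 0, 1 / γ ^ 2)).2.1 =
      -((u₂ * γ ^ 2 - 1 / γ ^ 2) * (gcos u₂ b * gsin u₂ b)) := by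
  have hk := gcos_sq_add hu.ne' b
  simp only [flow]
  constructor
  · linear_combination γ ^ 2 * hk
  · ring

lemma sinh_oneX (h₁ : 0 < u₁) : √u₁ * oneX u₁ u₂ γ = Real.arsinh
    (√(u₁ * (γ ^ 2 - 1) * (u₂ * γ ^ 2 - 1) / (γ ^ 2 * (u₁ + u₂) * (u₁ + 1)))) := by
  have := Real.sqrt_pos.2 h₁
  rw [oneX]; field_simp

lemma sin_oneY (h₂ : 0 < u₂) : √u₂ * oneY u₁ u₂ γ = Real.arcsin
    (√(u₂ * (γ ^ 2 - 1) * (u₁ * γ ^ 2 + 1) / ((u₁ + u₂) * (u₂ * γ ^ 4 - 1)))) := by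
  have := Real.sqrt_pos.2 h₂
  rw [oneY]; field_simp

lemma oneX_pos (h₁ : 0 < u₁) (h₂ : 1 ≤ u₂) (hγ : 1 < γ) : 0 < oneX u₁ u₂ γ :=
  mul_pos (one_div_pos.2 (Real.sqrt_pos.2 h₁))
    (Real.arsinh_pos_iff.2 (Real.sqrt_pos.2 (oneA_pos h₁ h₂ hγ)))

lemma oneY_pos (h₁ : 0 < u₁) (h₂ : 1 ≤ u₂) (hγ : 1 < γ) : 0 < oneY u₁ u₂ γ :=
  mul_pos (one_div_pos.2 (Real.sqrt_pos.2 (by linarith)))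
    (Real.arcsin_pos.2 (Real.sqrt_pos.2 (oneB_pos h₁ h₂ hγ)))

lemma oneY_le (h₂ : 0 < u₂) : √u₂ * oneY u₁ u₂ γ ≤ Real.pi / 2 := by
  rw [sin_oneY h₂]; exact Real.arcsin_le_pi_div_two _

lemma flow_oneX (h₁ : 0 < u₁) (h₂ : 1 ≤ u₂) (hγ : 1 < γ) :
    (flow (-u₁) (oneX u₁ u₂ γ) (1, 0, 1)).1 = oneQ u₁ u₂ γ := by
  rw [(flow_X_start h₁ _).1, oneQ_eq h₁ h₂ hγ, gsin_neg_control h₁, sinh_oneX h₁,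
    Real.sinh_arsinh, div_pow, Real.sq_sqrt h₁.le, Real.sq_sqrt (oneA_pos h₁ h₂ hγ).le]

lemma flow_oneY (h₁ : 0 < u₁) (h₂ : 1 ≤ u₂) (hγ : 1 < γ) :
    (flow u₂ (oneY u₁ u₂ γ) (γ ^ 2, 0, 1 / γ ^ 2)).1 = oneQ u₁ u₂ γ := by
  have hu : 0 < u₂ := by linarith
  have hB := oneB_pos h₁ h₂ hγ
  have hB1 := oneB_le_one h₁ h₂ hγ
  rw [(flow_Y_apse hu _).1, oneQ_eq' h₁ h₂ hγ, gsin_of_pos hu, sin_oneY hu, Real.sin_arcsin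
    (by linarith [Real.sqrt_nonneg (u₂ * (γ ^ 2 - 1) * (u₁ * γ ^ 2 + 1) /
      ((u₁ + u₂) * (u₂ * γ ^ 4 - 1)))]) (Real.sqrt_le_one.2 hB1), div_pow, Real.sq_sqrt hu.le,
    Real.sq_sqrt hB.le]
  ring

lemma flow_X_snd_pos (h₁ : 0 < u₁) {a : ℝ} (ha : 0 < a) :
    0 < (flow (-u₁) a (1, 0, 1)).2.1 := by
  rw [(flow_X_start h₁ a).2]
  have := gsin_neg_control_pos h₁ ha
  have := gcos_neg_control_pos h₁ a
  positivity

/-- The state at the switching of the one-switching extremal. -/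
lemma flow_oneX_eq (h₁ : 0 < u₁) (h₂ : 1 ≤ u₂) (hγ : 1 < γ) :
    flow (-u₁) (oneX u₁ u₂ γ) (1, 0, 1) =
      reverse (flow u₂ (oneY u₁ u₂ γ) (γ ^ 2, 0, 1 / γ ^ 2)) := by
  have hu : 0 < u₂ := by linarith
  have h2 : 1 < γ ^ 2 := one_lt_pow₀ hγ (by norm_num)
  have s0 : IsState ((1 : ℝ), (0 : ℝ), (1 : ℝ)) := by norm_num [IsState]
  have s1 := flow_isState (u := -u₁) (by linarith) (oneX u₁ u₂ γ) s0
  have s2 := flow_isState hu.ne' (oneY u₁ u₂ γ) (isState_apse (g := γ ^ 2) (by linarith))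
  have q1 := flow_oneX h₁ h₂ hγ
  have q2 := flow_oneY h₁ h₂ hγ
  have e1 := flow_energy (u := -u₁) (by linarith) (oneX u₁ u₂ γ) (1, 0, 1)
  have e2 := flow_energy hu.ne' (oneY u₁ u₂ γ) (γ ^ 2, 0, 1 / γ ^ 2)
  refine state_ext s1 (reverse_isState s2) (by simp only [reverse]; rw [q1, q2]) ?_
  have w1 := flow_X_snd_pos h₁ (oneX_pos h₁ h₂ hγ)
  have w2 : 0 ≤ -(flow u₂ (oneY u₁ u₂ γ) (γ ^ 2, 0, 1 / γ ^ 2)).2.1 := by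
    rw [(flow_Y_apse hu _).2, neg_neg]
    obtain ⟨c1, c2⟩ := gcos_gsin_nonneg hu (oneY_pos h₁ h₂ hγ).le (oneY_le (u₁ := u₁) (γ := γ) hu)
    exact mul_nonneg (apse_energy_pos h₂ hγ).le (mul_nonneg c1 c2)
  -- The two states share `q` and `e`, hence `w²` by the determinant; both signs of `w` are known.
  refine (pow_left_inj₀ w1.le w2 two_ne_zero).1 ?_
  have d1 := s1.2
  have d2 := s2.2
  simp only at e1 e2
  rw [q1] at d1 e1
  rw [q2] at d2 e2
  have hQ : (u₁ + u₂) * oneQ u₁ u₂ γ = cLast u₂ γ + u₁ - 1 := by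
    rw [oneQ]; field_simp
  rw [cLast] at hQ
  have : (flow (-u₁) (oneX u₁ u₂ γ) (1, 0, 1)).2.2 =
      (flow u₂ (oneY u₁ u₂ γ) (γ ^ 2, 0, 1 / γ ^ 2)).2.2 := by linarith
  rw [neg_sq]
  rw [this] at d1
  linarith

/-- The slope at the switching is less than `√u₁`. -/
lemma one_slope (h₁ : 1 ≤ u₁) (a : ℝ) : (flow (-u₁) a (1, 0, 1)).2.1 ^ 2 <
    u₁ * (flow (-u₁) a (1, 0, 1)).1 ^ 2 := by
  have s0 : IsState ((1 : ℝ), (0 : ℝ), (1 : ℝ)) := by norm_num [IsState]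
  have s1 := flow_isState (u := -u₁) (by linarith) a s0
  have e1 := flow_energy (u := -u₁) (by linarith) a (1, 0, 1)
  simp only at e1
  have hq := s1.1
  have hd := s1.2
  have : (flow (-u₁) a (1, 0, 1)).2.2 = u₁ * (flow (-u₁) a (1, 0, 1)).1 + 1 - u₁ := by linarith
  rw [this] at hd
  nlinarith [mul_nonneg hq.le (sub_nonneg.2 h₁)]

/-- Uniqueness of the durations of a one-switching transfer, up to periods of the `Y`-motion. -/
lemma one_durations (h₁ : 0 < u₁) (h₂ : 1 ≤ u₂) (hγ : 1 < γ) {a b : ℝ} (ha : 0 < a) (hb : 0 < b)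
    (h : flow u₂ b (flow (-u₁) a (1, 0, 1)) = (γ ^ 2, 0, 1 / γ ^ 2)) :
    a = oneX u₁ u₂ γ ∧ oneY u₁ u₂ γ ≤ b ∧ (√u₂ * b < Real.pi → b = oneY u₁ u₂ γ) := by
  have hu : 0 < u₂ := by linarith
  have hu1' := Real.sqrt_pos.2 h₁
  have hu2' := Real.sqrt_pos.2 hu
  have h2 : 1 < γ ^ 2 := one_lt_pow₀ hγ (by norm_num)
  have hrev : flow u₂ b (γ ^ 2, 0, 1 / γ ^ 2) = reverse (flow (-u₁) a (1, 0, 1)) := by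
    have : ((γ ^ 2, 0, 1 / γ ^ 2) : ℝ × ℝ × ℝ) = reverse (γ ^ 2, 0, 1 / γ ^ 2) := by
      simp [reverse]
    rw [this, flow_reverse, ← h, flow_neg_flow hu.ne']
  have e1 := flow_energy (u := -u₁) (by linarith) a (1, 0, 1)
  have e2 := flow_energy hu.ne' b (flow (-u₁) a (1, 0, 1))
  rw [h] at e2
  simp only at e1 e2
  -- At the switching `e - u₁ q = 1 - u₁` from the start and `e + u₂ q = c_{n+1}` from the target;
  -- subtraction determines `q`.
  have hq : (flow (-u₁) a (1, 0, 1)).1 = oneQ u₁ u₂ γ := by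
    rw [oneQ, eq_div_iff (by linarith), cLast]; linarith
  obtain ⟨x1, x2⟩ := flow_X_start h₁ a
  obtain ⟨y1, y2⟩ := flow_Y_apse (γ := γ) hu b
  have hw := flow_X_snd_pos h₁ ha
  have hD := apse_energy_pos h₂ hγ
  have hqy : (flow u₂ b (γ ^ 2, 0, 1 / γ ^ 2)).1 = oneQ u₁ u₂ γ := by rw [hrev, ← hq]; rfl
  have hwy : (flow u₂ b (γ ^ 2, 0, 1 / γ ^ 2)).2.1 < 0 := by
    rw [hrev]; simp only [reverse]; linarith
  refine ⟨?_, ?_⟩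
  · rw [hq, oneQ_eq h₁ h₂ hγ] at x1
    have hS : gsin (-u₁) a ^ 2 * u₁ = u₁ * (γ ^ 2 - 1) * (u₂ * γ ^ 2 - 1) /
        (γ ^ 2 * (u₁ + u₂) * (u₁ + 1)) := by
      generalize u₁ * (γ ^ 2 - 1) * (u₂ * γ ^ 2 - 1) / (γ ^ 2 * (u₁ + u₂) * (u₁ + 1)) = A at *
      have : (u₁ + 1) * (gsin (-u₁) a ^ 2 - A / u₁) = 0 := by linarith
      have := (mul_eq_zero.1 this).resolve_left (by linarith)
      have e : gsin (-u₁) a ^ 2 = A / u₁ := by linarith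
      rw [e]; field_simp
    have hsinh : Real.sinh (√u₁ * a) = √(u₁ * (γ ^ 2 - 1) * (u₂ * γ ^ 2 - 1) /
        (γ ^ 2 * (u₁ + u₂) * (u₁ + 1))) := by
      rw [← hS, gsin_neg_control h₁, div_pow, Real.sq_sqrt h₁.le, div_mul_cancel₀ _ h₁.ne',
        Real.sqrt_sq (Real.sinh_nonneg_iff.2 (by positivity))]
    rw [oneX, ← hsinh, Real.arsinh_sinh]
    field_simp
  have hS : Real.sin (√u₂ * b) ^ 2 = u₂ * (γ ^ 2 - 1) * (u₁ * γ ^ 2 + 1) /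
      ((u₁ + u₂) * (u₂ * γ ^ 4 - 1)) := by
    rw [hqy, oneQ_eq' h₁ h₂ hγ, gsin_of_pos hu, div_pow, Real.sq_sqrt hu.le] at y1
    generalize u₂ * (γ ^ 2 - 1) * (u₁ * γ ^ 2 + 1) / ((u₁ + u₂) * (u₂ * γ ^ 4 - 1)) = B at *
    have : (u₂ * γ ^ 2 - 1 / γ ^ 2) / u₂ * (Real.sin (√u₂ * b) ^ 2 - B) = 0 := by
      linear_combination y1
    have := (mul_eq_zero.1 this).resolve_left (div_pos hD hu).ne'
    linarith
  have hbu : 0 < √u₂ * b := by positivity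
  have key : √u₂ * b ≤ Real.pi / 2 → b = oneY u₁ u₂ γ := by
    intro hle
    rw [oneY, ← hS, Real.sqrt_sq (Real.sin_nonneg_of_nonneg_of_le_pi hbu.le (by linarith)),
      Real.arcsin_sin (by linarith) hle]
    field_simp
  constructor
  · rcases le_total (√u₂ * b) (Real.pi / 2) with hle | hle
    · exact (key hle).ge
    · refine le_of_mul_le_mul_left ?_ hu2'
      exact (oneY_le hu).trans hle
  · intro hlt
    -- Before one full period, the sign of `w` at the switching rules out the second quarter turn.
    refine key ?_
    by_contra! hc
    have hcos : gcos u₂ b ≤ 0 := by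
      rw [gcos_of_pos hu]
      exact Real.cos_nonpos_of_pi_div_two_le_of_le hc.le (by linarith)
    have hsin := gsin_pos hu hb hlt
    rw [y2] at hwy
    have : 0 < (u₂ * γ ^ 2 - 1 / γ ^ 2) * (gcos u₂ b * gsin u₂ b) := by linarith
    have := (pos_iff_pos_of_mul_pos this).1 hD
    nlinarith

lemma IsOneSwitching.durations (hb : IsOneSwitching u₁ u₂ T u t)
    (hx : IsTransfer u₁ u₂ γ T x u) (h₁ : 0 < u₁) (h₂ : 1 ≤ u₂) (hγ : 1 < γ) :
    t 1 = oneX u₁ u₂ γ ∧ oneY u₁ u₂ γ ≤ T - t 1 ∧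
      (√u₂ * (T - t 1) < Real.pi → T = timeZero u₁ u₂ γ) := by
  have hu : 0 < u₂ := by linarith
  have e0 := hb.lift_eq_flow hx.trajectory (k := 0) (by norm_num) (by simp; linarith) le_rfl
    (hb.2.2.1 0 (by norm_num)).le le_rfl
  have e1 := hb.lift_eq_flow hx.trajectory (k := 1) le_rfl (by simp; linarith) le_rfl
    (hb.2.2.1 1 le_rfl).le le_rfl
  have p0 := hb.2.2.1 0 (by norm_num)
  have p1 := hb.2.2.1 1 le_rfl
  have hT := hb.2.1
  have ht0 := hb.1
  norm_num at e0 e1 hT p0 p1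
  rw [ht0, lift_start hx] at e0
  rw [hT, e0, lift_finish hx] at e1
  rw [ht0] at p0
  rw [hT] at p1
  rw [sub_zero] at e1
  obtain ⟨c1, c2, c3⟩ := one_durations h₁ h₂ hγ p0 (sub_pos.2 p1) e1.symm
  refine ⟨c1, c2, fun h => ?_⟩
  have := c3 h
  rw [timeZero_eq]
  linarith

lemma IsOneSwitching.timeZero_le (hb : IsOneSwitching u₁ u₂ T u t)
    (hx : IsTransfer u₁ u₂ γ T x u) (h₁ : 0 < u₁) (h₂ : 1 ≤ u₂) (hγ : 1 < γ) :
    timeZero u₁ u₂ γ ≤ T := by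
  obtain ⟨c1, c2, -⟩ := hb.durations hx h₁ h₂ hγ
  rw [timeZero_eq]; linarith

/-- Extremality enters only through the bound on the `Y`-segment, which excludes added periods. -/
lemma IsOneSwitching.eq_timeZero (hb : IsOneSwitching u₁ u₂ T u t)
    (hx : IsTransfer u₁ u₂ γ T x u) (he : IsExtremal u₁ u₂ T x u) (h₁ : 0 < u₁) (h₂ : 1 ≤ u₂)
    (hγ : 1 < γ) : T = timeZero u₁ u₂ γ := by
  have hu : 0 < u₂ := by linarith
  refine (hb.durations hx h₁ h₂ hγ).2.2 ?_
  have hv0 : ∀ k ≤ 1, (fun k : ℕ => if Even k then -u₁ else u₂) k ≠ 0 := by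
    intro k _
    simp only; split_ifs <;> linarith
  obtain ⟨l₀, φ, ψ, hφ, hsg, hsw⟩ := IsBangBang.exists_switching_function hb hx.trajectory he hv0
  have p0 := hb.2.2.1 0 (by norm_num)
  have p1 := hb.2.2.1 1 le_rfl
  have hT := hb.2.1
  norm_num at p0 p1 hT
  have s0 := hsg 0 (by norm_num) (t 1) (by norm_num; exact p0.le)
  have s1 := fun r hr => hsg 1 le_rfl r hr
  have f1 := fun r hr => hφ 1 le_rfl (t 1) (by norm_num; exact p1.le) r hr
  norm_num at s0 s1 f1
  have h0 : φ (t 1) = 0 := switching_zero h₁ hu (Or.inr ⟨rfl, rfl⟩)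
    (fun c hc => s0 c hc.1 hc.2) (fun c hc => s1 (t 1) le_rfl p1.le c hc.1 hc.2)
  have hψ := (hsw 1 le_rfl (t 1) (by norm_num; exact p1.le) h0).1
  refine lt_pi_of_sign hu hψ (l₀ := l₀) fun σ hσ => ?_
  have m1 : t 1 ≤ t 1 + σ := by linarith [hσ.1]
  have m2 : t 1 + σ ≤ t 2 := by linarith [hσ.2]
  have := f1 (t 1 + σ) m1 m2
  rw [h0, add_sub_cancel_left] at this
  rw [← this]
  exact nonpos_of_max h₁ hu fun c hc => s1 _ m1 m2 c hc.1 hc.2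

lemma exists_one_switching (h₁ : 1 ≤ u₁) (h₂ : 1 ≤ u₂) (hγ : 1 < γ) :
    ∃ x u t, IsTransfer u₁ u₂ γ (timeZero u₁ u₂ γ) x u ∧
      IsExtremal u₁ u₂ (timeZero u₁ u₂ γ) x u ∧ IsOneSwitching u₁ u₂ (timeZero u₁ u₂ γ) u t := by
  have hu₁ : 0 < u₁ := by linarith
  have hu : 0 < u₂ := by linarith
  have hγ2 : 1 < γ ^ 2 := one_lt_pow₀ hγ (by norm_num)
  have pX := oneX_pos hu₁ h₂ hγ
  have pY := oneY_pos hu₁ h₂ hγ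
  let v : ℕ → ℝ := fun k => if Even k then -u₁ else u₂
  let t : ℕ → ℝ := fun k => if k = 0 then 0 else if k = 1 then oneX u₁ u₂ γ else timeZero u₁ u₂ γ
  let z1 := flow (-u₁) (oneX u₁ u₂ γ) (1, 0, 1)
  let z : ℕ → ℝ × ℝ × ℝ := fun k =>
    if k = 0 then (1, 0, 1) else if k = 1 then z1 else (γ ^ 2, 0, 1 / γ ^ 2)
  have v0 : v 0 = -u₁ := by simp [v]
  have v1 : v 1 = u₂ := by simp [v]
  have t0 : t 0 = 0 := rfl
  have t1 : t 1 = oneX u₁ u₂ γ := by simp [t]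
  have t2 : t 2 = timeZero u₁ u₂ γ := by simp [t]
  have two : ∀ {p : ℕ → Prop}, p 0 → p 1 → ∀ k ≤ 1, p k := by
    intro p h0 h1 k hk
    interval_cases k <;> assumption
  have hlt : ∀ k ≤ 1, t k < t (k + 1) := two (by rw [t0, t1]; exact pX)
    (by rw [t1, t2, timeZero_eq]; linarith)
  have hv0 : ∀ k ≤ 1, v k ≠ 0 := two (by rw [v0]; linarith) (by rw [v1]; linarith)
  have s0 : IsState ((1 : ℝ), (0 : ℝ), (1 : ℝ)) := by norm_num [IsState]
  have s1 : IsState z1 := flow_isState (by linarith) _ s0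
  have hz1 : z1 = reverse (flow u₂ (oneY u₁ u₂ γ) (γ ^ 2, 0, 1 / γ ^ 2)) :=
    flow_oneX_eq hu₁ h₂ hγ
  have hzs : ∀ k ≤ 1, z (k + 1) = flow (v k) (t (k + 1) - t k) (z k) := by
    refine two ?_ ?_
    · rw [v0, t0, zero_add, t1, sub_zero]; simp [z, z1]
    · rw [v1, t1, one_add_one_eq_two, t2, timeZero_eq, add_sub_cancel_left]
      have e : z 1 = z1 := by simp [z]
      have e3 : ((γ ^ 2, 0, 1 / γ ^ 2) : ℝ × ℝ × ℝ) = reverse (γ ^ 2, 0, 1 / γ ^ 2) := by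
        simp [reverse]
      rw [e, hz1, flow_reverse, flow_neg_flow hu.ne', ← e3]; simp [z]
  obtain ⟨x, u, hx, hxz, hux⟩ := exists_transfer (u₁ := u₁) (u₂ := u₂) (N := 1) (t := t)
    (v := v) (z := z) (γ := γ) (by linarith) t0 (fun k hk => (hlt k hk).le)
    (two (by rw [v0]; exact ⟨le_rfl, by linarith⟩) (by rw [v1]; exact ⟨by linarith, le_rfl⟩))
    hv0 hzs (by simp [z]) (by simp [z])
  have hb : IsBangBang (t 2) u 1 t v :=
    ⟨t0, rfl, hlt, fun k hk => Filter.Eventually.of_forall (hux k hk)⟩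
  have hl1 : lift (x (t 1)) = z1 := by
    rw [hxz 1 le_rfl (t 1) ⟨le_rfl, (hlt 1 le_rfl).le⟩, sub_self, flow_zero,
      lift_proj (by simpa [z] using s1)]
    simp [z]
  refine ⟨x, u, t, t2 ▸ hx, ?_, t2 ▸ hb⟩
  rw [← t2]
  have hw : 0 < z1.2.1 := flow_X_snd_pos hu₁ pX
  have hq := s1.1
  -- Both segments are described from the single zero of `φ`, at the switching; `ρ` is forced by `l₀
  -- q = ρ w`.
  refine hb.isExtremal hv0 (l₀ := -1) (by norm_num) (a := fun _ => t 1)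
    (ρ := fun _ => -(z1.1 / z1.2.1)) (z := fun _ => z1) (fun _ _ => s1) ?_ ?_ ?_ ?_ ?_
  · refine two ?_ ?_
    · intro r hr
      have e1 := hb.lift_eq_flow hx.trajectory (k := 0) (by norm_num) (hv0 0 (by norm_num)) hr.1
        hr.2 le_rfl
      rw [zero_add, hl1] at e1
      rw [e1, ← neg_sub, flow_neg_flow (hv0 0 (by norm_num)), proj_lift]
      exact hx.trajectory.pos r (hb.Icc_subset (by norm_num) hr)
    · intro r hr
      have e : z 1 = z1 := by simp [z]
      rw [hxz 1 le_rfl r hr, e]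
  · intro k hk
    obtain rfl : k = 0 := by omega
    simp [swFun]
  · intro k hk
    obtain rfl : k = 0 := by omega
    simp [swFunDeriv]
  · refine two ?_ ?_
    · intro r hr c hc
      rw [v0]
      rw [zero_add] at hr
      refine mul_nonpos_of_nonneg_of_nonpos ?_ (by linarith [hc.1])
      have hσ : 0 ≤ t 1 - r := by linarith [hr.2]
      have hS := gsin_neg_control_nonneg hu₁ hσ
      have hC := gcos_neg_control_pos hu₁ (t 1 - r)
      have hk := gcos_sq_add (u := -u₁) (by linarith) (t 1 - r)
      have hsl := one_slope h₁ (oneX u₁ u₂ γ)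
      change z1.2.1 ^ 2 < u₁ * z1.1 ^ 2 at hsl
      rw [← neg_sub]
      simp only [swFun, gcos_neg, gsin_neg]
      -- The slope at the switching is below `√u₁` by `one_slope`, while `C² = 1 + u₁ S²`; this
      -- keeps `φ` nonnegative on the whole `X`-segment.
      have key : z1.2.1 * gsin (-u₁) (t 1 - r) ≤ z1.1 * gcos (-u₁) (t 1 - r) := by
        refine (pow_le_pow_iff_left₀ (by positivity) (by positivity) two_ne_zero).1 ?_
        rw [mul_pow, mul_pow]
        nlinarith [sq_nonneg (gsin (-u₁) (t 1 - r)), mul_le_mul_of_nonneg_right hsl.le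
          (sq_nonneg (gsin (-u₁) (t 1 - r))), sq_nonneg z1.1]
      have e : 0 * (gcos (-u₁) (t 1 - r) ^ 2 - -u₁ * (-gsin (-u₁) (t 1 - r)) ^ 2) +
          -(z1.1 / z1.2.1) * (-gsin (-u₁) (t 1 - r) * gcos (-u₁) (t 1 - r)) +
          -1 * (-gsin (-u₁) (t 1 - r)) ^ 2 = gsin (-u₁) (t 1 - r) *
          ((z1.1 * gcos (-u₁) (t 1 - r) - z1.2.1 * gsin (-u₁) (t 1 - r)) / z1.2.1) := by
        field_simp; ring
      rw [e]
      exact mul_nonneg hS (div_nonneg (by linarith) hw.le)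
    · intro r hr c hc
      rw [v1]
      rw [one_add_one_eq_two, t2, timeZero_eq] at hr
      refine mul_nonpos_of_nonpos_of_nonneg ?_ (by linarith [hc.2])
      have hσ : 0 ≤ r - t 1 := by linarith [hr.1]
      have hσ2 : r - t 1 ≤ oneY u₁ u₂ γ := by rw [t1]; linarith [hr.2]
      obtain ⟨c1, c2⟩ := gcos_gsin_nonneg hu hσ ((mul_le_mul_of_nonneg_left hσ2
        (Real.sqrt_nonneg u₂)).trans (oneY_le hu))
      simp only [swFun]
      have := mul_nonneg (div_pos hq hw).le (mul_nonneg c2 c1)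
      nlinarith [sq_nonneg (gsin u₂ (r - t 1))]
  · intro k _
    field_simp

/-- The last segment of a spiral lasts at least as long as the `Y`-segment of the one-switching
extremal. -/
lemma oneY_le_timeFinal (h₁ : 1 ≤ u₁) (h₂ : 1 ≤ u₂) (hγ : 1 < γ) {s : ℝ} (hs : u₁ < s)
    (hs' : s ≤ sPlus u₂) : oneY u₁ u₂ γ ≤ timeFinal u₂ γ s := by
  have hu₁ : 0 < u₁ := by linarith
  have hu : 0 < u₂ := by linarith
  have hs0 : 0 < s := by linarith
  have hu2' := Real.sqrt_pos.2 hu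
  have hσ : 0 < s + u₂ := by linarith
  have hγ2 : 1 < γ ^ 2 := one_lt_pow₀ hγ (by norm_num)
  have hle := le_sPlus_iff.1 hs'
  have hcc := cFirst_lt_cLast h₂ hγ
  have hc1 : 2 ≤ cFirst u₂ := by rw [cFirst]; linarith
  have hlen : 4 * (s + u₂) ≤ cLast u₂ γ ^ 2 := by nlinarith
  have hγu : 1 < u₂ * (γ ^ 2) ^ 2 := by nlinarith
  obtain ⟨a1, -⟩ := flow_arcTime (u := u₂) (g := γ ^ 2) (ε := 1) hu (by linarith) hγu hs0
    (by norm_num) (by rw [← cLast_eq]; exact hlen)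
  rw [← cLast_eq, ← timeFinal_eq, one_mul] at a1
  have q2 := flow_oneY hu₁ h₂ hγ
  have hQ1 := one_lt_oneQ hu₁ h₂ hγ
  have hRn : √(cLast u₂ γ ^ 2 - 4 * (s + u₂)) ^ 2 = cLast u₂ γ ^ 2 - 4 * (s + u₂) :=
    Real.sq_sqrt (by linarith)
  have hRn0 := Real.sqrt_nonneg (cLast u₂ γ ^ 2 - 4 * (s + u₂))
  -- the switching point lies beyond the larger root
  have hpoly : 0 < (s + u₂) * oneQ u₁ u₂ γ ^ 2 - cLast u₂ γ * oneQ u₁ u₂ γ + 1 := by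
    have hsl := one_slope h₁ (oneX u₁ u₂ γ)
    have s0 : IsState ((1 : ℝ), (0 : ℝ), (1 : ℝ)) := by norm_num [IsState]
    have hd := (flow_isState (u := -u₁) (by linarith) (oneX u₁ u₂ γ) s0).2
    have e1 := flow_energy (u := -u₁) (by linarith) (oneX u₁ u₂ γ) (1, 0, 1)
    simp only at e1
    rw [flow_oneX hu₁ h₂ hγ] at hsl hd e1
    have hQ : (u₁ + u₂) * oneQ u₁ u₂ γ = cLast u₂ γ + u₁ - 1 := by
      rw [oneQ]; field_simp
    have e2 : (flow (-u₁) (oneX u₁ u₂ γ) (1, 0, 1)).2.2 =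
        cLast u₂ γ - u₂ * oneQ u₁ u₂ γ := by linarith
    rw [e2] at hd
    nlinarith [mul_pos (sub_pos.2 hs) (pow_pos (by linarith : 0 < oneQ u₁ u₂ γ) 2)]
  have hlt : (cLast u₂ γ + √(cLast u₂ γ ^ 2 - 4 * (s + u₂))) / (2 * (s + u₂)) <
      oneQ u₁ u₂ γ := by
    rw [div_lt_iff₀ (by linarith)]
    generalize √(cLast u₂ γ ^ 2 - 4 * (s + u₂)) = R at *
    generalize oneQ u₁ u₂ γ = q at *
    by_contra! hc
    have h5 : 0 < (2 * (s + u₂) * q - cLast u₂ γ - R) * (2 * (s + u₂) * q - cLast u₂ γ + R) := by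
      have : (2 * (s + u₂) * q - cLast u₂ γ - R) * (2 * (s + u₂) * q - cLast u₂ γ + R) =
        4 * (s + u₂) * ((s + u₂) * q ^ 2 - cLast u₂ γ * q + 1) := by linear_combination -hRn
      rw [this]; positivity
    have h6 : 2 * (s + u₂) * q - cLast u₂ γ + R < 0 := by
      by_contra! h
      nlinarith
    -- A point with `q > 1` below the smaller root would give `c_{n+1} + R < 2`, against `c_{n+1} >
    -- c₁ ≥ 2`.
    have h7 : 2 * (s + u₂) < cLast u₂ γ - R := by nlinarith
    have h8 : (cLast u₂ γ - R) * (cLast u₂ γ + R) = 4 * (s + u₂) := by linear_combination -hRn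
    nlinarith
  rw [← a1, ← q2, (flow_Y_apse hu _).1, (flow_Y_apse hu _).1] at hlt
  have hD := apse_energy_pos h₂ hγ
  by_contra! hc
  have hF0 : 0 ≤ timeFinal u₂ γ s := by rw [timeFinal_eq]; exact arcTime_nonneg _ _ _ _
  have hmono : gsin u₂ (timeFinal u₂ γ s) ≤ gsin u₂ (oneY u₁ u₂ γ) := by
    rw [gsin_of_pos hu, gsin_of_pos hu]
    gcongr
    refine Real.sin_le_sin_of_le_of_le_pi_div_two ?_ (oneY_le hu) ?_
    · have := mul_nonneg hu2'.le hF0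
      linarith [Real.pi_pos]
    · exact mul_le_mul_of_nonneg_left hc.le hu2'.le
  have h0 := (gcos_gsin_nonneg hu hF0 ((mul_le_mul_of_nonneg_left hc.le hu2'.le).trans
    (oneY_le hu))).2
  nlinarith [pow_le_pow_left₀ h0 hmono 2]

end

section

/-! ### Dependence of the durations on the switching slope -/

lemma hasDerivAt_root {c a s : ℝ} (h : 4 * (s + a) < c ^ 2) :
    HasDerivAt (fun s => √(c ^ 2 - 4 * (s + a))) (-2 / √(c ^ 2 - 4 * (s + a))) s := by
  have h1 : HasDerivAt (fun s : ℝ => c ^ 2 - 4 * (s + a)) (-4) s := by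
    simpa using (((hasDerivAt_id s).add_const a).const_mul 4).const_sub (c ^ 2)
  convert h1.sqrt (by linarith) using 1
  ring

lemma hasDerivAt_arcTime {u c ε s : ℝ} (hu : 0 < u) (hc : 0 < c) (hs : 0 < s) (hε : ε ^ 2 = 1)
    (h : 4 * (s + u) < c ^ 2) :
    HasDerivAt (arcTime u c ε) ((ε * c / √(c ^ 2 - 4 * (s + u)) + 1) / (4 * (s + u) * √s)) s := by
  have hR := hasDerivAt_root h
  have hR2 : √(c ^ 2 - 4 * (s + u)) ^ 2 = c ^ 2 - 4 * (s + u) := Real.sq_sqrt (by linarith)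
  have hR0 : 0 < √(c ^ 2 - 4 * (s + u)) := Real.sqrt_pos.2 (by linarith)
  have hD2 : √(c ^ 2 - 4 * u) ^ 2 = c ^ 2 - 4 * u := Real.sq_sqrt (by linarith)
  have hD0 : 0 < √(c ^ 2 - 4 * u) := Real.sqrt_pos.2 (by linarith)
  have hσ : 0 < s + u := by linarith
  have hs' := Real.sqrt_pos.2 hs
  have hu' := Real.sqrt_pos.2 hu
  have ss := Real.sq_sqrt hs.le
  have su := Real.sq_sqrt hu.le
  have hid := arc_identity hD2 hR2 hε
  have hpos : 0 < c + ε * √(c ^ 2 - 4 * (s + u)) :=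
    add_mul_pos_of_sq hc (by rw [hR2]; linarith) hε
  unfold arcTime
  set R := √(c ^ 2 - 4 * (s + u)) with hRdef
  set D := √(c ^ 2 - 4 * u) with hDdef
  set g := (-(s * c) + ε * (u * R)) / ((s + u) * D) with hg
  have hcomp : 1 - g ^ 2 = (√s * √u * (c + ε * R) / ((s + u) * D)) ^ 2 := by
    rw [hg, div_pow, div_pow, mul_pow (√s * √u), mul_pow √s, ss, su, ← hid]; field_simp
  have hp : 0 < √s * √u * (c + ε * R) / ((s + u) * D) := by positivity
  have hsq : √(1 - g ^ 2) = √s * √u * (c + ε * R) / ((s + u) * D) := by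
    rw [hcomp, Real.sqrt_sq hp.le]
  have hlt : g ^ 2 < 1 := by nlinarith [pow_pos hp 2]
  have hne1 : g ≠ -1 := fun e => by rw [e] at hlt; norm_num at hlt
  have hne2 : g ≠ 1 := fun e => by rw [e] at hlt; norm_num at hlt
  have hnum : HasDerivAt (fun s => (-(s * c) + ε * (u * √(c ^ 2 - 4 * (s + u)))) /
      ((s + u) * D)) (((-c + ε * (u * (-2 / R))) * ((s + u) * D) -
        (-(s * c) + ε * (u * R)) * (1 * D)) / ((s + u) * D) ^ 2) s := by
    refine HasDerivAt.div (((hasDerivAt_mul_const c).neg).add ((hR.const_mul u).const_mul ε))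
      (((hasDerivAt_id s).add_const u).mul_const D) (by positivity)
  have hfin := (((Real.hasDerivAt_arccos hne1 hne2).comp s hnum).const_mul (1 / (2 * √u)))
  refine hfin.congr_deriv ?_
  rw [hsq]
  have h4 : 4 * (s + u) = c ^ 2 - R ^ 2 := by linarith
  have key : (-c + ε * (u * (-2 / R))) * ((s + u) * D) - (-(s * c) + ε * (u * R)) * (1 * D) =
      -(u * D * ε * (c + ε * R) ^ 2 / (2 * R)) := by
    field_simp
    linear_combination (-(u * ε) : ℝ) * h4 + (2 * u * c * R + u * ε * R ^ 2) * hε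
  rw [key]
  have e1 : ε * c / R + 1 = ε * (c + ε * R) / R := by
    field_simp; linear_combination -R * hε
  rw [e1]
  field_simp
  rw [su]; ring

lemma hasDerivAt_timeX {u s : ℝ} (hu : 0 < u) (hs : u < s) :
    HasDerivAt (timeX u) (-1 / (2 * √s * (s - u))) s := by
  have hsu : 0 < s - u := by linarith
  have hs0 : 0 < s := by linarith
  have hs' := Real.sqrt_pos.2 hs0
  have hu' := Real.sqrt_pos.2 hu
  have ss := Real.sq_sqrt hs0.le
  have su := Real.sq_sqrt hu.le
  have h1 : 1 < (s + u) / (s - u) := by rw [lt_div_iff₀ hsu]; linarith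
  have hsq : √(((s + u) / (s - u)) ^ 2 - 1) = 2 * (√s * √u) / (s - u) := by
    rw [show ((s + u) / (s - u)) ^ 2 - 1 = (2 * (√s * √u) / (s - u)) ^ 2 by
      rw [div_pow, div_pow, mul_pow 2, mul_pow √s, ss, su]; field_simp; ring]
    exact Real.sqrt_sq (by positivity)
  have hg : HasDerivAt (fun s : ℝ => (s + u) / (s - u))
      ((1 * (s - u) - (s + u) * 1) / (s - u) ^ 2) s :=
    HasDerivAt.div ((hasDerivAt_id s).add_const u) ((hasDerivAt_id s).sub_const u) hsu.ne'
  have := ((Real.hasDerivAt_arcosh h1).comp s hg).const_mul (1 / (2 * √u))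
  refine this.congr_deriv ?_
  rw [hsq]
  field_simp
  linear_combination 2 * su

lemma hasDerivAt_timeY {u s : ℝ} (hu : 0 < u) (hs0 : 0 < s) :
    HasDerivAt (timeY u) (1 / (2 * √s * (s + u))) s := by
  have hσ : 0 < s + u := by linarith
  have hs' := Real.sqrt_pos.2 hs0
  have hu' := Real.sqrt_pos.2 hu
  have ss := Real.sq_sqrt hs0.le
  have su := Real.sq_sqrt hu.le
  set g := (s - u) / (s + u) with hg
  have hcomp : 1 - g ^ 2 = (2 * (√s * √u) / (s + u)) ^ 2 := by
    rw [hg, div_pow, div_pow, mul_pow 2, mul_pow √s, ss, su]; field_simp; ring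
  have hp : 0 < 2 * (√s * √u) / (s + u) := by positivity
  have hsq : √(1 - g ^ 2) = 2 * (√s * √u) / (s + u) := by rw [hcomp, Real.sqrt_sq hp.le]
  have hlt : g ^ 2 < 1 := by nlinarith [pow_pos hp 2]
  have hne1 : g ≠ -1 := fun e => by rw [e] at hlt; norm_num at hlt
  have hne2 : g ≠ 1 := fun e => by rw [e] at hlt; norm_num at hlt
  have hd : HasDerivAt (fun s : ℝ => (s - u) / (s + u))
      ((1 * (s + u) - (s - u) * 1) / (s + u) ^ 2) s :=
    HasDerivAt.div ((hasDerivAt_id s).sub_const u) ((hasDerivAt_id s).add_const u) hσ.ne'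
  have := ((((Real.hasDerivAt_arccos hne1 hne2).comp s hd).const_sub
    (2 * Real.pi))).const_mul (1 / (2 * √u))
  refine this.congr_deriv ?_
  rw [hsq]
  field_simp
  linear_combination (-2) * su

/-- The logarithm of the quotient of the two sides of the transcendental equation (for
`ε = -1`), and of its companion with the other root (for `ε = 1`). -/
noncomputable def logGap (u₁ u₂ γ : ℝ) (n : ℕ) (ε s : ℝ) : ℝ :=
  Real.log (cFirst u₂ - ε * √(cFirst u₂ ^ 2 - 4 * (s + u₂))) -
    Real.log (cLast u₂ γ + √(cLast u₂ γ ^ 2 - 4 * (s + u₂))) -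
    n * (Real.log (s - u₁) - Real.log (s + u₂))

/-- The derivative of `logGap`. -/
noncomputable def logGapDeriv (u₁ u₂ γ : ℝ) (n : ℕ) (ε s : ℝ) : ℝ :=
  (ε * cFirst u₂ / √(cFirst u₂ ^ 2 - 4 * (s + u₂)) +
    cLast u₂ γ / √(cLast u₂ γ ^ 2 - 4 * (s + u₂))) / (2 * (s + u₂)) -
    n * (u₁ + u₂) / ((s - u₁) * (s + u₂))

variable {u₁ u₂ γ ε s : ℝ} {n : ℕ}

lemma sq_bounds (h₂ : 1 ≤ u₂) (hγ : 1 < γ) (hs' : s ≤ sPlus u₂) :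
    0 < cFirst u₂ ∧ cFirst u₂ < cLast u₂ γ ∧ 4 * (s + u₂) ≤ cFirst u₂ ^ 2 ∧
      4 * (s + u₂) < cLast u₂ γ ^ 2 := by
  have hc : 0 < cFirst u₂ := by rw [cFirst]; linarith
  have hlt := cFirst_lt_cLast h₂ hγ
  have := le_sPlus_iff.1 hs'
  exact ⟨hc, hlt, this, this.trans_lt (by nlinarith)⟩

lemma lt_sPlus_iff : s < sPlus u₂ ↔ 4 * (s + u₂) < cFirst u₂ ^ 2 := by
  rw [sPlus, cFirst, lt_div_iff₀ (by norm_num)]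
  constructor <;> intro h <;> linarith

lemma first_pos (h₁ : 0 < u₁) (h₂ : 1 ≤ u₂) (hε : ε ^ 2 = 1) (hs : u₁ < s)
    (hs' : s ≤ sPlus u₂) : 0 < cFirst u₂ - ε * √(cFirst u₂ ^ 2 - 4 * (s + u₂)) := by
  have hc : 0 < cFirst u₂ := by rw [cFirst]; linarith
  have := add_mul_pos_of_sq (R := √(cFirst u₂ ^ 2 - 4 * (s + u₂))) (ε := -ε) hc
    (by rw [Real.sq_sqrt (by linarith [le_sPlus_iff.1 hs'])]; linarith) (by rw [neg_sq, hε])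
  linarith

lemma hasDerivAt_logGap (h₁ : 0 < u₁) (h₂ : 1 ≤ u₂) (hγ : 1 < γ) (hε : ε ^ 2 = 1) (hs : u₁ < s)
    (hs' : s < sPlus u₂) :
    HasDerivAt (logGap u₁ u₂ γ n ε) (logGapDeriv u₁ u₂ γ n ε s) s := by
  obtain ⟨hc, hcc, -, hl⟩ := sq_bounds h₂ hγ hs'.le
  have hf := lt_sPlus_iff.1 hs'
  have hσ : 0 < s + u₂ := by linarith
  have hsu : 0 < s - u₁ := by linarith
  have hp := first_pos h₁ h₂ hε hs hs'.le
  have r1 := hasDerivAt_root hf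
  have r2 := hasDerivAt_root hl
  have q1 : √(cFirst u₂ ^ 2 - 4 * (s + u₂)) ^ 2 = cFirst u₂ ^ 2 - 4 * (s + u₂) :=
    Real.sq_sqrt (by linarith)
  have q2 : √(cLast u₂ γ ^ 2 - 4 * (s + u₂)) ^ 2 = cLast u₂ γ ^ 2 - 4 * (s + u₂) :=
    Real.sq_sqrt (by linarith)
  have p1 : 0 < √(cFirst u₂ ^ 2 - 4 * (s + u₂)) := Real.sqrt_pos.2 (by linarith)
  have p2 : 0 < √(cLast u₂ γ ^ 2 - 4 * (s + u₂)) := Real.sqrt_pos.2 (by linarith)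
  have hc' : 0 < cLast u₂ γ := hc.trans hcc
  have d := ((((r1.const_mul ε).const_sub (cFirst u₂)).log hp.ne').sub
    ((r2.const_add (cLast u₂ γ)).log (by positivity))).sub
    (((((hasDerivAt_id s).sub_const u₁).log hsu.ne').sub
      (((hasDerivAt_id s).add_const u₂).log hσ.ne')).const_mul (n : ℝ))
  refine d.congr_deriv ?_
  rw [logGapDeriv]
  simp only [id]
  set R := √(cFirst u₂ ^ 2 - 4 * (s + u₂))
  set R' := √(cLast u₂ γ ^ 2 - 4 * (s + u₂))
  have e1 : -(ε * (-2 / R)) / (cFirst u₂ - ε * R) =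
      (ε * cFirst u₂ / R + 1) / (2 * (s + u₂)) := by
    rw [div_eq_div_iff hp.ne' (by positivity)]
    field_simp
    linear_combination (ε * (1/2 : ℝ) * (1 : ℝ)) * q1 * 2 + (cFirst u₂ * R) * hε * 1
  have e2 : -2 / R' / (cLast u₂ γ + R') =
      -((cLast u₂ γ / R' - 1) / (2 * (s + u₂))) := by
    rw [← neg_div, div_eq_div_iff (by positivity) (by positivity)]
    field_simp
    linear_combination -q2
  rw [e1, e2]
  field_simp
  ring

/-- The durations differentiate to the same rational and root terms as `logGap`, up to the common
factor `1 / (2√s)`. The comparison of the branches rests on this proportionality. -/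
lemma hasDerivAt_spiralTime (h₁ : 0 < u₁) (h₂ : 1 ≤ u₂) (hγ : 1 < γ) (hε : ε ^ 2 = 1)
    (hs : u₁ < s) (hs' : s < sPlus u₂) :
    HasDerivAt (spiralTime u₁ u₂ γ n ε) (logGapDeriv u₁ u₂ γ n ε s / (2 * √s)) s := by
  obtain ⟨hc, hcc, -, hl⟩ := sq_bounds h₂ hγ hs'.le
  have hf := lt_sPlus_iff.1 hs'
  have hσ : 0 < s + u₂ := by linarith
  have hsu : 0 < s - u₁ := by linarith
  have hs0 : 0 < s := by linarith
  have hss := Real.sqrt_pos.2 hs0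
  have hu : 0 < u₂ := by linarith
  have hF := hasDerivAt_arcTime hu (hc.trans hcc) hs0 (one_pow 2) hl
  rw [show arcTime u₂ (cLast u₂ γ) 1 = timeFinal u₂ γ from
      funext fun s => (timeFinal_eq u₂ γ s).symm] at hF
  have d := (((hasDerivAt_arcTime hu hc hs0 hε hf).add
    ((hasDerivAt_timeX h₁ hs).const_mul (n : ℝ))).add
    ((hasDerivAt_timeY hu hs0).const_mul ((n : ℝ) - 1))).add hF
  have p1 : 0 < √(cFirst u₂ ^ 2 - 4 * (s + u₂)) := Real.sqrt_pos.2 (by linarith)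
  have p2 : 0 < √(cLast u₂ γ ^ 2 - 4 * (s + u₂)) := Real.sqrt_pos.2 (by linarith)
  refine d.congr_deriv ?_
  rw [logGapDeriv]
  field_simp
  ring

end

section

/-! ### Comparison of the two branches -/

variable {u₁ u₂ γ ε s : ℝ} {n : ℕ} {τ : ℕ → ℝ}

lemma logGap_eq_zero (h₁ : 0 < u₁) (h₂ : 1 ≤ u₂) (hγ : 1 < γ) (hε : ε ^ 2 = 1) (hs : u₁ < s)
    (hs' : s ≤ sPlus u₂) (h : (cFirst u₂ - ε * √(cFirst u₂ ^ 2 - 4 * (s + u₂))) /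
      (cLast u₂ γ + √(cLast u₂ γ ^ 2 - 4 * (s + u₂))) = ((s - u₁) / (s + u₂)) ^ n) :
    logGap u₁ u₂ γ n ε s = 0 := by
  obtain ⟨hc, hcc, -, hl⟩ := sq_bounds h₂ hγ hs'
  have hσ : 0 < s + u₂ := by linarith
  have hsu : 0 < s - u₁ := by linarith
  have hp := first_pos h₁ h₂ hε hs hs'
  have hc' : 0 < cLast u₂ γ := hc.trans hcc
  have := congrArg Real.log h
  rw [Real.log_div hp.ne' (by positivity), Real.log_pow, Real.log_div hsu.ne' hσ.ne'] at this
  rw [logGap, this, sub_self]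

lemma IsRatio.logGap_eq_zero (h : IsRatio u₁ u₂ γ n s) (h₁ : 0 < u₁) (h₂ : 1 ≤ u₂)
    (hγ : 1 < γ) : logGap u₁ u₂ γ n (-1) s = 0 := by
  refine TrapCooling.logGap_eq_zero h₁ h₂ hγ (by norm_num) h.1.1 h.1.2 ?_
  rw [← h.2]; ring

lemma continuousOn_logGap (h₁ : 0 < u₁) (h₂ : 1 ≤ u₂) (hγ : 1 < γ) (hε : ε ^ 2 = 1) :
    ContinuousOn (logGap u₁ u₂ γ n ε) (Ioc u₁ (sPlus u₂)) := by
  have hc : 0 < cLast u₂ γ := by rw [cLast]; positivity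
  unfold logGap
  refine ((ContinuousOn.log (by fun_prop) fun s hs => ?_).sub
    (ContinuousOn.log (by fun_prop) fun s hs => ?_)).sub (continuousOn_const.mul
    ((ContinuousOn.log (by fun_prop) fun s hs => ?_).sub
      (ContinuousOn.log (by fun_prop) fun s hs => ?_)))
  · exact (first_pos h₁ h₂ hε hs.1 hs.2).ne'
  · positivity
  · linarith [hs.1]
  · linarith [hs.1]

lemma continuousOn_arcTime {u c : ℝ} (hu : 0 < u) (hc : 4 * u < c ^ 2) :
    ContinuousOn (arcTime u c ε) (Ioi 0) := by
  have hD : 0 < √(c ^ 2 - 4 * u) := Real.sqrt_pos.2 (by linarith)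
  unfold arcTime
  refine continuousOn_const.mul (Real.continuous_arccos.comp_continuousOn
    (ContinuousOn.div (by fun_prop) (by fun_prop) fun s hs => ?_))
  have : 0 < s + u := by linarith [mem_Ioi.1 hs]
  positivity

lemma continuousOn_spiralTime (h₁ : 0 < u₁) (h₂ : 1 ≤ u₂) (hγ : 1 < γ) :
    ContinuousOn (spiralTime u₁ u₂ γ n ε) (Ioc u₁ (sPlus u₂)) := by
  intro s hs
  have hu : 0 < u₂ := by linarith
  obtain ⟨hc, hcc, hf, hl⟩ := sq_bounds h₂ hγ hs.2
  have hs0 : 0 < s := h₁.trans hs.1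
  have a1 := (continuousOn_arcTime (ε := ε) hu (by linarith : 4 * u₂ < cFirst u₂ ^ 2)).continuousAt
    (Ioi_mem_nhds hs0)
  have a2 := (continuousOn_arcTime (ε := 1) hu (by linarith : 4 * u₂ < cLast u₂ γ ^ 2)).continuousAt
    (Ioi_mem_nhds hs0)
  rw [show arcTime u₂ (cLast u₂ γ) 1 = timeFinal u₂ γ from
      funext fun s => (timeFinal_eq u₂ γ s).symm] at a2
  exact (((a1.add ((hasDerivAt_timeX h₁ hs.1).continuousAt.const_mul (n : ℝ))).add
    ((hasDerivAt_timeY hu hs0).continuousAt.const_mul ((n : ℝ) - 1))).add a2).continuousWithinAt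

/-- A modification of the total duration whose derivative has the sign of
`logGap`. -/
noncomputable def modifiedTime (u₁ u₂ γ : ℝ) (n : ℕ) (ε s : ℝ) : ℝ :=
  spiralTime u₁ u₂ γ n ε s - logGap u₁ u₂ γ n ε s / (2 * √s)

lemma continuousOn_modifiedTime (h₁ : 0 < u₁) (h₂ : 1 ≤ u₂) (hγ : 1 < γ) (hε : ε ^ 2 = 1) :
    ContinuousOn (modifiedTime u₁ u₂ γ n ε) (Ioc u₁ (sPlus u₂)) := by
  refine (continuousOn_spiralTime h₁ h₂ hγ).sub ((continuousOn_logGap h₁ h₂ hγ hε).div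
    (by fun_prop) fun s hs => ?_)
  have := Real.sqrt_pos.2 (h₁.trans hs.1)
  positivity

lemma hasDerivAt_modifiedTime (h₁ : 0 < u₁) (h₂ : 1 ≤ u₂) (hγ : 1 < γ) (hε : ε ^ 2 = 1)
    (hs : u₁ < s) (hs' : s < sPlus u₂) :
    HasDerivAt (modifiedTime u₁ u₂ γ n ε) (logGap u₁ u₂ γ n ε s / (4 * s * √s)) s := by
  have hs0 : 0 < s := h₁.trans hs
  have hss := Real.sqrt_pos.2 hs0
  have ss := Real.sq_sqrt hs0.le
  have d := (hasDerivAt_spiralTime (n := n) h₁ h₂ hγ hε hs hs').sub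
    ((hasDerivAt_logGap (n := n) h₁ h₂ hγ hε hs hs').div
      ((Real.hasDerivAt_sqrt hs0.ne').const_mul 2) (by positivity))
  refine d.congr_deriv ?_
  field_simp
  linear_combination (-4 * logGap u₁ u₂ γ n ε s) * ss

lemma div_root_lt {c c' a : ℝ} (hc : 0 < c) (hcc : c < c') (ha : 0 < a) (h : a < c ^ 2) :
    c' / √(c' ^ 2 - a) < c / √(c ^ 2 - a) := by
  have hsq : c ^ 2 < c' ^ 2 := by nlinarith
  rw [div_lt_div_iff₀ (Real.sqrt_pos.2 (by linarith)) (Real.sqrt_pos.2 (by linarith))]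
  refine lt_of_pow_lt_pow_left₀ 2 (by positivity) ?_
  rw [mul_pow, mul_pow, Real.sq_sqrt (by linarith), Real.sq_sqrt (by linarith)]
  nlinarith

lemma div_root_mono {c a b : ℝ} (hc : 0 < c) (hab : a < b) (h : b < c ^ 2) :
    c / √(c ^ 2 - a) < c / √(c ^ 2 - b) := by
  have : 0 < √(c ^ 2 - b) := Real.sqrt_pos.2 (by linarith)
  exact div_lt_div_of_pos_left hc this (Real.sqrt_lt_sqrt (by linarith) (by linarith))

/-- As `c / √(c² - a)` decreases in `c` and `c₁ < c_{n+1}`, the root terms of the derivative are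
negative for `ε = -1`, and so is the term with `n`. -/
lemma strictAntiOn_logGap (h₁ : 0 < u₁) (h₂ : 1 ≤ u₂) (hγ : 1 < γ) (hn : 1 ≤ n) :
    StrictAntiOn (logGap u₁ u₂ γ n (-1)) (Ioc u₁ (sPlus u₂)) := by
  refine strictAntiOn_of_hasDerivWithinAt_neg (f' := logGapDeriv u₁ u₂ γ n (-1)) (convex_Ioc _ _)
    (continuousOn_logGap h₁ h₂ hγ (by norm_num)) (fun s hs => ?_) fun s hs => ?_
  · rw [interior_Ioc] at hs
    exact (hasDerivAt_logGap h₁ h₂ hγ (by norm_num) hs.1 hs.2).hasDerivWithinAt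
  · rw [interior_Ioc] at hs
    obtain ⟨hc, hcc, -, hl⟩ := sq_bounds h₂ hγ hs.2.le
    have hσ : 0 < s + u₂ := by linarith [hs.1]
    have hsu : 0 < s - u₁ := by linarith [hs.1]
    have := div_root_lt hc hcc (by linarith) (lt_sPlus_iff.1 hs.2)
    have hn' : (1 : ℝ) ≤ n := by exact_mod_cast hn
    have a1 : 0 < n * (u₁ + u₂) / ((s - u₁) * (s + u₂)) := by positivity
    have a2 : (-1 * cFirst u₂ / √(cFirst u₂ ^ 2 - 4 * (s + u₂)) +
      cLast u₂ γ / √(cLast u₂ γ ^ 2 - 4 * (s + u₂))) / (2 * (s + u₂)) < 0 := by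
      refine div_neg_of_neg_of_pos ?_ (by linarith)
      rw [neg_one_mul, neg_div]; linarith
    rw [logGapDeriv]; linarith

/-- The transcendental equation has at most one solution. -/
lemma IsRatio.unique {s' : ℝ} (h : IsRatio u₁ u₂ γ n s) (h' : IsRatio u₁ u₂ γ n s') (h₁ : 0 < u₁)
    (h₂ : 1 ≤ u₂) (hγ : 1 < γ) (hn : 1 ≤ n) : s = s' :=
  (strictAntiOn_logGap h₁ h₂ hγ hn).injOn h.1 h'.1
    ((h.logGap_eq_zero h₁ h₂ hγ).trans (h'.logGap_eq_zero h₁ h₂ hγ).symm)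

lemma logGap_lt (h₁ : 0 < u₁) (h₂ : 1 ≤ u₂) (hs : u₁ < s) (hs' : s < sPlus u₂) :
    logGap u₁ u₂ γ n 1 s < logGap u₁ u₂ γ n (-1) s := by
  have h := first_pos h₁ h₂ (one_pow 2) hs hs'.le
  have hR : 0 < √(cFirst u₂ ^ 2 - 4 * (s + u₂)) :=
    Real.sqrt_pos.2 (by linarith [lt_sPlus_iff.1 hs'])
  have := Real.log_lt_log h (show cFirst u₂ - 1 * √(cFirst u₂ ^ 2 - 4 * (s + u₂)) <
    cFirst u₂ - -1 * √(cFirst u₂ ^ 2 - 4 * (s + u₂)) by linarith)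
  rw [logGap, logGap]; linarith

lemma root_sPlus (u₂ : ℝ) : √(cFirst u₂ ^ 2 - 4 * (sPlus u₂ + u₂)) = 0 := by
  rw [sPlus, cFirst, show (u₂ + 1) ^ 2 - 4 * ((u₂ - 1) ^ 2 / 4 + u₂) = 0 by ring, Real.sqrt_zero]

lemma modifiedTime_sPlus : modifiedTime u₁ u₂ γ n 1 (sPlus u₂) =
    modifiedTime u₁ u₂ γ n (-1) (sPlus u₂) := by
  simp only [modifiedTime, spiralTime, logGap, arcTime, root_sPlus, mul_zero]

/-- The two modified times agree at `s₊`, where the roots of the first arc coincide. Their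
difference has derivative proportional to the difference of the two `logGap`s, which is negative, so
it is nonnegative to the left of `s₊`. -/
lemma modifiedTime_neg_le {a : ℝ} (h₁ : 0 < u₁) (h₂ : 1 ≤ u₂) (hγ : 1 < γ) (ha : u₁ < a)
    (ha' : a ≤ sPlus u₂) : modifiedTime u₁ u₂ γ n (-1) a ≤ modifiedTime u₁ u₂ γ n 1 a := by
  have key : StrictAntiOn (modifiedTime u₁ u₂ γ n 1 - modifiedTime u₁ u₂ γ n (-1))
      (Ioc u₁ (sPlus u₂)) := by
    refine strictAntiOn_of_hasDerivWithinAt_neg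
      (f' := fun s => logGap u₁ u₂ γ n 1 s / (4 * s * √s) - logGap u₁ u₂ γ n (-1) s / (4 * s * √s))
      (convex_Ioc _ _) ((continuousOn_modifiedTime h₁ h₂ hγ (one_pow 2)).sub
        (continuousOn_modifiedTime h₁ h₂ hγ (by norm_num))) (fun s hs => ?_) fun s hs => ?_
    · rw [interior_Ioc] at hs
      exact ((hasDerivAt_modifiedTime h₁ h₂ hγ (one_pow 2) hs.1 hs.2).sub
        (hasDerivAt_modifiedTime h₁ h₂ hγ (by norm_num) hs.1 hs.2)).hasDerivWithinAt
    · rw [interior_Ioc] at hs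
      have hs0 : 0 < s := h₁.trans hs.1
      have := Real.sqrt_pos.2 hs0
      rw [← sub_div]
      exact div_neg_of_neg_of_pos (by linarith [logGap_lt (γ := γ) (n := n) h₁ h₂ hs.1 hs.2])
        (by positivity)
  have := key.antitoneOn ⟨ha, ha'⟩ ⟨ha.trans_le ha', le_rfl⟩ ha'
  simp only [Pi.sub_apply, modifiedTime_sPlus, sub_self] at this
  linarith

/-- The derivative of `logGap` on the `+`-branch changes sign at most once, from `-` to `+`. -/
lemma logGapDeriv_pos {a b : ℝ} (h₁ : 0 < u₁) (h₂ : 1 ≤ u₂) (hγ : 1 < γ) (ha : u₁ < a)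
    (hab : a < b) (hb : b < sPlus u₂) (h : 0 ≤ logGapDeriv u₁ u₂ γ n 1 a) :
    0 < logGapDeriv u₁ u₂ γ n 1 b := by
  -- Cleared of positive denominators, the derivative is an increasing function minus a constant.
  have form : ∀ s, u₁ < s → logGapDeriv u₁ u₂ γ n 1 s * (2 * (s + u₂) * (s - u₁)) =
      (s - u₁) * (cFirst u₂ / √(cFirst u₂ ^ 2 - 4 * (s + u₂)) +
        cLast u₂ γ / √(cLast u₂ γ ^ 2 - 4 * (s + u₂))) - 2 * n * (u₁ + u₂) := by
    intro s hs
    have hσ : s + u₂ ≠ 0 := by linarith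
    have hsu : s - u₁ ≠ 0 := by linarith
    rw [logGapDeriv, one_mul]
    field_simp
  obtain ⟨hc, hcc, -, hl⟩ := sq_bounds h₂ hγ hb.le
  have hf := lt_sPlus_iff.1 hb
  have m1 := div_root_mono hc (show 4 * (a + u₂) < 4 * (b + u₂) by linarith) hf
  have m2 := div_root_mono (hc.trans hcc) (show 4 * (a + u₂) < 4 * (b + u₂) by linarith) hl
  have f1 := form a ha
  have f2 := form b (ha.trans hab)
  have p1 : 0 ≤ cFirst u₂ / √(cFirst u₂ ^ 2 - 4 * (a + u₂)) := by positivity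
  have p2 : 0 ≤ cLast u₂ γ / √(cLast u₂ γ ^ 2 - 4 * (a + u₂)) :=
    div_nonneg (hc.trans hcc).le (Real.sqrt_nonneg _)
  have hA : 0 ≤ logGapDeriv u₁ u₂ γ n 1 a * (2 * (a + u₂) * (a - u₁)) :=
    mul_nonneg h (mul_nonneg (by linarith) (by linarith))
  have hB : 0 < 2 * (b + u₂) * (b - u₁) := mul_pos (by linarith) (by linarith)
  refine pos_of_mul_pos_left ?_ hB.le
  rw [f2]
  rw [f1] at hA
  nlinarith

/-- A solution on the `+`-branch gives a slower transfer than a solution of the transcendental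
equation. -/
lemma IsRatio.spiralTime_lt {s' : ℝ} (h : IsRatio u₁ u₂ γ n s) (h₁ : 0 < u₁) (h₂ : 1 ≤ u₂)
    (hγ : 1 < γ) (hn : 1 ≤ n) (hs : u₁ < s') (hs' : s' < sPlus u₂)
    (h0 : logGap u₁ u₂ γ n 1 s' = 0) :
    spiralTime u₁ u₂ γ n (-1) s < spiralTime u₁ u₂ γ n 1 s' := by
  have hz := h.logGap_eq_zero h₁ h₂ hγ
  have hlt : s' < s := by
    by_contra! hc
    have := (strictAntiOn_logGap h₁ h₂ hγ hn).antitoneOn h.1 ⟨hs, hs'.le⟩ hc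
    linarith [logGap_lt (γ := γ) (n := n) h₁ h₂ hs hs']
  have hsub : Icc s' s ⊆ Ioc u₁ (sPlus u₂) := fun r hr => ⟨hs.trans_le hr.1, hr.2.trans h.1.2⟩
  have hend : logGap u₁ u₂ γ n 1 s ≤ 0 := by
    rcases h.1.2.lt_or_eq with h' | h'
    · exact (logGap_lt h₁ h₂ h.1.1 h').le.trans hz.le
    · rw [← hz, logGap, logGap, h', root_sPlus]; simp
  have hcont := (continuousOn_logGap (n := n) h₁ h₂ hγ (one_pow 2)).mono hsub
  -- Starting at zero and ending nonpositive, a nonnegative interior value would give, by the mean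
  -- value theorem, a nonnegative derivative followed by a nonpositive one.
  have hneg : ∀ p ∈ Ioo s' s, logGap u₁ u₂ γ n 1 p < 0 := by
    intro p hp
    by_contra! hc
    have hd : ∀ r ∈ Ioo s' s, HasDerivAt (logGap u₁ u₂ γ n 1) (logGapDeriv u₁ u₂ γ n 1 r) r :=
      fun r hr => hasDerivAt_logGap h₁ h₂ hγ (one_pow 2) (hs.trans hr.1) (hr.2.trans_le h.1.2)
    obtain ⟨a, ha, ea⟩ := exists_hasDerivAt_eq_slope (logGap u₁ u₂ γ n 1)
      (logGapDeriv u₁ u₂ γ n 1) hp.1 (hcont.mono (Icc_subset_Icc_right hp.2.le))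
      fun r hr => hd r ⟨hr.1, hr.2.trans hp.2⟩
    obtain ⟨b, hb, eb⟩ := exists_hasDerivAt_eq_slope (logGap u₁ u₂ γ n 1)
      (logGapDeriv u₁ u₂ γ n 1) hp.2 (hcont.mono (Icc_subset_Icc_left hp.1.le))
      fun r hr => hd r ⟨hp.1.trans hr.1, hr.2⟩
    have n1 : 0 ≤ logGapDeriv u₁ u₂ γ n 1 a := by
      rw [ea, h0, sub_zero]; exact div_nonneg hc (by linarith [hp.1])
    have n2 : logGapDeriv u₁ u₂ γ n 1 b ≤ 0 := by
      rw [eb]; exact div_nonpos_of_nonpos_of_nonneg (by linarith) (by linarith [hp.2])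
    exact absurd (logGapDeriv_pos h₁ h₂ hγ (hs.trans ha.1) (ha.2.trans hb.1)
      (hb.2.trans_le h.1.2) n1) n2.not_gt
  have hanti : StrictAntiOn (modifiedTime u₁ u₂ γ n 1) (Icc s' s) := by
    refine strictAntiOn_of_hasDerivWithinAt_neg
      (f' := fun s => logGap u₁ u₂ γ n 1 s / (4 * s * √s)) (convex_Icc _ _)
      ((continuousOn_modifiedTime h₁ h₂ hγ (one_pow 2)).mono hsub) (fun r hr => ?_) fun r hr => ?_
    · rw [interior_Icc] at hr
      exact (hasDerivAt_modifiedTime h₁ h₂ hγ (one_pow 2) (hs.trans hr.1)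
        (hr.2.trans_le h.1.2)).hasDerivWithinAt
    · rw [interior_Icc] at hr
      have hr0 : 0 < r := h₁.trans (hs.trans hr.1)
      have := Real.sqrt_pos.2 hr0
      exact div_neg_of_neg_of_pos (hneg r hr) (by positivity)
  -- Along the companion branch the modified time falls from `s'` to `s`, and changing branch at `s`
  -- does not raise it; at both solutions it is the true duration.
  have l1 := hanti (left_mem_Icc.2 hlt.le) (right_mem_Icc.2 hlt.le) hlt
  have l2 := modifiedTime_neg_le (n := n) h₁ h₂ hγ h.1.1 h.1.2
  have l3 := l2.trans_lt l1
  simp only [modifiedTime, hz, h0, zero_div, sub_zero] at l3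
  exact l3

/-- Solvability of the transcendental equation. -/
lemma exists_isRatio (h₂ : 1 ≤ u₂) (hγ : 1 < γ) (hn : 1 ≤ n) (h₁ : 0 < u₁)
    (hlt : u₁ < sPlus u₂)
    (h : cFirst u₂ / (cLast u₂ γ + √(cLast u₂ γ ^ 2 - 4 * (sPlus u₂ + u₂))) ≤
      ((sPlus u₂ - u₁) / (sPlus u₂ + u₂)) ^ n) : ∃ s, IsRatio u₁ u₂ γ n s := by
  have hc : 0 < cLast u₂ γ := by rw [cLast]; positivity
  have hc1 : 0 < cFirst u₂ := by rw [cFirst]; positivity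
  let g : ℝ → ℝ := fun s => (cFirst u₂ + √(cFirst u₂ ^ 2 - 4 * (s + u₂))) /
        (cLast u₂ γ + √(cLast u₂ γ ^ 2 - 4 * (s + u₂))) - ((s - u₁) / (s + u₂)) ^ n
  have hg : ContinuousOn g (Icc u₁ (sPlus u₂)) := by
    refine (ContinuousOn.div (by fun_prop) (by fun_prop) fun s hs => ?_).sub
      ((ContinuousOn.div (by fun_prop) (by fun_prop) fun s hs => ?_).pow n)
    · positivity
    · have : 0 < s + u₂ := by linarith [hs.1]
      exact this.ne'
  -- At `s = u₁` the power vanishes, because `n ≥ 1`.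
  have g0 : 0 < g u₁ := by
    simp only [g, sub_self, zero_div, zero_pow (by omega : n ≠ 0), sub_zero]
    positivity
  have g1 : g (sPlus u₂) ≤ 0 := by
    simp only [g, root_sPlus, add_zero]
    linarith
  obtain ⟨s, hs, e⟩ := intermediate_value_Icc' hlt.le hg ⟨g1, g0.le⟩
  refine ⟨s, ⟨lt_of_le_of_ne hs.1 ?_, hs.2⟩, sub_eq_zero.1 e⟩
  rintro rfl
  exact g0.ne' e

/-! ### Comparison with the one-switching transfer -/

/-- Monotonicity of `sinh (n x) / sinh x` for `x > 0`, cleared of denominators and proved by the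
addition theorem. -/
lemma sinh_mul_le {a b : ℝ} (ha : 0 ≤ a) (hab : a ≤ b) (n : ℕ) :
    Real.sinh (n * a) * Real.sinh b ≤ Real.sinh (n * b) * Real.sinh a := by
  induction n with
  | zero => simp
  | succ n ih =>
    have e : ∀ x : ℝ, ((n + 1 : ℕ) : ℝ) * x = n * x + x := fun x => by push_cast; ring
    rw [e, e, Real.sinh_add, Real.sinh_add]
    have s0 : 0 ≤ Real.sinh a := Real.sinh_nonneg_iff.2 ha
    have s1 : Real.sinh a ≤ Real.sinh b := Real.sinh_le_sinh.2 hab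
    have c1 : Real.cosh a ≤ Real.cosh b :=
      Real.cosh_le_cosh.2 (by rwa [abs_of_nonneg ha, abs_of_nonneg (ha.trans hab)])
    have c2 : Real.cosh (n * a) ≤ Real.cosh (n * b) := by
      refine Real.cosh_le_cosh.2 ?_
      rw [abs_of_nonneg (by positivity), abs_of_nonneg (mul_nonneg n.cast_nonneg (ha.trans hab))]
      gcongr
    have i1 := mul_le_mul_of_nonneg_right ih (Real.cosh_pos a).le
    have s2 : 0 ≤ Real.sinh (n * b) :=
      Real.sinh_nonneg_iff.2 (mul_nonneg n.cast_nonneg (ha.trans hab))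
    have i2 := mul_le_mul_of_nonneg_left c1 (mul_nonneg s2 s0)
    have i3 := mul_le_mul_of_nonneg_right c2 (mul_nonneg s0 (s0.trans s1))
    linarith

lemma timeX_antitone {s' : ℝ} (h₁ : 0 < u₁) (hs : u₁ < s) (hss : s ≤ s') :
    timeX u₁ s' ≤ timeX u₁ s := by
  have hs0 : 0 < s - u₁ := by linarith
  have hs1 : 0 < s' - u₁ := by linarith
  have h0 : 0 < s := h₁.trans hs
  have h0' : 0 < s' := h0.trans_le hss
  refine mul_le_mul_of_nonneg_left ((Real.arcosh_le_arcosh (by positivity) (by positivity)).2 ?_)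
    (by positivity)
  rw [div_le_div_iff₀ hs1 hs0]
  nlinarith

/-- The bound on `y` is the smaller root `(d - √(d² - c²)) / c` of `c y² - 2 d y + c`, so this
quadratic is positive at `y`. -/
lemma lt_half_inv_add {c d y : ℝ} (hc : 0 < c) (hcd : c < d) (hy : 0 < y)
    (h : y < c / (d + √(d ^ 2 - c ^ 2))) : d / c < (y⁻¹ + y) / 2 := by
  have hR2 : √(d ^ 2 - c ^ 2) ^ 2 = d ^ 2 - c ^ 2 := Real.sq_sqrt (by nlinarith)
  have hR0 : 0 ≤ √(d ^ 2 - c ^ 2) := Real.sqrt_nonneg _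
  have hd : 0 < d := hc.trans hcd
  generalize √(d ^ 2 - c ^ 2) = R at *
  rw [lt_div_iff₀ (by positivity)] at h
  have h3 : c * y < d - R := by
    refine lt_of_mul_lt_mul_right ?_ (show 0 ≤ d + R by positivity)
    calc c * y * (d + R) = c * (y * (d + R)) := by ring
      _ < c * c := mul_lt_mul_of_pos_left h hc
      _ = _ := by linear_combination hR2
  have h4 : 0 < (c * y) ^ 2 - 2 * d * (c * y) + c ^ 2 := by nlinarith
  rw [lt_div_iff₀ two_pos, ← sub_pos,
    show y⁻¹ + y - d / c * 2 = ((c * y) ^ 2 - 2 * d * (c * y) + c ^ 2) / (c ^ 2 * y) by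
      field_simp; ring]
  positivity

/-- The radicand is `u₁ (c_{n+1} - c₁) / ((u₁ + u₂) (u₁ + 1))`; the estimate then reduces to `(u₁ -
1) (u₂ - 1) ≥ 0`. -/
lemma oneA_lt {S : ℝ} (h₁ : 1 ≤ u₁) (h₂ : 1 < u₂) (hγ : 1 < γ)
    (h : (cLast u₂ γ - cFirst u₂) * (u₁ * cFirst u₂) / 2 < S * (u₁ + u₂) ^ 2) :
    u₁ * (γ ^ 2 - 1) * (u₂ * γ ^ 2 - 1) / (γ ^ 2 * (u₁ + u₂) * (u₁ + 1)) < S := by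
  have hcc := cFirst_lt_cLast h₂.le hγ
  have hγ2 : 0 < γ ^ 2 := by positivity
  have h12 : 0 < u₁ + u₂ := by linarith
  have hdc : cLast u₂ γ - cFirst u₂ = (γ ^ 2 - 1) * (u₂ * γ ^ 2 - 1) / γ ^ 2 := by
    rw [cLast, cFirst]; field_simp; ring
  have e : u₁ * (γ ^ 2 - 1) * (u₂ * γ ^ 2 - 1) / (γ ^ 2 * (u₁ + u₂) * (u₁ + 1)) =
      u₁ * (cLast u₂ γ - cFirst u₂) / ((u₁ + u₂) * (u₁ + 1)) := by
    rw [hdc]; field_simp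
  rw [e, div_lt_iff₀ (mul_pos h12 (by linarith))]
  have hk : 2 * (u₁ + u₂) ≤ cFirst u₂ * (u₁ + 1) := by
    rw [cFirst]
    linarith [mul_nonneg (sub_nonneg.2 h₁) (sub_nonneg.2 h₂.le)]
  have a8 : u₁ * (cLast u₂ γ - cFirst u₂) * (2 * (u₁ + u₂)) ≤
      u₁ * (cLast u₂ γ - cFirst u₂) * (cFirst u₂ * (u₁ + 1)) :=
    mul_le_mul_of_nonneg_left hk (mul_nonneg (by linarith) (by linarith))
  have a9 := mul_lt_mul_of_pos_right h (show 0 < 2 * (u₁ + 1) by linarith)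
  refine lt_of_mul_lt_mul_right (a := 2 * (u₁ + u₂)) ?_ (by linarith)
  linarith

/-- Where the transcendental inequality fails at `s₊`, the `X`-segments of a spiral take longer
than the `X`-segment of the one-switching transfer. -/
lemma oneX_lt (h₁ : 1 ≤ u₁) (h₂ : 1 < u₂) (hγ : 1 < γ) (hn : 1 ≤ n) (hlt : u₁ < sPlus u₂)
    (h : ((sPlus u₂ - u₁) / (sPlus u₂ + u₂)) ^ n <
      cFirst u₂ / (cLast u₂ γ + √(cLast u₂ γ ^ 2 - 4 * (sPlus u₂ + u₂)))) :
    oneX u₁ u₂ γ < n * timeX u₁ (sPlus u₂) := by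
  have h0 : 0 < u₁ := by linarith
  have hu : 0 < u₂ := by linarith
  obtain ⟨hc, hcc, -, -⟩ := sq_bounds h₂.le hγ (le_refl (sPlus u₂))
  obtain ⟨X1, X2, X3⟩ := timeX_spec h0 hlt
  have hσ4 : 4 * (sPlus u₂ + u₂) = cFirst u₂ ^ 2 := by rw [sPlus, cFirst]; ring
  have hr := ratio_pos_lt_one h0 hu hlt
  set p := sPlus u₂ with hp
  set r := (p - u₁) / (p + u₂) with hrdef
  set X := timeX u₁ p
  set c := cFirst u₂
  set d := cLast u₂ γ
  have hpu : 0 < p - u₁ := by linarith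
  have hσ : 0 < p + u₂ := by linarith
  have hd : 0 < d := hc.trans hcc
  have hsu := Real.sqrt_pos.2 h0
  -- the hyperbolic angle of the ratio
  obtain ⟨l, hl⟩ : ∃ l, l = -Real.log r / 2 := ⟨_, rfl⟩
  have hlpos : 0 < l := by rw [hl]; linarith [Real.log_neg hr.1 hr.2]
  have er : Real.exp (-(2 * l)) = r := by
    rw [hl, show -(2 * (-Real.log r / 2)) = Real.log r by ring, Real.exp_log hr.1]
  have er' : Real.exp (2 * l) = r⁻¹ := by rw [← er, Real.exp_neg, inv_inv]
  have sinh_l : Real.sinh l ^ 2 * (4 * r) = (1 - r) ^ 2 := by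
    have a1 := Real.cosh_two_mul l
    have a2 := Real.cosh_sq l
    have a3 := Real.cosh_eq (2 * l)
    rw [er, er'] at a3
    have : Real.sinh l ^ 2 = ((r⁻¹ + r) / 2 - 1) / 2 := by linarith
    rw [this]; field_simp [hr.1.ne']; ring
  have sinh_l' : Real.sinh l ^ 2 * ((p - u₁) * c ^ 2) = (u₁ + u₂) ^ 2 := by
    have e1 : 1 - r = (u₁ + u₂) / (p + u₂) := by rw [hrdef]; field_simp; ring
    rw [e1, hrdef] at sinh_l
    field_simp at sinh_l
    rw [← hσ4]; linear_combination sinh_l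
  have sinh_X : Real.sinh (√u₁ * X) ^ 2 * (p - u₁) = u₁ := by
    rw [gsin_neg_control h0, div_pow, Real.sq_sqrt h0.le] at X3
    field_simp at X3
    linarith
  have hsl : 0 < Real.sinh l := Real.sinh_pos_iff.2 hlpos
  have hXpos : 0 < √u₁ * X := mul_pos hsu X1
  -- Comparing the squares of the hyperbolic sines, this is `(u₁ + u₂)² ≤ u₁ (u₂ + 1)²`, that is
  -- `(u₁ - 1) (u₂² - u₁) ≥ 0`; `u₁ < s₊` ensures `u₁ ≤ u₂²`.
  have hle : l ≤ √u₁ * X := by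
    have hu12 : u₁ ≤ u₂ ^ 2 := by
      have : u₁ < (u₂ - 1) ^ 2 / 4 := hlt
      nlinarith
    have hcu : (u₁ + u₂) ^ 2 ≤ u₁ * c ^ 2 := by
      have : c = u₂ + 1 := rfl
      rw [this]
      nlinarith [mul_nonneg (sub_nonneg.2 h₁) (sub_nonneg.2 hu12)]
    rw [← Real.sinh_le_sinh]
    refine (pow_le_pow_iff_left₀ hsl.le (Real.sinh_nonneg_iff.2 hXpos.le) two_ne_zero).1 ?_
    refine le_of_mul_le_mul_right ?_ (show 0 < (p - u₁) * c ^ 2 by positivity)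
    calc _ = (u₁ + u₂) ^ 2 := sinh_l'
      _ ≤ _ := hcu
      _ = _ := by rw [← mul_assoc, sinh_X]
  have hmul := sinh_mul_le hlpos.le hle n
  -- With `r = exp (-2 l)`, the failed inequality bounds `r ^ n` above, hence the hyperbolic cosine
  -- of `2 n l` below.
  have hcosh : d / c < Real.cosh (2 * (n * l)) := by
    have ey : Real.exp (-(2 * (n * l))) = r ^ n := by
      rw [← er, ← Real.exp_nat_mul]; congr 1; ring
    have ey' : Real.exp (2 * (n * l)) = (r ^ n)⁻¹ := by rw [← ey, Real.exp_neg, inv_inv]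
    have hy : 0 < r ^ n := pow_pos hr.1 n
    rw [Real.cosh_eq, ey, ey']
    rw [hσ4] at h
    exact lt_half_inv_add hc hcc hy h
  have hA : u₁ * (γ ^ 2 - 1) * (u₂ * γ ^ 2 - 1) / (γ ^ 2 * (u₁ + u₂) * (u₁ + 1)) <
      Real.sinh (√u₁ * (n * X)) ^ 2 := by
    rw [show √u₁ * (n * X) = n * (√u₁ * X) by ring]
    have a1 := Real.cosh_two_mul (n * l)
    have a2 := Real.cosh_sq (n * l)
    have a3 : Real.sinh (n * l) ^ 2 * Real.sinh (√u₁ * X) ^ 2 ≤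
        Real.sinh (n * (√u₁ * X)) ^ 2 * Real.sinh l ^ 2 := by
      rw [← mul_pow, ← mul_pow]
      exact pow_le_pow_left₀ (mul_nonneg (Real.sinh_nonneg_iff.2 (by positivity))
        (Real.sinh_nonneg_iff.2 hXpos.le)) hmul 2
    have a4 : (d / c - 1) / 2 < Real.sinh (n * l) ^ 2 := by linarith
    have a5 : Real.sinh (n * l) ^ 2 * (u₁ * c ^ 2) ≤
        Real.sinh (n * (√u₁ * X)) ^ 2 * (u₁ + u₂) ^ 2 := by
      have := mul_le_mul_of_nonneg_right a3 (show 0 ≤ (p - u₁) * c ^ 2 by positivity)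
      rw [← sinh_l']
      calc _ = Real.sinh (n * l) ^ 2 * (Real.sinh (√u₁ * X) ^ 2 * (p - u₁) * c ^ 2) := by
            rw [sinh_X]
        _ = _ := by ring
        _ ≤ _ := this
        _ = _ := by ring
    have a6 : (d - c) * (u₁ * c) / 2 < Real.sinh (n * l) ^ 2 * (u₁ * c ^ 2) := by
      calc _ = (d / c - 1) / 2 * (u₁ * c ^ 2) := by field_simp
        _ < _ := by gcongr
    exact oneA_lt h₁ h₂ hγ (a6.trans_le a5)
  have hn0 : (0 : ℝ) < n := by exact_mod_cast hn
  refine lt_of_mul_lt_mul_left ?_ hsu.le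
  rw [sinh_oneX h0, ← Real.arsinh_sinh (√u₁ * (n * X)), Real.arsinh_lt_arsinh]
  exact (Real.sqrt_lt' (Real.sinh_pos_iff.2 (by positivity))).2 hA

end

section

/-! ### Time-optimal transfers with turns are spirals -/

lemma contDiff_gcos_gsin {u : ℝ} (hu : u ≠ 0) :
    ContDiff ℝ 1 (gcos u) ∧ ContDiff ℝ 1 (gsin u) := by
  rw [contDiff_one_iff_deriv, contDiff_one_iff_deriv, funext fun t => (hasDerivAt_gcos hu t).deriv,
    funext fun t => (hasDerivAt_gsin hu t).deriv]
  exact ⟨⟨fun t => (hasDerivAt_gcos hu t).differentiableAt,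
    continuous_const.mul (continuous_gsin hu)⟩,
    fun t => (hasDerivAt_gsin hu t).differentiableAt, continuous_gcos hu⟩

/-- The mismatch at the third switching of three consecutive segments. -/
noncomputable def mismatch (v v' : ℝ) (z z' : ℝ × ℝ × ℝ) (p : ℝ × ℝ × ℝ) : ℝ × ℝ :=
  ((flow v' p.2.1 (flow v p.1 z)).1 - (flow v (-p.2.2) z').1,
    (flow v' p.2.1 (flow v p.1 z)).2.1 - (flow v (-p.2.2) z').2.1)

lemma contDiff_mismatch {v v' : ℝ} (hv : v ≠ 0) (hv' : v' ≠ 0) (z z' : ℝ × ℝ × ℝ) :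
    ContDiff ℝ 1 (mismatch v v' z z') := by
  obtain ⟨c, s⟩ := contDiff_gcos_gsin hv
  obtain ⟨c', s'⟩ := contDiff_gcos_gsin hv'
  have h1 : ContDiff ℝ 1 fun p : ℝ × ℝ × ℝ => gcos v p.1 := c.comp contDiff_fst
  have h2 : ContDiff ℝ 1 fun p : ℝ × ℝ × ℝ => gsin v p.1 := s.comp contDiff_fst
  have h3 : ContDiff ℝ 1 fun p : ℝ × ℝ × ℝ => gcos v' p.2.1 := c'.comp contDiff_snd.fst
  have h4 : ContDiff ℝ 1 fun p : ℝ × ℝ × ℝ => gsin v' p.2.1 := s'.comp contDiff_snd.fst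
  have h5 : ContDiff ℝ 1 fun p : ℝ × ℝ × ℝ => gcos v p.2.2 := c.comp contDiff_snd.snd
  have h6 : ContDiff ℝ 1 fun p : ℝ × ℝ × ℝ => gsin v p.2.2 := s.comp contDiff_snd.snd
  unfold mismatch
  simp only [flow, gcos_neg, gsin_neg]
  fun_prop

/-- First-order condition for the middle one of three consecutive segments of minimal total
duration. -/
lemma balanced_of_eventually_le {v v' a b c : ℝ} {z : ℝ × ℝ × ℝ} (hv : v ≠ 0) (hv' : v' ≠ 0)
    (hne : v ≠ v') (hz : IsState z)
    (hmin : ∀ᶠ p : ℝ × ℝ × ℝ in nhds (a, b, c), flow v p.2.2 (flow v' p.2.1 (flow v p.1 z)) =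
      flow v c (flow v' b (flow v a z)) → a + b + c ≤ p.1 + p.2.1 + p.2.2) :
    gsin v' b * (gcos v' b * (flow v a z).1 + gsin v' b * (flow v a z).2.1) = 0 := by
  set P := flow v a z with hP
  set Q := flow v' b P with hQ
  set z' := flow v c Q with hz'
  have sP : IsState P := flow_isState hv a hz
  have sQ : IsState Q := flow_isState hv' b sP
  have sz' : IsState z' := flow_isState hv c sQ
  have hback : flow v (-c) z' = Q := flow_neg_flow hv c Q
  have hG0 : mismatch v v' z z' (a, b, c) = 0 := by
    simp only [mismatch, ← hP, ← hQ, hback, sub_self, Prod.mk_zero_zero]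
  have hstrict := (contDiff_mismatch hv hv' z z').hasStrictFDerivAt
    (x := ((a, b, c) : ℝ × ℝ × ℝ)) one_ne_zero
  set G' := fderiv ℝ (mismatch v v' z z') (a, b, c) with hG'
  let L : ℝ × ℝ × ℝ →L[ℝ] ℝ := ContinuousLinearMap.fst ℝ ℝ (ℝ × ℝ) +
    (ContinuousLinearMap.fst ℝ ℝ ℝ).comp (ContinuousLinearMap.snd ℝ ℝ (ℝ × ℝ)) +
    (ContinuousLinearMap.snd ℝ ℝ ℝ).comp (ContinuousLinearMap.snd ℝ ℝ (ℝ × ℝ))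
  have hL : ∀ p : ℝ × ℝ × ℝ, L p = p.1 + p.2.1 + p.2.2 := fun p => rfl
  -- The constraint compares the forward flow of two segments with the backward flow of the third.
  -- Two coordinates suffice, since the determinant fixes `e`; this leaves three durations under two
  -- scalar constraints.
  have hext : IsLocalExtrOn L {p | mismatch v v' z z' p = mismatch v v' z z' (a, b, c)}
      (a, b, c) := by
    refine Or.inl ?_
    filter_upwards [self_mem_nhdsWithin, mem_nhdsWithin_of_mem_nhds hmin] with p hp hle
    rw [hL, hL]
    refine hle ?_
    replace hp : mismatch v v' z z' p = 0 := Eq.trans hp hG0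
    have e1 := congrArg Prod.fst hp
    have e2 := congrArg Prod.snd hp
    simp only [mismatch, Prod.fst_zero, Prod.snd_zero, sub_eq_zero] at e1 e2
    rw [state_ext (flow_isState hv' _ (flow_isState hv _ hz)) (flow_isState hv _ sz') e1 e2,
      flow_flow_neg hv]
  obtain ⟨Λ, Λ₀, hΛ, hmul⟩ := hext.exists_linear_map_of_hasStrictFDerivAt hstrict
    L.hasStrictFDerivAt
  have hfd := hstrict.hasFDerivAt
  -- the three partial derivatives
  have da : G' (1, 0, 0) = (gcos v' b ^ 2 * (2 * P.2.1) +
      2 * gcos v' b * gsin v' b * (P.2.2 - v * P.1) + gsin v' b ^ 2 * (-2 * v * P.2.1),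
      -v' * gcos v' b * gsin v' b * (2 * P.2.1) + (gcos v' b ^ 2 - v' * gsin v' b ^ 2) *
        (P.2.2 - v * P.1) + gcos v' b * gsin v' b * (-2 * v * P.2.1)) := by
    have hcurve : HasDerivAt (fun r : ℝ => ((r, b, c) : ℝ × ℝ × ℝ)) (1, 0, 0) a :=
      (hasDerivAt_id a).prodMk (hasDerivAt_const a (b, c))
    have h := hfd.comp_hasDerivAt (f := fun r : ℝ => ((r, b, c) : ℝ × ℝ × ℝ)) a hcurve
    have f1 := hasDerivAt_flow_fst hv a z
    have f2 := hasDerivAt_flow_snd hv a z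
    have f3 := hasDerivAt_flow_trd hv a z
    have h' := (((f1.const_mul (gcos v' b ^ 2)).add
        (f2.const_mul (2 * gcos v' b * gsin v' b))).add
        (f3.const_mul (gsin v' b ^ 2))).sub_const ((flow v (-c) z').1) |>.prodMk
      ((((f1.const_mul (-v' * gcos v' b * gsin v' b)).add
        (f2.const_mul (gcos v' b ^ 2 - v' * gsin v' b ^ 2))).add
        (f3.const_mul (gcos v' b * gsin v' b))).sub_const ((flow v (-c) z').2.1))
    exact h.unique h'
  have db : G' (0, 1, 0) = (2 * Q.2.1, Q.2.2 - v' * Q.1) := by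
    have hcurve : HasDerivAt (fun r : ℝ => ((a, r, c) : ℝ × ℝ × ℝ)) (0, 1, 0) b :=
      (hasDerivAt_const b a).prodMk ((hasDerivAt_id b).prodMk (hasDerivAt_const b c))
    have h := hfd.comp_hasDerivAt (f := fun r : ℝ => ((a, r, c) : ℝ × ℝ × ℝ)) b hcurve
    exact h.unique (((hasDerivAt_flow_fst hv' b P).sub_const ((flow v (-c) z').1)).prodMk
      ((hasDerivAt_flow_snd hv' b P).sub_const ((flow v (-c) z').2.1)))
  have dc : G' (0, 0, 1) = (2 * Q.2.1, Q.2.2 - v * Q.1) := by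
    have hcurve : HasDerivAt (fun r : ℝ => ((a, b, r) : ℝ × ℝ × ℝ)) (0, 0, 1) c :=
      (hasDerivAt_const c a).prodMk ((hasDerivAt_const c b).prodMk (hasDerivAt_id c))
    have h := hfd.comp_hasDerivAt (f := fun r : ℝ => ((a, b, r) : ℝ × ℝ × ℝ)) c hcurve
    have n := (hasDerivAt_id c).neg
    have f1 := (((hasDerivAt_flow_fst hv (-c) z').comp c n).const_sub Q.1)
    have f2 := (((hasDerivAt_flow_snd hv (-c) z').comp c n).const_sub Q.2.1)
    refine (h.unique (f1.prodMk f2)).trans ?_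
    rw [hback]; simp
  have ma := hmul (1, 0, 0)
  have mb := hmul (0, 1, 0)
  have mc := hmul (0, 0, 1)
  rw [da, hL] at ma
  rw [db, hL] at mb
  rw [dc, hL] at mc
  have hlin : ∀ r s : ℝ, Λ (r, s) = r * Λ (1, 0) + s * Λ (0, 1) := by
    intro r s
    rw [show ((r, s) : ℝ × ℝ) = r • (1, 0) + s • (0, 1) by simp, map_add, map_smul, map_smul]
    simp
  rw [hlin] at ma mb mc
  simp only [smul_eq_mul, zero_add, add_zero, mul_one] at ma mb mc
  have hvv : v - v' ≠ 0 := sub_ne_zero.2 hne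
  -- The partial derivatives in the second and third durations differ only by `(v' - v) q` in the
  -- `w`-coordinate, and `q > 0`.
  have n2 : Λ (0, 1) = 0 := by
    have : (v - v') * (Q.1 * Λ (0, 1)) = 0 := by linear_combination mb - mc
    exact (mul_eq_zero.1 ((mul_eq_zero.1 this).resolve_left hvv)).resolve_left sQ.1.ne'
  have n1 : Λ (1, 0) ≠ 0 := by
    intro n1
    refine hΛ (Prod.ext ?_ ?_)
    · refine LinearMap.ext fun x => ?_
      obtain ⟨r, s⟩ := x
      simpa [n1, n2] using hlin r s
    · simpa [n1, n2] using mb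
  rw [n2] at ma mb
  have hQ2 : Q.2.1 = -v' * gcos v' b * gsin v' b * P.1 +
      (gcos v' b ^ 2 - v' * gsin v' b ^ 2) * P.2.1 + gcos v' b * gsin v' b * P.2.2 := rfl
  rw [hQ2] at mb
  have : Λ (1, 0) * (v - v') * (gsin v' b * (gcos v' b * P.1 + gsin v' b * P.2.1)) = 0 := by
    linear_combination (mb - ma) / 2
  exact (mul_eq_zero.1 this).resolve_left (mul_ne_zero n1 hvv)

/-- Half a period of `C` and `S` changes both signs, and the flow is quadratic in them. -/
lemma flow_sub_period {u : ℝ} (hu : 0 < u) (t : ℝ) (z : ℝ × ℝ × ℝ) :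
    flow u (t - Real.pi / √u) z = flow u t z := by
  have hu' := Real.sqrt_pos.2 hu
  have e : √u * (t - Real.pi / √u) = √u * t - Real.pi := by field_simp
  have hc : gcos u (t - Real.pi / √u) = -gcos u t := by
    rw [gcos_of_pos hu, gcos_of_pos hu, e, Real.cos_sub_pi]
  have hs : gsin u (t - Real.pi / √u) = -gsin u t := by
    rw [gsin_of_pos hu, gsin_of_pos hu, e, Real.sin_sub_pi, neg_div]
  simp only [flow, hc, hs, neg_sq, mul_neg, neg_mul, neg_neg]

variable {u₁ u₂ γ T : ℝ} {x : ℝ → ℝ × ℝ} {u : ℝ → ℝ} {n : ℕ} {t : ℕ → ℝ}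

lemma IsTimeOptimal.le_sum (ho : IsTimeOptimal u₁ u₂ γ T x u) (h₁ : 0 < u₁) (h₂ : 0 < u₂)
    (hγ : 0 < γ) {τ : ℕ → ℝ} {z : ℕ → ℝ × ℝ × ℝ} (hτ : ∀ k ≤ 2 * n, 0 ≤ τ k)
    (hz : ∀ k ≤ 2 * n, z (k + 1) = flow (turnControl u₁ u₂ k) (τ k) (z k))
    (hz0 : z 0 = (1, 0, 1)) (hzN : z (2 * n + 1) = (γ ^ 2, 0, 1 / γ ^ 2)) :
    T ≤ ∑ k ∈ Finset.range (2 * n + 1), τ k := by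
  obtain ⟨x', u', hx', -⟩ := exists_transfer (u₁ := u₁) (u₂ := u₂) (N := 2 * n)
    (t := fun k => ∑ i ∈ Finset.range k, τ i) (v := turnControl u₁ u₂) (z := z) hγ (by simp)
    (fun k hk => by rw [Finset.sum_range_succ]; linarith [hτ k hk])
    (fun k _ => turnControl_mem h₁ h₂ k) (fun k _ => turnControl_ne_zero h₁ h₂ k)
    (fun k hk => by rw [Finset.sum_range_succ, add_sub_cancel_left]; exact hz k hk) hz0 hzN
  exact ho.2 _ _ _ hx'

/-- Optimality is tested only against chains of the same bang-bang form: deleting a period bounds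
the `Y`-segments, and varying three neighbouring durations gives the balance. -/
lemma HasTurns.isSpiral_of_isTimeOptimal (hb : HasTurns u₁ u₂ T u n t)
    (ho : IsTimeOptimal u₁ u₂ γ T x u) (h₁ : 0 < u₁) (h₂ : 0 < u₂) (hγ : 0 < γ) :
    IsSpiral u₁ u₂ γ n (fun k => t (k + 1) - t k) (fun k => lift (x (t k))) := by
  have hx := ho.1
  have hv0 : ∀ k, turnControl u₁ u₂ k ≠ 0 := turnControl_ne_zero h₁ h₂
  change IsBangBang T u (2 * n) t (turnControl u₁ u₂) at hb
  have hle := hb.le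
  have hlt := hb.2.2.1
  have hsum := hb.sum_eq
  have hstart : lift (x (t 0)) = (1, 0, 1) := by rw [hb.1]; exact lift_start hx
  have hfinish : lift (x (t (2 * n + 1))) = (γ ^ 2, 0, 1 / γ ^ 2) := by
    rw [hb.2.1]; exact lift_finish hx
  have hstep : ∀ k ≤ 2 * n, lift (x (t (k + 1))) =
      flow (turnControl u₁ u₂ k) (t (k + 1) - t k) (lift (x (t k))) := fun k hk =>
    hb.lift_eq_flow hx.trajectory hk (hv0 k) le_rfl (hle k hk) le_rfl
  have hstate : ∀ k ≤ 2 * n + 1, IsState (lift (x (t k))) := by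
    intro k
    induction k with
    | zero => intro _; rw [hstart]; constructor <;> norm_num
    | succ k ih => intro hk; rw [hstep k (by omega)]; exact flow_isState (hv0 k) _ (ih (by omega))
  have hpi : ∀ k ≤ 2 * n, Even k → √u₂ * (t (k + 1) - t k) < Real.pi := by
    intro k hk hev
    by_contra! hc
    have hu' := Real.sqrt_pos.2 h₂
    have := ho.le_sum (n := n) h₁ h₂ hγ (z := fun k => lift (x (t k)))
      (τ := fun i => t (i + 1) - t i - if i = k then Real.pi / √u₂ else 0)
      (fun i hi => ?_) (fun i hi => ?_) hstart hfinish
    · rw [Finset.sum_sub_distrib, hsum, Finset.sum_ite_eq' , if_pos (by simp; omega)] at this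
      have : 0 < Real.pi / √u₂ := div_pos Real.pi_pos hu'
      linarith
    · split_ifs with e
      · subst e
        rw [sub_nonneg, div_le_iff₀ hu']; linarith
      · simpa using hle i hi
    · split_ifs with e
      · subst e
        have := hstep i hi
        rw [turnControl, if_pos hev] at this ⊢
        rw [flow_sub_period h₂]; exact this
      · rw [sub_zero]; exact hstep i hi
  refine ⟨hstart, hfinish, hstep, fun k hk => sub_pos.2 (hlt k hk), hpi, ?_⟩
  intro k hk1 hk
  obtain ⟨m, rfl⟩ : ∃ m, k = m + 1 := ⟨k - 1, by omega⟩
  have hper : turnControl u₁ u₂ (m + 1 + 1) = turnControl u₁ u₂ m := by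
    simp only [turnControl, Nat.even_add_one, not_not]
  have hne : turnControl u₁ u₂ m ≠ turnControl u₁ u₂ (m + 1) := by
    simp only [turnControl, Nat.even_add_one]
    split_ifs <;> (intro h; linarith)
  have e1 := hstep m (by omega)
  have e2 := hstep (m + 1) hk.le
  have e3 := hstep (m + 1 + 1) hk
  have key := balanced_of_eventually_le (a := t (m + 1) - t m) (b := t (m + 1 + 1) - t (m + 1))
    (c := t (m + 1 + 1 + 1) - t (m + 1 + 1)) (hv0 m) (hv0 (m + 1)) hne (hstate m (by omega)) ?_
  · rw [← e1] at key
    refine (mul_eq_zero.1 key).resolve_left ?_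
    have hpos := sub_pos.2 (hlt (m + 1) hk.le)
    rcases Nat.even_or_odd' (m + 1) with ⟨j, hj | hj⟩
    · have := hpi (m + 1) hk.le (hj ▸ even_two_mul j)
      rw [hj] at this hpos ⊢
      rw [turnControl_even]
      exact (gsin_pos h₂ hpos this).ne'
    · rw [hj] at hpos ⊢
      rw [turnControl_odd]
      exact (gsin_neg_control_pos h₁ hpos).ne'
  · have o1 : ∀ᶠ p : ℝ × ℝ × ℝ in nhds (t (m + 1) - t m, t (m + 1 + 1) - t (m + 1),
        t (m + 1 + 1 + 1) - t (m + 1 + 1)), 0 < p.1 ∧ 0 < p.2.1 ∧ 0 < p.2.2 := by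
      refine (IsOpen.inter (isOpen_lt continuous_const continuous_fst)
        (IsOpen.inter (isOpen_lt continuous_const continuous_snd.fst)
          (isOpen_lt continuous_const continuous_snd.snd))).mem_nhds ⟨?_, ?_, ?_⟩
      · exact sub_pos.2 (hlt m (by omega))
      · exact sub_pos.2 (hlt (m + 1) hk.le)
      · exact sub_pos.2 (hlt (m + 1 + 1) hk)
    have d1 : m ≠ m + 1 + 1 := by omega
    -- Nearby positive durations with the same final state yield a full competitor: only the two
    -- switching states inside the triple change.
    filter_upwards [o1] with p hp hflow
    rw [hper] at e3
    rw [← e1, ← e2, ← e3] at hflow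
    have := ho.le_sum (n := n) h₁ h₂ hγ
      (τ := fun i => t (i + 1) - t i + (if i = m then p.1 - (t (m + 1) - t m) else 0) +
        (if i = m + 1 then p.2.1 - (t (m + 1 + 1) - t (m + 1)) else 0) +
        (if i = m + 1 + 1 then p.2.2 - (t (m + 1 + 1 + 1) - t (m + 1 + 1)) else 0))
      (z := fun i => if i = m + 1 then flow (turnControl u₁ u₂ m) p.1 (lift (x (t m)))
        else if i = m + 1 + 1 then flow (turnControl u₁ u₂ (m + 1)) p.2.1
          (flow (turnControl u₁ u₂ m) p.1 (lift (x (t m)))) else lift (x (t i)))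
      (fun i hi => ?_) (fun i hi => ?_) ?_ ?_
    · simp only [Finset.sum_add_distrib, hsum, Finset.sum_ite_eq', Finset.mem_range] at this
      rw [if_pos (by omega), if_pos (by omega), if_pos (by omega)] at this
      linarith
    · by_cases i0 : i = m
      · subst i0; simp [hp.1.le, d1]
      by_cases i1 : i = m + 1
      · subst i1; simp [hp.2.1.le]
      by_cases i2 : i = m + 1 + 1
      · subst i2; simp [hp.2.2.le, d1.symm]
      simp only [i0, i1, i2, if_false, add_zero, sub_nonneg]
      exact hle i hi
    · by_cases i0 : i = m
      · subst i0; simp [d1]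
      by_cases i1 : i = m + 1
      · subst i1; simp
      by_cases i2 : i = m + 1 + 1
      · subst i2; simp [← hflow, hper, d1.symm]
      have j1 : i + 1 ≠ m + 1 := by omega
      have j2 : i + 1 ≠ m + 1 + 1 := by omega
      simp only [i0, i1, i2, j1, j2, if_false, add_zero]
      exact hstep i hi
    · rw [if_neg (by omega), if_neg (by omega), hstart]
    · rw [if_neg (by omega), if_neg (by omega), hfinish]

end

section

/-! ### The minimal duration and the number of turns -/

variable {u₁ u₂ γ T ε s : ℝ} {x : ℝ → ℝ × ℝ} {u : ℝ → ℝ} {n : ℕ} {t τ : ℕ → ℝ}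

lemma timeFinal_nonneg (u₂ γ s : ℝ) : 0 ≤ timeFinal u₂ γ s := by
  rw [timeFinal_eq]; exact arcTime_nonneg _ _ _ _

lemma timeY_nonneg (u₂ s : ℝ) : 0 ≤ timeY u₂ s := by
  have := Real.arccos_le_pi ((s - u₂) / (s + u₂))
  exact mul_nonneg (by positivity) (by linarith [Real.pi_pos])

lemma mul_timeX_add_le (hn : 1 ≤ n) :
    n * timeX u₁ s + timeFinal u₂ γ s ≤ spiralTime u₁ u₂ γ n ε s := by
  have hn' : (1 : ℝ) ≤ n := by exact_mod_cast hn
  have := mul_nonneg (sub_nonneg.2 hn') (timeY_nonneg u₂ s)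
  have := arcTime_nonneg u₂ (cFirst u₂) ε s
  rw [spiralTime]; linarith

lemma HasShape.mul_timeX_le (h : HasShape u₁ u₂ γ n ε s τ) (h₁ : 0 < u₁) (hn : 1 ≤ n) :
    n * timeX u₁ (sPlus u₂) ≤ spiralTime u₁ u₂ γ n ε s := by
  have := mul_le_mul_of_nonneg_left (timeX_antitone h₁ h.lt h.le) (n.cast_nonneg (α := ℝ))
  linarith [mul_timeX_add_le (u₁ := u₁) (u₂ := u₂) (γ := γ) (s := s) (ε := ε) hn,
    timeFinal_nonneg u₂ γ s]

lemma HasShape.le_floor (h : HasShape u₁ u₂ γ n ε s τ) (h₁ : 0 < u₁) (hn : 1 ≤ n)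
    (hle : spiralTime u₁ u₂ γ n ε s ≤ timeZero u₁ u₂ γ) :
    (n : ℤ) ≤ ⌊timeZero u₁ u₂ γ / timeX u₁ (sPlus u₂)⌋ := by
  rw [Int.le_floor, le_div_iff₀ (timeX_spec h₁ (h.lt.trans_le h.le)).1]
  push_cast
  exact (h.mul_timeX_le h₁ hn).trans hle

lemma HasShape.logGap_eq_zero (h : HasShape u₁ u₂ γ n ε s τ) (hε : ε ^ 2 = 1) (h₁ : 0 < u₁)
    (h₂ : 1 ≤ u₂) (hγ : 1 < γ) : logGap u₁ u₂ γ n ε s = 0 :=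
  TrapCooling.logGap_eq_zero h₁ h₂ hγ hε h.lt h.le h.ratio

/-- At `s₊` the discriminant of the first arc vanishes, so the sign `ε` is immaterial. -/
lemma HasShape.neg_of_eq_sPlus (h : HasShape u₁ u₂ γ n 1 (sPlus u₂) τ) :
    HasShape u₁ u₂ γ n (-1) (sPlus u₂) τ := by
  refine ⟨h.lt, h.le, ?_, h.odd, h.even, h.last, ?_⟩
  · rw [h.first]; simp only [arcTime, root_sPlus, mul_zero]
  · rw [← h.ratio]; simp only [root_sPlus, mul_zero]

lemma HasShape.isRatio (h : HasShape u₁ u₂ γ n (-1) s τ) : IsRatio u₁ u₂ γ n s := by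
  refine ⟨⟨h.lt, h.le⟩, ?_⟩
  rw [← h.ratio]; ring

lemma HasShape.hasDurations (h : HasShape u₁ u₂ γ n (-1) s fun k => t (k + 1) - t k) :
    HasDurations u₁ u₂ γ n s t :=
  ⟨by rw [timeInitial_eq]; exact h.first, h.odd, h.even, h.last⟩

lemma HasTurns.eq_spiralTime (hb : HasTurns u₁ u₂ T u n t) (hn : 1 ≤ n)
    (h : HasShape u₁ u₂ γ n ε s fun k => t (k + 1) - t k) : T = spiralTime u₁ u₂ γ n ε s := by
  rw [← h.sum_eq hn, hb.sum_eq]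

/-- The shape of an optimal transfer lies on the branch of the transcendental equation. -/
lemma IsTimeOptimal.hasShape_neg (ho : IsTimeOptimal u₁ u₂ γ T x u)
    (hb : HasTurns u₁ u₂ T u n t) (h₁ : 1 ≤ u₁) (h₂ : 1 ≤ u₂) (hγ : 1 < γ) (hn : 1 ≤ n) :
    ∃ s, HasShape u₁ u₂ γ n (-1) s fun k => t (k + 1) - t k := by
  have h0 : 0 < u₁ := by linarith
  obtain ⟨ε, s, hε, h⟩ := (hb.isSpiral_of_isTimeOptimal ho h0 (by linarith) (by linarith)).hasShape
    h0 h₂ hγ hn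
  rcases hε with rfl | rfl
  swap
  · exact ⟨s, h⟩
  rcases h.le.eq_or_lt with rfl | hs
  · exact ⟨_, h.neg_of_eq_sPlus⟩
  exfalso
  have hT := hb.eq_spiralTime hn h
  have hlt := h.lt.trans hs
  -- The sign at `s₊` decides which competitor beats the companion branch: the extremal from the
  -- main equation if the intermediate value theorem solves it, the one-switching transfer
  -- otherwise.
  rcases le_or_gt (cFirst u₂ / (cLast u₂ γ + √(cLast u₂ γ ^ 2 - 4 * (sPlus u₂ + u₂))))
    (((sPlus u₂ - u₁) / (sPlus u₂ + u₂)) ^ n) with hc | hc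
  · obtain ⟨r, hr⟩ := exists_isRatio h₂ hγ hn h0 hlt hc
    have h' := hr.hasShape hn
    obtain ⟨x', u', hx', -⟩ := exists_spiral h' (by norm_num) h0 h₂ hγ hn
    rw [h'.sum_eq hn] at hx'
    have := ho.2 _ _ _ hx'
    have := hr.spiralTime_lt h0 h₂ hγ hn h.lt hs (h.logGap_eq_zero (one_pow 2) h0 h₂ hγ)
    linarith
  · obtain ⟨x', u', t', hx', -⟩ := exists_one_switching h₁ h₂ hγ
    have := ho.2 _ _ _ hx'
    have a1 := oneX_lt h₁ (h.one_lt h0 h₂) hγ hn hlt hc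
    have a2 := oneY_le_timeFinal h₁ h₂ hγ h.lt h.le
    have a3 := mul_le_mul_of_nonneg_left (timeX_antitone h0 h.lt h.le) (n.cast_nonneg (α := ℝ))
    have a4 := mul_timeX_add_le (u₁ := u₁) (u₂ := u₂) (γ := γ) (s := s) (ε := 1) hn
    rw [timeZero_eq] at this
    linarith

end

end TrapCooling

/-! ### Assembly of the theorem -/

theorem mainTheorem1 (u₁ u₂ γ : ℝ) (hu₁ : 1 ≤ u₁) (hu₂ : 1 ≤ u₂) (hγ : 1 < γ) :
    -- one switching: the least transfer time of the form `XY`, and the only extremal one, is `T₀`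
    (IsLeast {T : ℝ | ∃ x u t, IsTransfer u₁ u₂ γ T x u ∧ IsOneSwitching u₁ u₂ T u t}
        (timeZero u₁ u₂ γ) ∧
      {T : ℝ | ∃ x u t, IsTransfer u₁ u₂ γ T x u ∧ IsExtremal u₁ u₂ T x u ∧
          IsOneSwitching u₁ u₂ T u t} = {timeZero u₁ u₂ γ}) ∧
    ∀ n : ℕ, 1 ≤ n →
      -- the transcendental equation has at most one solution in the interval
      (∀ s s' : ℝ, IsRatio u₁ u₂ γ n s → IsRatio u₁ u₂ γ n s' → s = s') ∧
      -- if it has one, then the extremal with `n` turns and the stated durations exists, and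
      -- `T_n` is the least transfer time of the extremals with `n` turns
      (∀ s : ℝ, IsRatio u₁ u₂ γ n s →
        (∃ x u t, IsTransfer u₁ u₂ γ (timeTurns u₁ u₂ γ n s) x u ∧
          IsExtremal u₁ u₂ (timeTurns u₁ u₂ γ n s) x u ∧
          HasTurns u₁ u₂ (timeTurns u₁ u₂ γ n s) u n t ∧ HasDurations u₁ u₂ γ n s t) ∧
        IsLeast {T : ℝ | ∃ x u t, IsTransfer u₁ u₂ γ T x u ∧ IsExtremal u₁ u₂ T x u ∧
            HasTurns u₁ u₂ T u n t}
          (timeTurns u₁ u₂ γ n s)) ∧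
      -- a time-optimal transfer with `n` turns has these durations, and `n` obeys the bound
      (∀ (T : ℝ) (x : ℝ → ℝ × ℝ) (u : ℝ → ℝ) (t : ℕ → ℝ),
        IsTimeOptimal u₁ u₂ γ T x u → HasTurns u₁ u₂ T u n t →
        (∃ s, IsRatio u₁ u₂ γ n s ∧ HasDurations u₁ u₂ γ n s t ∧
          T = timeTurns u₁ u₂ γ n s) ∧
        (n : ℤ) ≤ ⌊timeZero u₁ u₂ γ / timeX u₁ (sPlus u₂)⌋) ∧
      -- more generally every extremal with `n` turns that is not slower than `T₀` obeys it
      (∀ (T : ℝ) (x : ℝ → ℝ × ℝ) (u : ℝ → ℝ) (t : ℕ → ℝ),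
        IsTransfer u₁ u₂ γ T x u → IsExtremal u₁ u₂ T x u → HasTurns u₁ u₂ T u n t →
        T ≤ timeZero u₁ u₂ γ →
        (n : ℤ) ≤ ⌊timeZero u₁ u₂ γ / timeX u₁ (sPlus u₂)⌋) := by
  have h0 : 0 < u₁ := by linarith
  obtain ⟨x₀, v₀, t₀, hx₀, he₀, hb₀⟩ := exists_one_switching hu₁ hu₂ hγ
  refine ⟨⟨⟨⟨x₀, v₀, t₀, hx₀, hb₀⟩, ?_⟩, ?_⟩, fun n hn => ⟨?_, ?_, ?_, ?_⟩⟩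
  · rintro T ⟨x, u, t, hx, hb⟩
    exact hb.timeZero_le hx h0 hu₂ hγ
  · ext T
    constructor
    · rintro ⟨x, u, t, hx, he, hb⟩
      exact hb.eq_timeZero hx he h0 hu₂ hγ
    · rintro rfl
      exact ⟨x₀, v₀, t₀, hx₀, he₀, hb₀⟩
  · exact fun s s' h h' => h.unique h' h0 hu₂ hγ hn
  · intro s hs
    have h := hs.hasShape hn
    obtain ⟨x, u, hx, he, hb⟩ := exists_spiral h (by norm_num) h0 hu₂ hγ hn
    rw [h.sum_eq hn, ← timeTurns_eq] at hx he hb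
    have hd : HasDurations u₁ u₂ γ n s
        (fun k => ∑ i ∈ Finset.range k, turnDuration u₁ u₂ γ n s i) := by
      refine HasShape.hasDurations ?_
      simpa only [Finset.sum_range_succ_sub_sum] using h
    refine ⟨⟨x, u, _, hx, he, hb, hd⟩, ⟨x, u, _, hx, he, hb⟩, ?_⟩
    rintro T ⟨x', u', t', hx', he', hb'⟩
    obtain ⟨ε, s', hε, h'⟩ := (hb'.isSpiral hx' he' h0 (by linarith) hn).hasShape h0 hu₂ hγ hn
    rw [timeTurns_eq, hb'.eq_spiralTime hn h']
    have hneg : HasShape u₁ u₂ γ n (-1) s' (fun k => t' (k + 1) - t' k) →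
        spiralTime u₁ u₂ γ n (-1) s ≤ T := fun h' => by
      rw [hb'.eq_spiralTime hn h', hs.unique h'.isRatio h0 hu₂ hγ hn]
    -- An arbitrary extremal lies on one of the two branches: on the main one uniqueness of `s`
    -- gives equality, on the companion one the duration is strictly larger unless `s' = s₊`.
    rcases hε with rfl | rfl
    · rcases h'.le.eq_or_lt with rfl | hlt
      · exact (hneg h'.neg_of_eq_sPlus).trans_eq (hb'.eq_spiralTime hn h')
      · exact (hs.spiralTime_lt h0 hu₂ hγ hn h'.lt hlt
          (h'.logGap_eq_zero (one_pow 2) h0 hu₂ hγ)).le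
    · exact (hneg h').trans_eq (hb'.eq_spiralTime hn h')
  · intro T x u t ho hb
    obtain ⟨s, h⟩ := ho.hasShape_neg hb hu₁ hu₂ hγ hn
    have hT := hb.eq_spiralTime hn h
    refine ⟨⟨s, h.isRatio, h.hasDurations, hT.trans (timeTurns_eq _ _ _ _ _).symm⟩,
      h.le_floor h0 hn ?_⟩
    rw [← hT]
    exact ho.2 _ _ _ hx₀
  · intro T x u t hx he hb hle
    obtain ⟨ε, s, -, h⟩ := (hb.isSpiral hx he h0 (by linarith) hn).hasShape h0 hu₂ hγ hn
    refine h.le_floor h0 hn ?_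
    rwa [← hb.eq_spiralTime hn h]
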